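/- **Theorem (counterexample in dimension 3).** For a linear map $A:\mathbb{R}^3\to\mathbb{R}^3$ let $|\Lambda^2A|$ denote the product of its two largest singular values. Let $B$ be the closed unit ball in $\mathbb{R}^3$. If $F:B\to\mathbb{R}^3$ is Lipschitz and differentiable at every point of a set $\Omega\subset B$ of full measure, put $\mathrm{Dil}_2(F)=\sup_{p\in\Omega}|\Lambda^2DF(p)|$. There are constants $C,c>0$ such that for every $N\in\mathbb{N}$ there is a bounded open set $U_N\subset\mathbb{R}^3$ with smooth boundary, whose closure is diffeomorphic to $B$ by a diffeomorphism carrying the open ball onto $U_N$, with the following properties: 1. $\mathrm{area}(\partial U_N)\le C$; 2. every Lipschitz map $F:(B,\partial B)\to(\overline{U_N},\partial U_N)$ whose restriction $F|_{\partial B}:\partial B\to\partial U_N$ has degree $1$ satisfies $\mathrm{Dil}_2(F)\ge c\,N^{1/2}$, for every choice of the full-measure set $\Omega$ on which $F$ is differentiable. Here $\partial B$ and $\partial U_N$ are oriented as the boundaries of $B$ and $U_N$, and $F|_{\partial B}$ has degree $1$ if $\int_{\partial B}F^*\omega=\int_{\partial U_N}\omega$ for every smooth $2$-form $\omega$ on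 $\mathbb{R}^3$. -/

import Mathlib

open Set MeasureTheory
open scoped ContDiff ENNReal

/-- Euclidean three-space. -/
abbrev Space3 : Type := EuclideanSpace ℝ (Fin 3)

/-- `|Λ^k A|`: the product of the `k` largest singular values of `A`, i.e. of the `k` largest
eigenvalues of `√(Aᵀ A)`. (The singular values are listed in decreasing order.) -/
noncomputable def extPowNorm (k : ℕ) (A : Space3 →L[ℝ] Space3) : ℝ :=
  ∏ i ∈ Finset.range k, (A : Space3 →ₗ[ℝ] Space3).singularValues i

/-- The `k`-dilation of a map `F` with domain `s`, computed on the set `Ω` of points of `s` at which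
`F` is differentiable: `sup_{p ∈ Ω} |Λ^k DF(p)|`. -/
noncomputable def kDilation (k : ℕ) (F : Space3 → Space3) (s Ω : Set Space3) : ℝ≥0∞ :=
  ⨆ p ∈ Ω, ENNReal.ofReal (extPowNorm k (fderivWithin ℝ F s p))

/-- `Ω` is a subset of full measure of `s`, at every point of which `F : s → ℝ³` is
differentiable. -/
structure IsFullDiffSet (F : Space3 → Space3) (s Ω : Set Space3) : Prop where
  subset : Ω ⊆ s
  full : volume (s \ Ω) = 0
  diff : ∀ p ∈ Ω, DifferentiableWithinAt ℝ F s p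

/-- Spherical coordinates on the unit sphere, positively oriented with respect to the outward
normal. -/
noncomputable def spherePoint (θ φ : ℝ) : Space3 :=
  !₂[Real.sin θ * Real.cos φ, Real.sin θ * Real.sin φ, Real.cos θ]

/-- The integral `∫_{S²} f^* η` over the unit sphere, oriented as the boundary of the unit ball, of
the pullback of a 2-form `η` on `ℝ³` by a map `f` (Lipschitz on the sphere), computed in spherical
coordinates. Only the values of `f` on the unit sphere matter. -/
noncomputable def spherePullbackIntegral (f : Space3 → Space3)
    (η : Space3 → Space3 [⋀^Fin 2]→L[ℝ] ℝ) : ℝ :=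
  ∫ u : ℝ × ℝ in Ioo 0 Real.pi ×ˢ Ioo 0 (2 * Real.pi),
    η (f (spherePoint u.1 u.2))
      ![deriv (fun t => f (spherePoint t u.2)) u.1, deriv (fun t => f (spherePoint u.1 t)) u.2]

/-- `G` restricts to an orientation-preserving diffeomorphism, smooth up to the boundary, of the
closed unit ball onto the closure of `U`, carrying the open ball onto `U` (and hence the unit sphere
onto the boundary of `U`). -/
structure IsOrientedBallDiffeo (G : Space3 → Space3) (U : Set Space3) : Prop where
  smooth : ∃ V : Set Space3, IsOpen V ∧ Metric.closedBall 0 1 ⊆ V ∧ ContDiffOn ℝ ∞ G V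
  inj : InjOn G (Metric.closedBall 0 1)
  det_pos : ∀ x ∈ Metric.closedBall (0 : Space3) 1, 0 < (fderiv ℝ G x).det
  image_ball : G '' Metric.ball 0 1 = U

/-- `U` is a smooth bounded domain diffeomorphic (up to the boundary) to a ball. A diffeomorphism
can always be taken to preserve orientation, after composition with a reflection of the ball. -/
def IsSmoothBallDomain (U : Set Space3) : Prop :=
  IsOpen U ∧ ∃ G : Space3 → Space3, IsOrientedBallDiffeo G U

/-- The restriction `S² → ∂U` of `F` to the unit sphere has degree `d`:
`∫_{S²} F^* η = d ∫_{∂U} η` for all smooth 2-forms `η`. Here `∂U` is oriented as the boundary of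
`U`, so `∫_{∂U} η = ∫_{S²} G^* η` for an orientation-preserving diffeomorphism `G` from the closed
ball to the closure of `U`. -/
def HasBoundaryDegree (F : Space3 → Space3) (U : Set Space3) (d : ℤ) : Prop :=
  ∃ G : Space3 → Space3, IsOrientedBallDiffeo G U ∧
    ∀ η : Space3 → Space3 [⋀^Fin 2]→L[ℝ] ℝ, ContDiff ℝ ∞ η →
      spherePullbackIntegral F η = d * spherePullbackIntegral G η

/-!
The domain is the unit ball from which two thin fingers have been removed. The fingers enter along
the first axis, with width of order `1 / M`, and then spiral in the plane `z = 0`: in the annulus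
where `3 / 10 ≤ x² + y² ≤ 7 / 10` they turn around the third axis a number of times proportional to
`M = N + 20`. Their length is of order `M` and their girth of order `1 / M`, so the area of the
boundary stays bounded (`exists_area_bound`). Explicitly, the domain is the image of the ball under
`spiralMap`, the composition of a radial contraction near the first axis with a twist about the
third axis.

The lower bound for the two-dilation is a linking, or Hopf invariant, argument. A closed two-form
`ω = db ∧ dc` is supported in a ring `tube` inside the domain, which surrounds a radial segment
crossing all the turns of the fingers. A one-form `α` (`spiralForm`) is such that `dα` is bounded on
the domain independently of `M` (`curlNorm_spiralForm_le`), while the integral of `α ∧ ω` over the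
domain is `-M` (`integral_spiralDomain`): the flux of `dα` runs along the turns of the fingers, and
`dα` is large only near a cut which is contained in the fingers.

Let `F` be a Lipschitz map of the ball to the closure of the domain, of degree one on the boundary,
with two-dilation `D`. Since `α ∧ ω = ∂_y e dx ∧ dy ∧ dz` is the exterior derivative of
`e dz ∧ dx`, the assumption on the degree, together with Stokes' theorem on the ball, shows that
`∫_B F^*(α ∧ ω) = ∫_U α ∧ ω`. In the ball, `F^*dα` has the primitive obtained by integrating along
the rays from the centre, which is bounded by a multiple of `D`. It differs from `F^*α` by an exact
form, and `F^*ω` is closed and vanishes near the sphere; so `F^*α` may be replaced by this primitive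
in the integral of `F^*α ∧ F^*ω`, which is therefore bounded by a multiple of `D ^ 2`
(`abs_integral_le_of_degree_one`). Hence `M ≤ C * D ^ 2`.

Differential forms on the ball are handled in spherical coordinates. A map of the ball becomes a map
of a slightly larger box of parameters, constant or periodic across the faces, and for Lipschitz maps
the identities of forms are obtained from those for smooth maps by mollification.
-/


open Filter Topology Metric
open scoped Convolution

/-! ### The action of a linear map on bivectors -/

/-- `|Λ²A|` is the norm of the map induced by `A` on bivectors: `|Au ∧ Av| ≤ |Λ²A| |u ∧ v|`,
with the norms of the bivectors written as Gram determinants. -/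
lemma gram_image_le (A : Space3 →L[ℝ] Space3) (u v : Space3) :
    ‖A u‖ ^ 2 * ‖A v‖ ^ 2 - (inner ℝ (A u) (A v)) ^ 2
      ≤ (extPowNorm 2 A) ^ 2 * (‖u‖ ^ 2 * ‖v‖ ^ 2 - (inner ℝ u v) ^ 2) := by
  have hn : Module.finrank ℝ Space3 = 3 := by simp
  set T : Space3 →ₗ[ℝ] Space3 := A.toLinearMap with hT
  have hS : (LinearMap.adjoint T ∘ₗ T).IsSymmetric := T.isPositive_adjoint_comp_self.isSymmetric
  set b := hS.eigenvectorBasis hn with hb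
  have key : ∀ x y : Space3, inner ℝ (A x) (A y)
      = ∑ i : Fin 3, T.singularValues i ^ 2 * (b.repr x i * b.repr y i) := by
    intro x y
    have h1 : inner ℝ (A x) (A y) = inner ℝ x ((LinearMap.adjoint T ∘ₗ T) y) := by
      change inner ℝ (T x) (T y) = inner ℝ x (LinearMap.adjoint T (T y))
      rw [LinearMap.adjoint_inner_right]
    rw [h1, ← b.repr.inner_map_map, PiLp.inner_apply]
    refine Finset.sum_congr rfl fun i _ => ?_
    rw [hS.eigenvectorBasis_apply_self_apply hn y i, ← T.sq_singularValues_fin hn i]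
    simp [hb]; ring
  have key' : ∀ x y : Space3, inner ℝ x y = ∑ i, (b.repr x i * b.repr y i) := by
    intro x y
    rw [← b.repr.inner_map_map, PiLp.inner_apply]
    refine Finset.sum_congr rfl fun i _ => ?_
    simp; ring
  have hanti := T.singularValues_antitone
  have h01 : T.singularValues 1 ≤ T.singularValues 0 := hanti (by norm_num)
  have h12 : T.singularValues 2 ≤ T.singularValues 1 := hanti (by norm_num)
  have h2 := T.singularValues_nonneg 2
  rw [← real_inner_self_eq_norm_sq, ← real_inner_self_eq_norm_sq, ← real_inner_self_eq_norm_sq,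
    ← real_inner_self_eq_norm_sq]
  simp only [key, key', Fin.sum_univ_three, extPowNorm, Finset.prod_range_succ,
    Finset.prod_range_zero, one_mul]
  change _ ≤ (T.singularValues 0 * T.singularValues 1) ^ 2 * _
  simp only [Fin.coe_ofNat_eq_mod, Nat.zero_mod, Nat.one_mod, Nat.reduceMod]
  generalize T.singularValues 0 = s0 at *
  generalize T.singularValues 1 = s1 at *
  generalize T.singularValues 2 = s2 at *
  generalize b.repr u 0 = u0
  generalize b.repr u 1 = u1
  generalize b.repr u 2 = u2
  generalize b.repr v 0 = v0
  generalize b.repr v 1 = v1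
  generalize b.repr v 2 = v2
  have h0 : 0 ≤ s0 := by linarith
  have e1 : (s0 * s2) ^ 2 ≤ (s0 * s1) ^ 2 := by gcongr
  have e2 : (s1 * s2) ^ 2 ≤ (s0 * s1) ^ 2 := by
    rw [mul_comm s0 s1]
    have h1 : 0 ≤ s1 := by linarith
    have h3 : s2 ≤ s0 := by linarith
    gcongr
  have f1 := mul_le_mul_of_nonneg_right e1 (sq_nonneg (u0 * v2 - u2 * v0))
  have f2 := mul_le_mul_of_nonneg_right e2 (sq_nonneg (u1 * v2 - u2 * v1))
  linarith

/-! ### Mollification of Lipschitz maps -/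

section Mollification

variable {X E : Type*} [NormedAddCommGroup X] [NormedSpace ℝ X] [FiniteDimensional ℝ X]
  [MeasurableSpace X] [BorelSpace X] [NormedAddCommGroup E] [NormedSpace ℝ E]
  [FiniteDimensional ℝ E]

open ContinuousLinearMap in
/-- Differentiation passes under the mollification of a Lipschitz map: this is where Rademacher's
theorem enters. -/
lemma hasFDerivAt_mollify (μ : Measure X) [μ.IsAddHaarMeasure] (φ : ContDiffBump (0 : X))
    {K : NNReal} {H : X → E} (hH : LipschitzWith K H) (x : X) :
    HasFDerivAt (fun x => ∫ t, φ.normed μ t • H (x - t) ∂μ)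
      (∫ t, φ.normed μ t • fderiv ℝ H (x - t) ∂μ) x := by
  have hφc : Continuous (φ.normed μ) := φ.continuous_normed
  have hHc := hH.continuous
  refine (hasFDerivAt_integral_of_dominated_loc_of_lip (s := univ)
    (F' := fun t => φ.normed μ t • fderiv ℝ H (x - t))
    (bound := fun t => φ.normed μ t * K) univ_mem ?_ ?_ ?_ ?_ ?_ ?_).2
  · exact Eventually.of_forall fun y => by
      apply Continuous.aestronglyMeasurable; fun_prop
  · apply Continuous.integrable_of_hasCompactSupport
    · fun_prop
    · exact φ.hasCompactSupport_normed.smul_right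
  · apply AEStronglyMeasurable.smul hφc.aestronglyMeasurable
    exact ((measurable_fderiv ℝ H).comp (by fun_prop)).aestronglyMeasurable
  · refine Eventually.of_forall fun t => LipschitzWith.lipschitzOnWith ?_
    refine LipschitzWith.of_dist_le_mul fun y z => ?_
    rw [dist_smul₀]
    have h1 := hH.dist_le_mul (y - t) (z - t)
    rw [dist_sub_right] at h1
    have h0 : 0 ≤ φ.normed μ t := φ.nonneg_normed t
    rw [Real.norm_of_nonneg h0, Real.coe_nnabs, abs_of_nonneg (by positivity), mul_assoc]
    exact mul_le_mul_of_nonneg_left h1 h0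
  · exact (φ.integrable_normed).mul_const _
  · have hae : ∀ᵐ t ∂μ, DifferentiableAt ℝ H (x - t) :=
      (μ.measurePreserving_sub_left x).quasiMeasurePreserving.ae hH.ae_differentiableAt
    filter_upwards [hae] with t ht
    have h := ht.hasFDerivAt.comp x ((hasFDerivAt_id x).sub_const t)
    exact h.const_smul (φ.normed μ t)

/-- A Lipschitz map is the uniform limit of smooth maps with the same Lipschitz bound whose
derivatives converge almost everywhere; moreover the approximations inherit the symmetries of the
map under translations. -/
theorem exists_mollification (μ : Measure X) [μ.IsAddHaarMeasure] {K : NNReal} {H : X → E}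
    (hH : LipschitzWith K H) :
    ∃ h : ℕ → X → E, (∀ n, ContDiff ℝ ∞ (h n)) ∧
      (∀ p, Tendsto (fun n => h n p) atTop (𝓝 (H p))) ∧
      (∀ n p, dist (h n p) (H p) ≤ K / (n + 2)) ∧
      (∀ n p, ‖fderiv ℝ (h n) p‖ ≤ K) ∧
      (∀ᵐ p ∂μ, Tendsto (fun n => fderiv ℝ (h n) p) atTop (𝓝 (fderiv ℝ H p))) ∧
      (∀ n x t, (∀ p ∈ ball x (1 / 2), H (p + t) = H p) → h n (x + t) = h n x) := by
  have hpos : ∀ n : ℕ, (0 : ℝ) < 1 / (n + 2) := fun n => by positivity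
  let φ : ℕ → ContDiffBump (0 : X) := fun n =>
    ⟨1 / (n + 2) / 2, 1 / (n + 2), half_pos (hpos n), half_lt_self (hpos n)⟩
  have hφ : Tendsto (fun n => (φ n).rOut) atTop (𝓝 0) := by
    have := (tendsto_one_div_add_atTop_nhds_zero_nat (𝕜 := ℝ)).comp (tendsto_add_atTop_nat 1)
    refine this.congr fun n => ?_
    simp only [Function.comp, φ]; push_cast; ring
  have hHc := hH.continuous
  have hconv : ∀ n p, (∫ t, (φ n).normed μ t • H (p - t) ∂μ)
      = ((φ n).normed μ ⋆[ContinuousLinearMap.lsmul ℝ ℝ, μ] H) p := fun n p => rfl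
  have hder : ∀ n p, fderiv ℝ (fun x => ∫ t, (φ n).normed μ t • H (x - t) ∂μ) p
      = ((φ n).normed μ ⋆[ContinuousLinearMap.lsmul ℝ ℝ, μ] (fderiv ℝ H)) p := fun n p =>
    (hasFDerivAt_mollify μ (φ n) hH p).fderiv
  have hdbd : ∀ p, ‖fderiv ℝ H p‖ ≤ K := fun p => norm_fderiv_le_of_lipschitz ℝ hH
  refine ⟨fun n x => ∫ t, (φ n).normed μ t • H (x - t) ∂μ, fun n => ?_, fun p => ?_,
    fun n p => ?_, fun n p => ?_, ?_, fun n x t hx => ?_⟩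
  · exact (φ n).hasCompactSupport_normed.contDiff_convolution_left
      (ContinuousLinearMap.lsmul ℝ ℝ : ℝ →L[ℝ] E →L[ℝ] E)
      (φ n).contDiff_normed (hHc.locallyIntegrable (μ := μ))
  · exact ContDiffBump.convolution_tendsto_right_of_continuous hφ hHc p
  · change dist (∫ t, (φ n).normed μ t • H (p - t) ∂μ) (H p) ≤ _
    rw [hconv]
    apply ContDiffBump.dist_normed_convolution_le hHc.aestronglyMeasurable
    intro x hx
    have hx' : dist x p < 1 / (n + 2) := hx
    calc dist (H x) (H p) ≤ K * dist x p := hH.dist_le_mul _ _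
      _ ≤ K * (1 / (n + 2)) := by gcongr
      _ = _ := by ring
  · rw [hder, convolution_def]
    calc _ ≤ ∫ t, (φ n).normed μ t * K ∂μ := by
          apply norm_integral_le_of_norm_le ((φ n).integrable_normed.mul_const _)
          refine Eventually.of_forall fun t => ?_
          simp only [ContinuousLinearMap.lsmul_apply]
          rw [norm_smul, Real.norm_of_nonneg ((φ n).nonneg_normed t)]
          exact mul_le_mul_of_nonneg_left (hdbd _) ((φ n).nonneg_normed t)
      _ = K := by rw [integral_mul_const, (φ n).integral_normed, one_mul]
  · have hli : LocallyIntegrable (fderiv ℝ H) μ := by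
      apply (locallyIntegrable_const (K : ℝ)).mono
        (measurable_fderiv ℝ H).aestronglyMeasurable
      refine Eventually.of_forall fun p => ?_
      simpa using hdbd p
    have := ContDiffBump.ae_convolution_tendsto_right_of_locallyIntegrable (φ := φ) (K := 2) hφ
      (Eventually.of_forall fun n => by simp only [φ]; linarith) hli
    filter_upwards [this] with p hp
    simpa only [hder] using hp
  · refine integral_congr_ae (Eventually.of_forall fun s => ?_)
    by_cases hs : s ∈ ball (0 : X) (1 / 2)
    · have : x - s ∈ ball x (1 / 2) := by
        simpa [mem_ball, dist_eq_norm, norm_sub_rev] using hs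
      simp only []
      rw [add_sub_right_comm, hx _ this]
    · have : (φ n).normed μ s = 0 := by
        rw [← Function.notMem_support, (φ n).support_normed_eq]
        intro h
        refine hs (ball_subset_ball ?_ h)
        simp only [φ]
        apply one_div_le_one_div_of_le <;> linarith [Nat.cast_nonneg (α := ℝ) n]
      simp [this]

end Mollification

/-! ### Stokes' theorem on the parameter box -/

/-- The space of parameters `((θ, φ), r)` of spherical coordinates. -/
abbrev Param : Type := (ℝ × ℝ) × ℝ

/-- The coordinate vectors `∂_θ, ∂_φ, ∂_r` of the parameter space. -/
def paramBasis : Fin 3 → Param := ![((1, 0), 0), ((0, 1), 0), ((0, 0), 1)]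

/-- The range of the angles `(θ, φ)`; the polar angle runs over more than `[0, π]`. -/
def angleBox : Set (ℝ × ℝ) := Ioc (-1) 5 ×ˢ Ioc 0 (2 * Real.pi)

/-- The box of parameters over which pulled back forms are integrated. It is larger than the domain
`θ ∈ [0, π]`, `r ∈ [0, 1]` of spherical coordinates, so as to leave room for mollification. -/
def paramBox : Set Param := angleBox ×ˢ Ioc (-1) 2

/-- The determinant of three vectors in coordinate three-space. -/
def det3 (a b c : Fin 3 → ℝ) : ℝ :=
  a 0 * (b 1 * c 2 - b 2 * c 1) - a 1 * (b 0 * c 2 - b 2 * c 0) + a 2 * (b 0 * c 1 - b 1 * c 0)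

/-- The gradient of a function on the parameter space. -/
noncomputable def pgrad (f : Param → ℝ) (p : Param) : Fin 3 → ℝ :=
  fun i => fderiv ℝ f p (paramBasis i)

lemma measurableSet_angleBox : MeasurableSet angleBox := measurableSet_Ioc.prod measurableSet_Ioc

lemma measurableSet_paramBox : MeasurableSet paramBox :=
  measurableSet_angleBox.prod measurableSet_Ioc

lemma angleBox_subset : angleBox ⊆ Icc (-1) 5 ×ˢ Icc 0 (2 * Real.pi) :=
  prod_mono Ioc_subset_Icc_self Ioc_subset_Icc_self

lemma paramBox_subset : paramBox ⊆ (Icc (-1) 5 ×ˢ Icc 0 (2 * Real.pi)) ×ˢ Icc (-1) 2 :=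
  prod_mono angleBox_subset Ioc_subset_Icc_self

lemma Continuous.integrableOn_paramBox {f : Param → ℝ} (hf : Continuous f) :
    IntegrableOn f paramBox :=
  (hf.continuousOn.integrableOn_compact ((isCompact_Icc.prod isCompact_Icc).prod
    isCompact_Icc)).mono_set paramBox_subset

lemma Continuous.integrableOn_angleBox {f : ℝ × ℝ → ℝ} (hf : Continuous f) :
    IntegrableOn f angleBox :=
  (hf.continuousOn.integrableOn_compact (isCompact_Icc.prod isCompact_Icc)).mono_set
    angleBox_subset

/-- The fundamental theorem of calculus over a half-open interval. -/
lemma setIntegral_Ioc_deriv {f f' : ℝ → ℝ} {a b : ℝ} (hab : a ≤ b)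
    (hf : ∀ t, HasDerivAt f (f' t) t) (hf' : Continuous f') :
    ∫ t in Ioc a b, f' t = f b - f a := by
  rw [← intervalIntegral.integral_of_le hab]
  exact intervalIntegral.integral_eq_sub_of_hasDerivAt (fun t _ => hf t)
    (hf'.intervalIntegrable _ _)

lemma HasLineDerivAt.hasDerivAt_line {f : Param → ℝ} {f' : ℝ} {v : Param} {c : ℝ → Param} {t : ℝ}
    (hc : ∀ s, c s = c t + (s - t) • v) (h : HasLineDerivAt ℝ f f' (c t) v) :
    HasDerivAt (fun s => f (c s)) f' t := by
  have h1 : HasDerivAt (fun s => f (c t + s • v)) f' (t - t) := by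
    rw [sub_self]; exact h
  have := h1.comp_sub_const t t
  refine this.congr_of_eventuallyEq (Eventually.of_forall fun s => ?_)
  simp only [hc s]

lemma integral_paramBox_deriv_r {V V' : Param → ℝ} (hV' : Continuous V')
    (h : ∀ p, HasLineDerivAt ℝ V (V' p) p (paramBasis 2)) :
    ∫ p in paramBox, V' p = ∫ q in angleBox, (V (q, 2) - V (q, -1)) := by
  unfold paramBox
  rw [Measure.volume_eq_prod, setIntegral_prod _ hV'.integrableOn_paramBox]
  refine setIntegral_congr_fun measurableSet_angleBox fun q _ => ?_
  refine setIntegral_Ioc_deriv (f := fun t => V (q, t)) (by norm_num) (fun t => ?_) (by fun_prop)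
  refine HasLineDerivAt.hasDerivAt_line (c := fun t => (q, t)) (fun s => ?_) (h (q, t))
  simp [paramBasis]

lemma integral_paramBox_eq_symm {f : Param → ℝ} (hf : Continuous f) :
    ∫ p in paramBox, f p = ∫ r in Ioc (-1) 2, ∫ q in angleBox, f (q, r) := by
  have := hf.integrableOn_paramBox
  unfold paramBox at *
  rw [IntegrableOn, Measure.volume_eq_prod, ← Measure.prod_restrict] at this
  rw [Measure.volume_eq_prod, ← Measure.prod_restrict, integral_prod_symm _ this]

lemma integral_paramBox_deriv_theta {V V' : Param → ℝ} (hV' : Continuous V')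
    (h : ∀ p, HasLineDerivAt ℝ V (V' p) p (paramBasis 0))
    (hb : ∀ φ r, V ((5, φ), r) = V ((-1, φ), r)) :
    ∫ p in paramBox, V' p = 0 := by
  rw [integral_paramBox_eq_symm hV']
  refine (integral_congr_ae (Eventually.of_forall fun r => ?_)).trans (integral_zero _ _)
  have hi := Continuous.integrableOn_angleBox (f := fun q => V' (q, r)) (by fun_prop)
  unfold angleBox at *
  rw [IntegrableOn, Measure.volume_eq_prod, ← Measure.prod_restrict] at hi
  rw [Measure.volume_eq_prod, ← Measure.prod_restrict, integral_prod_symm _ hi]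
  refine (integral_congr_ae (Eventually.of_forall fun φ => ?_)).trans (integral_zero _ _)
  rw [setIntegral_Ioc_deriv (f := fun t => V ((t, φ), r)) (by norm_num) (fun t => ?_)
    (by fun_prop), hb, sub_self]
  refine HasLineDerivAt.hasDerivAt_line (c := fun t => ((t, φ), r)) (fun s => ?_) (h ((t, φ), r))
  simp [paramBasis]

lemma integral_paramBox_deriv_phi {V V' : Param → ℝ} (hV' : Continuous V')
    (h : ∀ p, HasLineDerivAt ℝ V (V' p) p (paramBasis 1))
    (hb : ∀ θ r, V ((θ, 2 * Real.pi), r) = V ((θ, 0), r)) :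
    ∫ p in paramBox, V' p = 0 := by
  rw [integral_paramBox_eq_symm hV']
  refine (integral_congr_ae (Eventually.of_forall fun r => ?_)).trans (integral_zero _ _)
  have hi := Continuous.integrableOn_angleBox (f := fun q => V' (q, r)) (by fun_prop)
  unfold angleBox at *
  rw [Measure.volume_eq_prod] at *
  rw [setIntegral_prod _ hi]
  refine (integral_congr_ae (Eventually.of_forall fun θ => ?_)).trans (integral_zero _ _)
  rw [setIntegral_Ioc_deriv (f := fun t => V ((θ, t), r)) (by positivity) (fun t => ?_)
    (by fun_prop), hb, sub_self]
  refine HasLineDerivAt.hasDerivAt_line (c := fun t => ((θ, t), r)) (fun s => ?_) (h ((θ, t), r))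
  simp [paramBasis]

lemma ContDiff.pgrad {f : Param → ℝ} (hf : ContDiff ℝ ∞ f) (i : Fin 3) :
    ContDiff ℝ ∞ (fun p => pgrad f p i) :=
  (hf.fderiv_right (m := ∞) (by norm_num)).clm_apply contDiff_const

lemma hasLineDerivAt_pgrad {f : Param → ℝ} (hf : ContDiff ℝ ∞ f) (p : Param) (i : Fin 3) :
    HasLineDerivAt ℝ f (pgrad f p i) p (paramBasis i) :=
  ((hf.differentiable (by norm_num)).differentiableAt).hasFDerivAt.hasLineDerivAt _

lemma pgrad_pgrad_comm {f : Param → ℝ} (hf : ContDiff ℝ ∞ f) (p : Param) (i j : Fin 3) :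
    pgrad (fun p => pgrad f p i) p j = pgrad (fun p => pgrad f p j) p i := by
  have hd : DifferentiableAt ℝ (fderiv ℝ f) p :=
    ((hf.fderiv_right (m := ∞) (by norm_num)).differentiable (by norm_num)).differentiableAt
  have hs : IsSymmSndFDerivAt ℝ f p :=
    (contDiff_infty.1 hf 2).contDiffAt.isSymmSndFDerivAt (by simp)
  have key : ∀ k l : Fin 3, pgrad (fun p => pgrad f p k) p l
      = fderiv ℝ (fderiv ℝ f) p (paramBasis l) (paramBasis k) := by
    intro k l
    unfold pgrad
    rw [fderiv_clm_apply hd (by fun_prop)]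
    simp
  rw [key, key, hs.eq]

/-- Stokes' theorem `∫ da ∧ db ∧ dc = ∫_∂ a db ∧ dc` on the parameter box, when only the face
`r = 2` contributes to the boundary integral. -/
theorem integral_det3_pgrad {a : Param → ℝ} {A : Param → Fin 3 → ℝ} {b c : Param → ℝ}
    (ha : Continuous a) (hA : ∀ i, Continuous fun p => A p i)
    (haA : ∀ p i, HasLineDerivAt ℝ a (A p i) p (paramBasis i))
    (hb : ContDiff ℝ ∞ b) (hc : ContDiff ℝ ∞ c)
    (hper : ∀ θ r, a ((θ, 2 * Real.pi), r) = a ((θ, 0), r)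
      ∧ (∀ i, pgrad b ((θ, 2 * Real.pi), r) i = pgrad b ((θ, 0), r) i)
      ∧ (∀ i, pgrad c ((θ, 2 * Real.pi), r) i = pgrad c ((θ, 0), r) i))
    (hr : ∀ q i, pgrad b (q, -1) i = 0)
    (hθ : ∀ θ φ r, (θ = -1 ∨ θ = 5) → pgrad b ((θ, φ), r) 1 = 0 ∧ pgrad c ((θ, φ), r) 1 = 0) :
    ∫ p in paramBox, det3 (A p) (pgrad b p) (pgrad c p) =
      ∫ q in angleBox, a (q, 2) *
        (pgrad b (q, 2) 0 * pgrad c (q, 2) 1 - pgrad b (q, 2) 1 * pgrad c (q, 2) 0) := by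
  have cb : ∀ i, Continuous fun p => pgrad b p i := fun i => (hb.pgrad i).continuous
  have cc : ∀ i, Continuous fun p => pgrad c p i := fun i => (hc.pgrad i).continuous
  have cbb : ∀ i j, Continuous fun p => pgrad (fun p => pgrad b p i) p j :=
    fun i j => ((hb.pgrad i).pgrad j).continuous
  have ccc : ∀ i j, Continuous fun p => pgrad (fun p => pgrad c p i) p j :=
    fun i j => ((hc.pgrad i).pgrad j).continuous
  -- the derivative in direction `k` of `a (b_i c_j - b_j c_i)`
  let W : Fin 3 → Fin 3 → Fin 3 → Param → ℝ := fun i j k p =>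
    A p k * (pgrad b p i * pgrad c p j - pgrad b p j * pgrad c p i) +
    a p * ((pgrad (fun p => pgrad b p i) p k * pgrad c p j
        + pgrad b p i * pgrad (fun p => pgrad c p j) p k)
      - (pgrad (fun p => pgrad b p j) p k * pgrad c p i
        + pgrad b p j * pgrad (fun p => pgrad c p i) p k))
  have hW : ∀ i j k p, HasLineDerivAt ℝ
      (fun p => a p * (pgrad b p i * pgrad c p j - pgrad b p j * pgrad c p i)) (W i j k p) p
      (paramBasis k) := by
    intro i j k p
    have h1 := haA p k
    have hb' := fun i => hasLineDerivAt_pgrad (hb.pgrad i) p k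
    have hc' := fun i => hasLineDerivAt_pgrad (hc.pgrad i) p k
    unfold HasLineDerivAt at *
    have := h1.mul (((hb' i).mul (hc' j)).sub ((hb' j).mul (hc' i)))
    simp only [zero_smul, add_zero, Pi.sub_apply, Pi.mul_apply] at this
    exact this
  have cW : ∀ i j k, Continuous (W i j k) := by
    intro i j k
    have := cb i; have := cb j; have := cc i; have := cc j; have := hA k
    have := cbb i k; have := cbb j k; have := ccc i k; have := ccc j k
    fun_prop
  have hsum : ∀ p, det3 (A p) (pgrad b p) (pgrad c p) = W 1 2 0 p + W 2 0 1 p + W 0 1 2 p := by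
    intro p
    simp only [W, det3]
    rw [pgrad_pgrad_comm hb p 1 0, pgrad_pgrad_comm hb p 2 0, pgrad_pgrad_comm hb p 2 1,
      pgrad_pgrad_comm hc p 1 0, pgrad_pgrad_comm hc p 2 0, pgrad_pgrad_comm hc p 2 1]
    ring
  simp only [hsum]
  rw [integral_add (f := fun p => W 1 2 0 p + W 2 0 1 p)
      ((cW _ _ _).integrableOn_paramBox.add (cW _ _ _).integrableOn_paramBox)
      (cW _ _ _).integrableOn_paramBox,
    integral_add (cW _ _ _).integrableOn_paramBox (cW _ _ _).integrableOn_paramBox,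
    integral_paramBox_deriv_theta (cW 1 2 0) (hW 1 2 0),
    integral_paramBox_deriv_phi (cW 2 0 1) (hW 2 0 1),
    integral_paramBox_deriv_r (cW 0 1 2) (hW 0 1 2), zero_add, zero_add]
  · refine setIntegral_congr_fun measurableSet_angleBox fun q _ => ?_
    simp [hr]
  · intro θ r
    simp only [hper θ r]
  · intro φ r
    have h1 := hθ (-1) φ r (Or.inl rfl)
    have h2 := hθ 5 φ r (Or.inr rfl)
    simp [h1, h2]

/-! ### The Hopf-type integral of a smooth map -/

/-- The gradient of a function on `ℝ³`. -/
noncomputable def sgrad (f : Space3 → ℝ) (x : Space3) : Fin 3 → ℝ :=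
  fun i => fderiv ℝ f x (EuclideanSpace.single i 1)

/-- The value of the covector `a` at the vector `u`. -/
def pairing (a : Fin 3 → ℝ) (u : Space3) : ℝ := ∑ i, a i * u i

/-- The exterior product of two covectors, evaluated at a pair of vectors. -/
def wedge2 (a b : Fin 3 → ℝ) (u v : Space3) : ℝ :=
  pairing a u * pairing b v - pairing a v * pairing b u

/-- The exterior derivative of the one-form `∑ αⱼ dxⱼ`, evaluated at a pair of vectors. -/
noncomputable def dform (α : Fin 3 → Space3 → ℝ) (x : Space3) (u v : Space3) : ℝ :=
  ∑ j, (pairing (sgrad (α j) x) u * v j - pairing (sgrad (α j) x) v * u j)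

/-- The Jacobian determinant of a linear map from the parameter space to `ℝ³`. -/
noncomputable def jacDet (L : Param →L[ℝ] Space3) : ℝ :=
  det3 (L (paramBasis 0)) (L (paramBasis 1)) (L (paramBasis 2))

lemma fderiv_apply_eq_pairing (f : Space3 → ℝ) (x u : Space3) :
    fderiv ℝ f x u = pairing (sgrad f x) u := by
  have h : u = ∑ i, u i • EuclideanSpace.single i (1 : ℝ) := by
    ext j
    simp [Finset.sum_apply, Pi.single_apply]
  conv_lhs => rw [h]
  simp [pairing, sgrad, map_sum, mul_comm]

lemma ContDiff.sgrad {f : Space3 → ℝ} (hf : ContDiff ℝ ∞ f) (i : Fin 3) :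
    ContDiff ℝ ∞ (fun p => sgrad f p i) :=
  (hf.fderiv_right (m := ∞) (by norm_num)).clm_apply contDiff_const

lemma pgrad_comp {f : Space3 → ℝ} (hf : ContDiff ℝ ∞ f) {h : Param → Space3}
    (hh : ContDiff ℝ ∞ h) (p : Param) (j : Fin 3) :
    pgrad (fun p => f (h p)) p j = pairing (sgrad f (h p)) (fderiv ℝ h p (paramBasis j)) := by
  unfold pgrad
  have h1 : DifferentiableAt ℝ f (h p) := (hf.differentiable (by norm_num)).differentiableAt
  have h2 : DifferentiableAt ℝ h p := (hh.differentiable (by norm_num)).differentiableAt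
  have := fderiv_comp p h1 h2
  simp only [Function.comp_def] at this
  rw [this, ContinuousLinearMap.comp_apply, fderiv_apply_eq_pairing]

lemma det3_pairing (a b c : Fin 3 → ℝ) (L : Param →L[ℝ] Space3) :
    det3 (fun j => pairing a (L (paramBasis j))) (fun j => pairing b (L (paramBasis j)))
      (fun j => pairing c (L (paramBasis j))) = det3 a b c * jacDet L := by
  simp only [det3, pairing, jacDet, Fin.sum_univ_three]
  ring

/-- The two-form `db ∧ dc` pulled back by a smooth map. -/
lemma pgrad_minor {b c : Space3 → ℝ} (hb : ContDiff ℝ ∞ b) (hc : ContDiff ℝ ∞ c)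
    {h : Param → Space3} (hh : ContDiff ℝ ∞ h) (p : Param) (i j : Fin 3) :
    pgrad (fun p => b (h p)) p i * pgrad (fun p => c (h p)) p j
      - pgrad (fun p => b (h p)) p j * pgrad (fun p => c (h p)) p i
    = wedge2 (sgrad b (h p)) (sgrad c (h p)) (fderiv ℝ h p (paramBasis i))
        (fderiv ℝ h p (paramBasis j)) := by
  rw [pgrad_comp hb hh, pgrad_comp hb hh, pgrad_comp hc hh, pgrad_comp hc hh, wedge2]

lemma hasDerivAt_intervalIntegral_param {f f' : ℝ → ℝ → ℝ} {a b x₀ : ℝ}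
    (hf : Continuous f.uncurry) (hf' : Continuous f'.uncurry)
    (h : ∀ x t, HasDerivAt (fun x => f x t) (f' x t) x) :
    HasDerivAt (fun x => ∫ t in a..b, f x t) (∫ t in a..b, f' x₀ t) x₀ := by
  obtain ⟨C, hC⟩ := ((isCompact_Icc (a := x₀ - 1) (b := x₀ + 1)).prod
    (isCompact_uIcc (a := a) (b := b))).exists_bound_of_continuousOn hf'.continuousOn
  refine (intervalIntegral.hasDerivAt_integral_of_dominated_loc_of_deriv_le
    (bound := fun _ => C) (s := Icc (x₀ - 1) (x₀ + 1)) (F := f) (F' := f')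
    (Icc_mem_nhds (by linarith) (by linarith)) ?_ ?_ ?_ ?_ ?_ ?_).2
  · exact Eventually.of_forall fun x =>
      (hf.comp (Continuous.prodMk_right x)).aestronglyMeasurable
  · exact (hf.comp (Continuous.prodMk_right x₀)).intervalIntegrable _ _
  · exact (hf'.comp (Continuous.prodMk_right x₀)).aestronglyMeasurable
  · exact Eventually.of_forall fun t ht x hx => hC (x, t) ⟨hx, uIoc_subset_uIcc ht⟩
  · exact intervalIntegrable_const
  · exact Eventually.of_forall fun t _ x _ => h x t

/-- A smooth map on the parameter space which behaves at the faces of the parameter box like the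
composition of a map on the ball with spherical coordinates. -/
structure IsSmoothCylinder (h : Param → Space3) : Prop where
  smooth : ContDiff ℝ ∞ h
  periodic : ∀ p, h (p + (2 * Real.pi) • paramBasis 1) = h p
  pole : ∀ q, fderiv ℝ h (q, -1) = 0
  axis : ∀ θ φ r, (θ = -1 ∨ θ = 5) → fderiv ℝ h ((θ, φ), r) (paramBasis 1) = 0

lemma IsSmoothCylinder.periodic_fderiv {h : Param → Space3} (hh : IsSmoothCylinder h) (p : Param) :
    fderiv ℝ h (p + (2 * Real.pi) • paramBasis 1) = fderiv ℝ h p := by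
  rw [← fderiv_comp_add_right]
  congr 1
  exact funext hh.periodic

lemma IsSmoothCylinder.continuous_fderiv {h : Param → Space3} (hh : IsSmoothCylinder h) :
    Continuous (fderiv ℝ h) :=
  hh.smooth.continuous_fderiv (by norm_num)

lemma pgrad_mul {f g : Param → ℝ} (hf : ContDiff ℝ ∞ f) (hg : ContDiff ℝ ∞ g) (p : Param)
    (j : Fin 3) : pgrad (fun p => f p * g p) p j = f p * pgrad g p j + pgrad f p j * g p := by
  have h1 : DifferentiableAt ℝ f p := (hf.differentiable (by norm_num)).differentiableAt
  have h2 : DifferentiableAt ℝ g p := (hg.differentiable (by norm_num)).differentiableAt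
  simp only [pgrad]
  rw [fderiv_fun_mul h1 h2]
  simp [mul_comm]

lemma pgrad_sum {f : Fin 3 → Param → ℝ} (hf : ∀ i, ContDiff ℝ ∞ (f i)) (p : Param)
    (j : Fin 3) : pgrad (fun p => ∑ i, f i p) p j = ∑ i, pgrad (f i) p j := by
  simp only [pgrad]
  rw [fderiv_fun_sum fun i _ => ((hf i).differentiable (by norm_num)).differentiableAt]
  simp

lemma pgrad_coord {h : Param → Space3} (hh : ContDiff ℝ ∞ h) (p : Param) (i j : Fin 3) :
    pgrad (fun p => h p i) p j = fderiv ℝ h p (paramBasis j) i := by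
  have h2 : DifferentiableAt ℝ h p := (hh.differentiable (by norm_num)).differentiableAt
  have := ((EuclideanSpace.proj (𝕜 := ℝ) i).hasFDerivAt.comp p h2.hasFDerivAt).fderiv
  simp only [pgrad]
  change fderiv ℝ (fun p => h p i) p = _ at this
  rw [this]
  rfl

/-- The coefficient of `dpₖ` in the pullback of the one-form `∑ αᵢ dxᵢ` by `h`. -/
noncomputable def pullCoeff (α : Fin 3 → Space3 → ℝ) (h : Param → Space3) (k : Fin 3)
    (p : Param) : ℝ :=
  pairing (fun i => α i (h p)) (fderiv ℝ h p (paramBasis k))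

section

variable {α : Fin 3 → Space3 → ℝ} {h : Param → Space3}

lemma pullCoeff_eq (hh : ContDiff ℝ ∞ h) (k : Fin 3) :
    pullCoeff α h k = fun p => ∑ i, α i (h p) * pgrad (fun p => h p i) p k := by
  funext p
  simp only [pullCoeff, pairing, pgrad_coord hh]

lemma contDiff_coord (hh : ContDiff ℝ ∞ h) (i : Fin 3) : ContDiff ℝ ∞ (fun p => h p i) :=
  (EuclideanSpace.proj (𝕜 := ℝ) i).contDiff.comp hh

lemma contDiff_pullCoeff (hα : ∀ i, ContDiff ℝ ∞ (α i)) (hh : ContDiff ℝ ∞ h) (k : Fin 3) :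
    ContDiff ℝ ∞ (pullCoeff α h k) := by
  rw [pullCoeff_eq hh]
  exact ContDiff.sum fun i _ => ((hα i).comp hh).mul ((contDiff_coord hh i).pgrad k)

/-- The exterior derivative commutes with the pullback of one-forms. -/
lemma pgrad_pullCoeff_sub (hα : ∀ i, ContDiff ℝ ∞ (α i)) (hh : ContDiff ℝ ∞ h) (j k : Fin 3)
    (p : Param) :
    pgrad (pullCoeff α h k) p j - pgrad (pullCoeff α h j) p k
      = dform α (h p) (fderiv ℝ h p (paramBasis j)) (fderiv ℝ h p (paramBasis k)) := by
  have key : ∀ j k, pgrad (pullCoeff α h k) p j = ∑ i, (α i (h p)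
        * pgrad (fun p => pgrad (fun p => h p i) p k) p j
        + pairing (sgrad (α i) (h p)) (fderiv ℝ h p (paramBasis j))
          * fderiv ℝ h p (paramBasis k) i) := by
    intro j k
    rw [pullCoeff_eq hh, pgrad_sum (f := fun i p => α i (h p) * pgrad (fun p => h p i) p k)
      fun i => ((hα i).comp hh).mul ((contDiff_coord hh i).pgrad k)]
    refine Finset.sum_congr rfl fun i _ => ?_
    rw [pgrad_mul (f := fun p => α i (h p)) ((hα i).comp hh) ((contDiff_coord hh i).pgrad k),
      pgrad_comp (hα i) hh, pgrad_coord hh]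
  rw [key, key, dform, ← Finset.sum_sub_distrib]
  refine Finset.sum_congr rfl fun i _ => ?_
  rw [pgrad_pgrad_comm (contDiff_coord hh i)]
  ring

/-- The radial primitive of the pullback of `dα` by a smooth map: the coefficient of `dpⱼ`. -/
noncomputable def radialPrimitive (α : Fin 3 → Space3 → ℝ) (h : Param → Space3) (j : Fin 3)
    (p : Param) : ℝ :=
  ∫ s in (-1 : ℝ)..p.2, dform α (h (p.1, s)) (fderiv ℝ h (p.1, s) (paramBasis j))
    (fderiv ℝ h (p.1, s) (paramBasis 2))

lemma continuous_dform_fderiv (hα : ∀ i, ContDiff ℝ ∞ (α i)) (hh : ContDiff ℝ ∞ h) (j k : Fin 3) :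
    Continuous fun p => dform α (h p) (fderiv ℝ h p (paramBasis j))
      (fderiv ℝ h p (paramBasis k)) := by
  have : (fun p => dform α (h p) (fderiv ℝ h p (paramBasis j)) (fderiv ℝ h p (paramBasis k)))
      = fun p => pgrad (pullCoeff α h k) p j - pgrad (pullCoeff α h j) p k :=
    funext fun p => (pgrad_pullCoeff_sub hα hh j k p).symm
  rw [this]
  exact (((contDiff_pullCoeff hα hh k).pgrad j).sub
    ((contDiff_pullCoeff hα hh j).pgrad k)).continuous

lemma setIntegral_line_deriv {f : Param → ℝ} (hf : ContDiff ℝ ∞ f) (q : ℝ × ℝ) (a b : ℝ) :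
    ∫ s in a..b, pgrad f (q, s) 2 = f (q, b) - f (q, a) := by
  refine intervalIntegral.integral_eq_sub_of_hasDerivAt (f := fun s => f (q, s)) (fun t _ => ?_)
    (((hf.pgrad 2).continuous.comp (Continuous.prodMk_right q)).intervalIntegrable _ _)
  refine HasLineDerivAt.hasDerivAt_line (c := fun t => (q, t)) (fun s => ?_)
    (hasLineDerivAt_pgrad hf (q, t) 2)
  simp [paramBasis]

/-- The pullback of a one-form differs from the radial primitive of the pullback of its derivative
by an exact form. -/
lemma integral_pgrad_pullCoeff (hα : ∀ i, ContDiff ℝ ∞ (α i)) (hh : IsSmoothCylinder h)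
    (j : Fin 3) (p : Param) :
    ∫ s in (-1 : ℝ)..p.2, pgrad (pullCoeff α h 2) (p.1, s) j
      = pullCoeff α h j p + radialPrimitive α h j p := by
  have h1 : ∀ s, pgrad (pullCoeff α h 2) (p.1, s) j = pgrad (pullCoeff α h j) (p.1, s) 2 +
      dform α (h (p.1, s)) (fderiv ℝ h (p.1, s) (paramBasis j))
        (fderiv ℝ h (p.1, s) (paramBasis 2)) := by
    intro s
    rw [← pgrad_pullCoeff_sub hα hh.smooth]; ring
  simp only [h1]
  have hc := continuous_dform_fderiv hα hh.smooth j 2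
  rw [intervalIntegral.integral_add, setIntegral_line_deriv (contDiff_pullCoeff hα hh.smooth j)]
  · have : pullCoeff α h j (p.1, -1) = 0 := by simp [pullCoeff, hh.pole, pairing]
    rw [this, sub_zero]; rfl
  · exact ((((contDiff_pullCoeff hα hh.smooth j).pgrad 2).continuous).comp
      (Continuous.prodMk_right p.1)).intervalIntegrable _ _
  · exact (hc.comp (Continuous.prodMk_right p.1)).intervalIntegrable _ _

/-- If `h^*(db ∧ dc)` vanishes on the outer face then `h^*α` may be replaced, up to sign, by the
radial primitive of `h^*dα` in the integral of `h^*(α ∧ db ∧ dc)`. -/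
theorem integral_pullback_eq_radialPrimitive (hα : ∀ i, ContDiff ℝ ∞ (α i))
    (hh : IsSmoothCylinder h) {b c : Space3 → ℝ} (hb : ContDiff ℝ ∞ b) (hc : ContDiff ℝ ∞ c)
    (hface : ∀ q x y, wedge2 (sgrad b (h (q, 2))) (sgrad c (h (q, 2))) x y = 0) :
    ∫ p in paramBox, det3 (fun i => α i (h p)) (sgrad b (h p)) (sgrad c (h p))
        * jacDet (fderiv ℝ h p)
      = - ∫ p in paramBox, (radialPrimitive α h 0 p * wedge2 (sgrad b (h p)) (sgrad c (h p))
            (fderiv ℝ h p (paramBasis 1)) (fderiv ℝ h p (paramBasis 2))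
          - radialPrimitive α h 1 p * wedge2 (sgrad b (h p)) (sgrad c (h p))
            (fderiv ℝ h p (paramBasis 0)) (fderiv ℝ h p (paramBasis 2))) := by
  have hs := hh.smooth
  have hL := contDiff_pullCoeff hα hs 2
  set Lf := pullCoeff α h 2 with hLf
  -- `h^*α` and the radial primitive differ, up to sign, by the differential `A` of the integral `g`
  -- of `h^*α` along the rays
  let g : Param → ℝ := fun p => ∫ s in (-1 : ℝ)..p.2, Lf (p.1, s)
  let A : Param → Fin 3 → ℝ := fun p =>
    ![∫ s in (-1 : ℝ)..p.2, pgrad Lf (p.1, s) 0, ∫ s in (-1 : ℝ)..p.2, pgrad Lf (p.1, s) 1, Lf p]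
  have cL : Continuous Lf := hL.continuous
  have cLi : ∀ i, Continuous fun p => pgrad Lf p i := fun i => (hL.pgrad i).continuous
  have cparam : ∀ f : Param → ℝ, Continuous f →
      Continuous fun p : Param => ∫ s in (-1 : ℝ)..p.2, f (p.1, s) := fun f hf =>
    intervalIntegral.continuous_parametric_primitive_of_continuous (f := fun q s => f (q, s))
      (a₀ := -1) hf
  have hA : ∀ i, Continuous fun p => A p i := by
    intro i
    fin_cases i
    · exact cparam _ (cLi 0)
    · exact cparam _ (cLi 1)
    · exact cL
  have hline : ∀ j : Fin 3, (paramBasis j).2 = 0 → ∀ p, HasLineDerivAt ℝ g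
      (∫ s in (-1 : ℝ)..p.2, pgrad Lf (p.1, s) j) p (paramBasis j) := by
    intro j hj p
    have h0 := hasDerivAt_intervalIntegral_param (a := -1) (b := p.2) (x₀ := 0)
      (f := fun t s => Lf (p.1 + t • (paramBasis j).1, s))
      (f' := fun t s => pgrad Lf (p.1 + t • (paramBasis j).1, s) j)
      (by unfold Function.uncurry; fun_prop) (by unfold Function.uncurry; fun_prop)
      (fun x s => HasLineDerivAt.hasDerivAt_line
        (c := fun t => (p.1 + t • (paramBasis j).1, s)) (fun y => by
          ext <;> simp [hj, sub_mul]) (hasLineDerivAt_pgrad hL _ j))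
    simp only [zero_smul, add_zero] at h0
    unfold HasLineDerivAt
    refine h0.congr_of_eventuallyEq (Eventually.of_forall fun t => ?_)
    simp [g, hj]
  have haA : ∀ p i, HasLineDerivAt ℝ g (A p i) p (paramBasis i) := by
    intro p i
    fin_cases i
    · exact hline 0 rfl p
    · exact hline 1 rfl p
    · have h0 : HasDerivAt (fun t => ∫ s in (-1 : ℝ)..t, Lf (p.1, s)) (Lf (p.1, p.2)) p.2 :=
        (cL.comp (Continuous.prodMk_right p.1)).integral_hasStrictDerivAt (-1) p.2 |>.hasDerivAt
      unfold HasLineDerivAt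
      have h1 : HasDerivAt (fun t => ∫ s in (-1 : ℝ)..t, Lf (p.1, s)) (Lf (p.1, p.2)) (p.2 + 0) := by
        rwa [add_zero]
      have h2 := h1.comp_const_add p.2 0
      refine h2.congr_of_eventuallyEq (Eventually.of_forall fun t => ?_)
      have e : p.1 + ((0 : ℝ), (0 : ℝ)) = p.1 := add_zero p.1
      simp [g, paramBasis, e]
  have hper2 : ∀ θ r, h ((θ, 2 * Real.pi), r) = h ((θ, 0), r) ∧
      fderiv ℝ h ((θ, 2 * Real.pi), r) = fderiv ℝ h ((θ, 0), r) := by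
    intro θ r
    have e : ((θ, 2 * Real.pi), r) = ((θ, (0 : ℝ)), r) + (2 * Real.pi) • paramBasis 1 := by
      simp [paramBasis]
    rw [e, hh.periodic, hh.periodic_fderiv]
    exact ⟨rfl, rfl⟩
  have st := integral_det3_pgrad (a := g) (A := A) (b := fun p => b (h p)) (c := fun p => c (h p))
    (cparam _ cL) hA haA (hb.comp hs) (hc.comp hs) ?_ ?_ ?_
  · have hf0 : ∀ q, g (q, 2) * (pgrad (fun p => b (h p)) (q, 2) 0 * pgrad (fun p => c (h p)) (q, 2) 1
        - pgrad (fun p => b (h p)) (q, 2) 1 * pgrad (fun p => c (h p)) (q, 2) 0) = 0 := by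
      intro q
      rw [pgrad_minor hb hc hs, hface, mul_zero]
    simp only [hf0, integral_zero] at st
    have hdecomp : ∀ p, det3 (A p) (pgrad (fun p => b (h p)) p) (pgrad (fun p => c (h p)) p)
        = det3 (fun i => α i (h p)) (sgrad b (h p)) (sgrad c (h p)) * jacDet (fderiv ℝ h p)
        + (radialPrimitive α h 0 p * wedge2 (sgrad b (h p)) (sgrad c (h p))
            (fderiv ℝ h p (paramBasis 1)) (fderiv ℝ h p (paramBasis 2))
          - radialPrimitive α h 1 p * wedge2 (sgrad b (h p)) (sgrad c (h p))
            (fderiv ℝ h p (paramBasis 0)) (fderiv ℝ h p (paramBasis 2))) := by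
      intro p
      rw [← det3_pairing, ← pgrad_minor hb hc hs, ← pgrad_minor hb hc hs]
      have a0 : A p 0 = pullCoeff α h 0 p + radialPrimitive α h 0 p :=
        integral_pgrad_pullCoeff hα hh 0 p
      have a1 : A p 1 = pullCoeff α h 1 p + radialPrimitive α h 1 p :=
        integral_pgrad_pullCoeff hα hh 1 p
      have a2 : A p 2 = pullCoeff α h 2 p := rfl
      simp only [← pgrad_comp hb hs, ← pgrad_comp hc hs]
      simp only [det3, a0, a1, a2, pullCoeff]
      ring
    simp only [hdecomp] at st
    have hcf := hs.continuous_fderiv (n := ∞) (by norm_num)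
    have cb : ∀ i, Continuous fun p => sgrad b (h p) i :=
      fun i => (hb.sgrad i).continuous.comp hs.continuous
    have cc : ∀ i, Continuous fun p => sgrad c (h p) i :=
      fun i => (hc.sgrad i).continuous.comp hs.continuous
    have ca : ∀ i, Continuous fun p => α i (h p) := fun i => (hα i).continuous.comp hs.continuous
    have cw : ∀ i j, Continuous fun p => wedge2 (sgrad b (h p)) (sgrad c (h p))
        (fderiv ℝ h p (paramBasis i)) (fderiv ℝ h p (paramBasis j)) := by
      intro i j; unfold wedge2 pairing; fun_prop
    have cr : ∀ j, Continuous (radialPrimitive α h j) :=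
      fun j => cparam _ (continuous_dform_fderiv hα hs j 2)
    rw [integral_add] at st
    · linarith
    · apply Continuous.integrableOn_paramBox
      unfold jacDet det3
      fun_prop
    · apply Continuous.integrableOn_paramBox
      have := cr 0; have := cr 1; have := cw 1 2; have := cw 0 2
      fun_prop
  · intro θ r
    have e := hper2 θ
    refine ⟨?_, fun i => ?_, fun i => ?_⟩
    · simp only [g, hLf, pullCoeff, (e _).1, (e _).2]
    · rw [pgrad_comp hb hs, pgrad_comp hb hs, (e _).1, (e _).2]
    · rw [pgrad_comp hc hs, pgrad_comp hc hs, (e _).1, (e _).2]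
  · intro q i
    rw [pgrad_comp hb hs, hh.pole]
    simp [pairing]
  · intro θ φ r hθ
    rw [pgrad_comp hb hs, pgrad_comp hc hs, hh.axis θ φ r hθ]
    simp [pairing]

end

/-! ### The Hopf-type inequality for Lipschitz maps -/

/-- A Lipschitz map on the parameter space which is constant where `r ≤ 0`, independent of `r` where
`r ≥ 1`, constant in the angles where `θ ∉ [0, π]`, and `2π`-periodic in `φ`. -/
structure IsLipCylinder (K : NNReal) (H : Param → Space3) : Prop where
  lip : LipschitzWith K H
  periodic : ∀ p, H (p + (2 * Real.pi) • paramBasis 1) = H p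
  pole : ∀ q r, r ≤ 0 → H (q, r) = H ((0, 0), 0)
  outer : ∀ q r, 1 ≤ r → H (q, r) = H (q, 1)
  north : ∀ θ φ r, θ ≤ 0 → H ((θ, φ), r) = H ((0, 0), r)
  south : ∀ θ φ r, Real.pi ≤ θ → H ((θ, φ), r) = H ((Real.pi, 0), r)

lemma mem_ball_param {p x : Param} {ε : ℝ} (h : p ∈ ball x ε) :
    |p.1.1 - x.1.1| < ε ∧ |p.1.2 - x.1.2| < ε ∧ |p.2 - x.2| < ε := by
  rw [mem_ball, Prod.dist_eq, Prod.dist_eq, max_lt_iff, max_lt_iff, Real.dist_eq, Real.dist_eq,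
    Real.dist_eq] at h
  exact ⟨h.1.1, h.1.2, h.2⟩

/-- The smooth approximations of a Lipschitz cylinder map supplied by mollification. -/
structure IsApprox (K : NNReal) (H : Param → Space3) (h : ℕ → Param → Space3) : Prop where
  cyl : ∀ n, IsSmoothCylinder (h n)
  dist_le : ∀ n p, dist (h n p) (H p) ≤ K / (n + 2)
  norm_fderiv_le : ∀ n p, ‖fderiv ℝ (h n) p‖ ≤ K
  tendsto : ∀ p, Tendsto (fun n => h n p) atTop (𝓝 (H p))
  tendsto_fderiv : ∀ᵐ p, Tendsto (fun n => fderiv ℝ (h n) p) atTop (𝓝 (fderiv ℝ H p))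
  outer : ∀ n q r, |r - 2| < 1 / 2 → h n (q, r) = h n (q, 2)

lemma IsLipCylinder.exists_isApprox {K : NNReal} {H : Param → Space3} (hH : IsLipCylinder K H) :
    ∃ h, IsApprox K H h := by
  have h0 : (volume : Measure (ℝ × ℝ)).IsAddHaarMeasure :=
    inferInstanceAs ((volume : Measure ℝ).prod (volume : Measure ℝ)).IsAddHaarMeasure
  have : (volume : Measure Param).IsAddHaarMeasure :=
    inferInstanceAs ((volume : Measure (ℝ × ℝ)).prod (volume : Measure ℝ)).IsAddHaarMeasure
  obtain ⟨h, h1, h2, h3, h4, h5, h6⟩ := exists_mollification (volume : Measure Param) hH.lip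
  refine ⟨h, fun n => ⟨h1 n, fun p => h6 n p _ fun p' _ => hH.periodic p', fun q => ?_,
    fun θ φ r hθ => ?_⟩, h3, h4, h2, h5, fun n q r hr => ?_⟩
  · have : h n =ᶠ[𝓝 (q, -1)] fun _ => h n (q, -1) := by
      filter_upwards [ball_mem_nhds (q, (-1 : ℝ)) (show (0 : ℝ) < 1 / 2 by norm_num)] with x hx
      have e : x = (q, (-1 : ℝ)) + (x - (q, -1)) := by abel
      rw [e]
      apply h6
      intro p hp
      have a1 := (abs_lt.1 (mem_ball_param hp).2.2).2
      have a2 := (abs_lt.1 (mem_ball_param hx).2.2).2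
      simp only at a1 a2
      exact (hH.pole (p + (x - (q, -1))).1 (p + (x - (q, -1))).2 (by simp; linarith)).trans
        (hH.pole p.1 p.2 (by linarith)).symm
    rw [this.fderiv_eq]; simp
  · have hd : DifferentiableAt ℝ (h n) ((θ, φ), r) :=
      ((h1 n).differentiable (by norm_num)).differentiableAt
    have hl := hd.hasFDerivAt.hasLineDerivAt (paramBasis 1)
    have hconst : (fun t : ℝ => h n (((θ, φ), r) + t • paramBasis 1)) = fun _ => h n ((θ, φ), r) := by
      funext t
      apply h6
      rintro ⟨⟨a, b⟩, c⟩ hp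
      have a1 := abs_lt.1 (mem_ball_param hp).1
      simp only at a1
      have hpi := Real.pi_lt_d2
      rcases hθ with rfl | rfl
      · simp [paramBasis, hH.north a _ _ (by linarith)]
      · simp [paramBasis, hH.south a _ _ (by linarith)]
    unfold HasLineDerivAt at hl
    rw [hconst] at hl
    exact hl.unique (hasDerivAt_const _ _)
  · have e : (q, r) = (q, (2 : ℝ)) + (0, r - 2) := by simp
    rw [e]
    apply h6
    rintro ⟨a, c⟩ hp
    have a1 := abs_lt.1 (mem_ball_param hp).2.2
    have a2 := abs_lt.1 hr
    simp only at a1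
    simp only [Prod.mk_add_mk, add_zero]
    rw [hH.outer a (c + (r - 2)) (by linarith), hH.outer a c (by linarith)]

section

variable {K : NNReal} {H : Param → Space3} {h : ℕ → Param → Space3}

/-- A continuous function of the one-jet of the approximations is uniformly bounded on the box. -/
lemma IsApprox.exists_bound (hH : IsLipCylinder K H) (hh : IsApprox K H h)
    {Φ : Space3 × (Param →L[ℝ] Space3) → ℝ} (hΦ : Continuous Φ) :
    ∃ C, ∀ n, ∀ p ∈ (Icc (-1) 5 ×ˢ Icc 0 (2 * Real.pi)) ×ˢ Icc (-1 : ℝ) 2,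
      ‖Φ (h n p, fderiv ℝ (h n) p)‖ ≤ C := by
  have hc : IsCompact ((Icc (-1 : ℝ) 5 ×ˢ Icc 0 (2 * Real.pi)) ×ˢ Icc (-1 : ℝ) 2) :=
    (isCompact_Icc.prod isCompact_Icc).prod isCompact_Icc
  obtain ⟨R, hR⟩ := hc.exists_bound_of_continuousOn hH.lip.continuous.continuousOn
  obtain ⟨C, hC⟩ := ((isCompact_closedBall (0 : Space3) (R + K)).prod
    (isCompact_closedBall (0 : Param →L[ℝ] Space3) K)).exists_bound_of_continuousOn
      hΦ.continuousOn
  refine ⟨C, fun n p hp => hC _ ⟨?_, ?_⟩⟩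
  · rw [mem_closedBall_zero_iff]
    have h1 := hh.dist_le n p
    have h2 : (K : ℝ) / (n + 2) ≤ K := div_le_self K.2 (by linarith [Nat.cast_nonneg (α := ℝ) n])
    calc ‖h n p‖ = ‖H p + (h n p - H p)‖ := by congr 1; abel
      _ ≤ ‖H p‖ + ‖h n p - H p‖ := norm_add_le _ _
      _ ≤ R + K := by
        rw [← dist_eq_norm]
        exact add_le_add (hR p hp) (h1.trans h2)
  · rw [mem_closedBall_zero_iff]
    exact hh.norm_fderiv_le n p

lemma IsApprox.continuous_jet (hh : IsApprox K H h)
    {Φ : Space3 × (Param →L[ℝ] Space3) → ℝ} (hΦ : Continuous Φ) (n : ℕ) :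
    Continuous fun p => Φ (h n p, fderiv ℝ (h n) p) :=
  hΦ.comp ((hh.cyl n).smooth.continuous.prodMk (hh.cyl n).continuous_fderiv)

lemma IsApprox.tendsto_jet (hh : IsApprox K H h)
    {Φ : Space3 × (Param →L[ℝ] Space3) → ℝ} (hΦ : Continuous Φ) :
    ∀ᵐ p, Tendsto (fun n => Φ (h n p, fderiv ℝ (h n) p)) atTop (𝓝 (Φ (H p, fderiv ℝ H p))) := by
  filter_upwards [hh.tendsto_fderiv] with p hp
  exact (hΦ.tendsto _).comp ((hh.tendsto p).prodMk_nhds hp)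

lemma volume_paramBox_lt_top : volume paramBox < ⊤ :=
  (measure_mono paramBox_subset).trans_lt
    ((isCompact_Icc.prod isCompact_Icc).prod isCompact_Icc).measure_lt_top

lemma volume_angleBox_lt_top : volume angleBox < ⊤ :=
  (measure_mono angleBox_subset).trans_lt (isCompact_Icc.prod isCompact_Icc).measure_lt_top

lemma IsApprox.tendsto_integral (hH : IsLipCylinder K H) (hh : IsApprox K H h)
    {Φ : Space3 × (Param →L[ℝ] Space3) → ℝ} (hΦ : Continuous Φ) :
    Tendsto (fun n => ∫ p in paramBox, Φ (h n p, fderiv ℝ (h n) p)) atTop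
      (𝓝 (∫ p in paramBox, Φ (H p, fderiv ℝ H p))) := by
  obtain ⟨C, hC⟩ := hh.exists_bound hH hΦ
  have : Fact (volume paramBox < ⊤) := ⟨volume_paramBox_lt_top⟩
  refine tendsto_integral_of_dominated_convergence (fun _ => C)
    (fun n => (hh.continuous_jet hΦ n).aestronglyMeasurable) (integrable_const _) (fun n => ?_)
    (ae_restrict_of_ae (hh.tendsto_jet hΦ))
  filter_upwards [ae_restrict_mem measurableSet_paramBox] with p hp
  exact hC n p (paramBox_subset hp)

lemma IsApprox.tendsto_integral_ray (hH : IsLipCylinder K H) (hh : IsApprox K H h)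
    {Φ : Space3 × (Param →L[ℝ] Space3) → ℝ} (hΦ : Continuous Φ) :
    ∀ᵐ q ∂volume.restrict angleBox,
      Tendsto (fun n => ∫ s in Ioc (-1 : ℝ) 2, Φ (h n (q, s), fderiv ℝ (h n) (q, s))) atTop
      (𝓝 (∫ s in Ioc (-1 : ℝ) 2, Φ (H (q, s), fderiv ℝ H (q, s)))) := by
  obtain ⟨C, hC⟩ := hh.exists_bound hH hΦ
  have h1 := hh.tendsto_jet hΦ
  rw [Measure.volume_eq_prod] at h1
  filter_upwards [ae_restrict_of_ae (Measure.ae_ae_of_ae_prod h1),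
    ae_restrict_mem measurableSet_angleBox] with q hq hq'
  refine tendsto_integral_of_dominated_convergence (fun _ => C)
    (fun n => ((hh.continuous_jet hΦ n).comp (Continuous.prodMk_right q)).aestronglyMeasurable)
    (integrable_const _) (fun n => ?_) (ae_restrict_of_ae hq)
  filter_upwards [ae_restrict_mem measurableSet_Ioc] with s hs
  exact hC n (q, s) (paramBox_subset ⟨hq', hs⟩)

lemma IsApprox.tendsto_integral_face (hH : IsLipCylinder K H) (hh : IsApprox K H h)
    {Φ : Space3 × (Param →L[ℝ] Space3) → ℝ} (hΦ : Continuous Φ) :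
    Tendsto (fun n => ∫ q in angleBox, Φ (h n (q, 2), fderiv ℝ (h n) (q, 2))) atTop
      (𝓝 (∫ q in angleBox, Φ (H (q, 2), fderiv ℝ H (q, 2)))) := by
  obtain ⟨C, hC⟩ := hh.exists_bound hH hΦ
  have h1 := hh.tendsto_fderiv
  rw [Measure.volume_eq_prod] at h1
  have : Fact (volume angleBox < ⊤) := ⟨volume_angleBox_lt_top⟩
  refine tendsto_integral_of_dominated_convergence (fun _ => C)
    (fun n => ((hh.continuous_jet hΦ n).comp (Continuous.prodMk_left 2)).aestronglyMeasurable)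
    (integrable_const _) (fun n => ?_) ?_
  · filter_upwards [ae_restrict_mem measurableSet_angleBox] with q hq
    exact hC n (q, 2) (paramBox_subset ⟨hq, by norm_num⟩)
  · filter_upwards [ae_restrict_of_ae (Measure.ae_ae_of_ae_prod h1)] with q hq
    -- some `r` near `2` is a point of convergence, and nothing depends on `r` there
    have hfreq : ∃ᵐ r : ℝ, r ∈ ball (2 : ℝ) (1 / 2) := by
      rw [frequently_ae_mem_iff]
      exact (measure_ball_pos _ _ (by norm_num)).ne'
    obtain ⟨r, hrI, hr⟩ := (hfreq.and_eventually hq).exists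
    have hr2 : |r - 2| < 1 / 2 := by rwa [mem_ball, Real.dist_eq] at hrI
    have shift : ∀ f : Param → Space3, (∀ q s, |s - 2| < 1 / 2 → f (q, s) = f (q, 2)) →
        fderiv ℝ f (q, r) = fderiv ℝ f (q, 2) := by
      intro f hf
      have e : (q, r) = (q, (2 : ℝ)) + (0, r - 2) := by simp
      rw [e, ← fderiv_comp_add_right]
      apply Filter.EventuallyEq.fderiv_eq
      have : ∀ᶠ p in 𝓝 (q, (2 : ℝ)), |p.2 - 2| < 1 / 2 ∧ |p.2 + (r - 2) - 2| < 1 / 2 := by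
        have c1 : Continuous fun p : Param => |p.2 - 2| := by fun_prop
        have c2 : Continuous fun p : Param => |p.2 + (r - 2) - 2| := by fun_prop
        refine (c1.continuousAt.eventually_lt continuousAt_const (by norm_num)).and
          (c2.continuousAt.eventually_lt continuousAt_const ?_)
        simpa using hr2
      filter_upwards [this] with p hp
      rcases p with ⟨a, s⟩
      rw [Prod.mk_add_mk, add_zero]
      rw [hf _ _ hp.2, hf _ _ hp.1]
    have hHs := shift H fun q s hs => by
      have := abs_lt.1 hs
      rw [hH.outer _ _ (by linarith), hH.outer q 2 (by norm_num)]
    have hhs := fun n => shift (h n) (hh.outer n)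
    simp only [hHs, hhs] at hr
    exact (hΦ.tendsto _).comp ((hh.tendsto _).prodMk_nhds hr)

end

lemma continuous_wedge2 {b c : Space3 → ℝ} (hb : ContDiff ℝ ∞ b) (hc : ContDiff ℝ ∞ c)
    (i j : Fin 3) : Continuous fun z : Space3 × (Param →L[ℝ] Space3) =>
      wedge2 (sgrad b z.1) (sgrad c z.1) (z.2 (paramBasis i)) (z.2 (paramBasis j)) := by
  have cb : ∀ i, Continuous fun p => sgrad b p i := fun i => (hb.sgrad i).continuous
  have cc : ∀ i, Continuous fun p => sgrad c p i := fun i => (hc.sgrad i).continuous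
  unfold wedge2 pairing
  fun_prop

lemma continuous_dform {α : Fin 3 → Space3 → ℝ} (hα : ∀ i, ContDiff ℝ ∞ (α i)) (i j : Fin 3) :
    Continuous fun z : Space3 × (Param →L[ℝ] Space3) =>
      dform α z.1 (z.2 (paramBasis i)) (z.2 (paramBasis j)) := by
  have ca : ∀ i j, Continuous fun p => sgrad (α j) p i :=
    fun i j => ((hα j).sgrad i).continuous
  unfold dform pairing
  fun_prop

lemma continuous_jacDet {f : Space3 → ℝ} (hf : Continuous f) :
    Continuous fun z : Space3 × (Param →L[ℝ] Space3) => f z.1 * jacDet z.2 := by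
  unfold jacDet det3
  fun_prop

lemma continuous_det3_forms {α : Fin 3 → Space3 → ℝ} (hα : ∀ i, ContDiff ℝ ∞ (α i))
    {b c : Space3 → ℝ} (hb : ContDiff ℝ ∞ b) (hc : ContDiff ℝ ∞ c) :
    Continuous fun x => det3 (fun i => α i x) (sgrad b x) (sgrad c x) := by
  have cb : ∀ i, Continuous fun p => sgrad b p i := fun i => (hb.sgrad i).continuous
  have cc : ∀ i, Continuous fun p => sgrad c p i := fun i => (hc.sgrad i).continuous
  have ca : ∀ i, Continuous (α i) := fun i => (hα i).continuous
  unfold det3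
  fun_prop

/-- Stokes' theorem `∫ H^*(de ∧ db ∧ dc) = ∫_∂ H^*(e db ∧ dc)` for Lipschitz maps. -/
theorem IsLipCylinder.stokes {K : NNReal} {H : Param → Space3} (hH : IsLipCylinder K H)
    {e b c : Space3 → ℝ} (he : ContDiff ℝ ∞ e) (hb : ContDiff ℝ ∞ b) (hc : ContDiff ℝ ∞ c) :
    ∫ p in paramBox, det3 (sgrad e (H p)) (sgrad b (H p)) (sgrad c (H p)) * jacDet (fderiv ℝ H p)
      = ∫ q in angleBox, e (H (q, 2)) * wedge2 (sgrad b (H (q, 2))) (sgrad c (H (q, 2)))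
        (fderiv ℝ H (q, 2) (paramBasis 0)) (fderiv ℝ H (q, 2) (paramBasis 1)) := by
  obtain ⟨h, hh⟩ := hH.exists_isApprox
  have l1 := hh.tendsto_integral hH (continuous_jacDet
    (continuous_det3_forms (α := fun i x => sgrad e x i) he.sgrad hb hc))
  have l2 := hh.tendsto_integral_face hH
    ((he.continuous.comp continuous_fst).mul (continuous_wedge2 hb hc 0 1))
  refine tendsto_nhds_unique l1 (l2.congr fun n => ?_)
  have hs := (hh.cyl n).smooth
  have hper2 : ∀ θ r, h n ((θ, 2 * Real.pi), r) = h n ((θ, 0), r) ∧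
      fderiv ℝ (h n) ((θ, 2 * Real.pi), r) = fderiv ℝ (h n) ((θ, 0), r) := by
    intro θ r
    have e : ((θ, 2 * Real.pi), r) = ((θ, (0 : ℝ)), r) + (2 * Real.pi) • paramBasis 1 := by
      simp [paramBasis]
    rw [e, (hh.cyl n).periodic, (hh.cyl n).periodic_fderiv]
    exact ⟨rfl, rfl⟩
  have st := integral_det3_pgrad (a := fun p => e (h n p)) (A := pgrad fun p => e (h n p))
    (b := fun p => b (h n p)) (c := fun p => c (h n p))
    (he.continuous.comp hs.continuous) (fun i => ((he.comp hs).pgrad i).continuous)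
    (fun p i => hasLineDerivAt_pgrad (he.comp hs) p i) (hb.comp hs) (hc.comp hs) ?_ ?_ ?_
  · have e1 : ∀ {f : Space3 → ℝ} (hf : ContDiff ℝ ∞ f) (p : Param), pgrad (fun p => f (h n p)) p
        = fun j => pairing (sgrad f (h n p)) (fderiv ℝ (h n) p (paramBasis j)) :=
      fun hf p => funext fun j => pgrad_comp hf hs p j
    simp only [pgrad_minor hb hc hs] at st
    simp only [e1 he, e1 hb, e1 hc, det3_pairing] at st
    exact st.symm
  · intro θ r
    have e := hper2 θ
    refine ⟨?_, fun i => ?_, fun i => ?_⟩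
    · simp only [(e _).1]
    · rw [pgrad_comp hb hs, pgrad_comp hb hs, (e _).1, (e _).2]
    · rw [pgrad_comp hc hs, pgrad_comp hc hs, (e _).1, (e _).2]
  · intro q i
    rw [pgrad_comp hb hs, (hh.cyl n).pole]
    simp [pairing]
  · intro θ φ r hθ
    rw [pgrad_comp hb hs, pgrad_comp hc hs, (hh.cyl n).axis θ φ r hθ]
    simp [pairing]

lemma volume_real_angleBox : volume.real angleBox = 12 * Real.pi := by
  have : volume angleBox = ENNReal.ofReal (12 * Real.pi) := by
    unfold angleBox
    rw [Measure.volume_eq_prod, Measure.prod_prod, Real.volume_Ioc, Real.volume_Ioc,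
      ← ENNReal.ofReal_mul (by norm_num)]
    congr 1; ring
  rw [measureReal_def, this, ENNReal.toReal_ofReal (by positivity)]

lemma abs_intervalIntegral_ray_le {f : ℝ → ℝ} (hf : Continuous f) {r : ℝ}
    (hr : r ∈ Ioc (-1 : ℝ) 2) :
    |∫ s in (-1 : ℝ)..r, f s| ≤ ∫ s in Ioc (-1 : ℝ) 2, |f s| := by
  rw [intervalIntegral.integral_of_le hr.1.le]
  calc |∫ s in Ioc (-1) r, f s| ≤ ∫ s in Ioc (-1) r, |f s| := abs_integral_le_integral_abs
    _ ≤ ∫ s in Ioc (-1 : ℝ) 2, |f s| := by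
      apply setIntegral_mono_set
      · exact (hf.abs.integrableOn_Icc (a := -1) (b := 2)).mono_set Ioc_subset_Icc_self
      · exact Eventually.of_forall fun _ => abs_nonneg _
      · exact (Ioc_subset_Ioc_right hr.2).eventuallyLE

lemma setIntegral_ray_le {f : ℝ → ℝ} {B : ℝ} (h : ∀ᵐ s ∂volume.restrict (Ioc (-1 : ℝ) 2), |f s| ≤ B) :
    ∫ s in Ioc (-1 : ℝ) 2, |f s| ≤ 3 * B := by
  have := norm_setIntegral_le_of_norm_le_const_ae (μ := volume) (s := Ioc (-1 : ℝ) 2)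
    (f := fun s => |f s|) (C := B) (by simp) (by simpa using h)
  have h2 : volume.real (Ioc (-1 : ℝ) 2) = 3 := by
    rw [measureReal_def, Real.volume_Ioc, ENNReal.toReal_ofReal (by norm_num)]; norm_num
  rw [h2] at this
  linarith [le_abs_self (∫ s in Ioc (-1 : ℝ) 2, |f s|), Real.norm_eq_abs (∫ s in Ioc (-1 : ℝ) 2, |f s|)]

/-- The Hopf-type inequality. The integral of `H^*(α ∧ db ∧ dc)` is bounded by the product of the
sup norms of the pullbacks of `dα` and `db ∧ dc`, provided that `db ∧ dc` vanishes near the image of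
the outer face. -/
theorem IsLipCylinder.abs_integral_le {K : NNReal} {H : Param → Space3} (hH : IsLipCylinder K H)
    {α : Fin 3 → Space3 → ℝ} (hα : ∀ i, ContDiff ℝ ∞ (α i)) {b c : Space3 → ℝ}
    (hb : ContDiff ℝ ∞ b) (hc : ContDiff ℝ ∞ c) {δ : ℝ} (hδ : 0 < δ)
    (hface : ∀ q z, dist z (H (q, 1)) < δ → ∀ x y, wedge2 (sgrad b z) (sgrad c z) x y = 0)
    {B₁ B₂ : ℝ} (hB₁ : 0 ≤ B₁)
    (h₁ : ∀ᵐ p ∂volume.restrict paramBox, ∀ j : Fin 3, j ≠ 2 → |dform α (H p)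
      (fderiv ℝ H p (paramBasis j)) (fderiv ℝ H p (paramBasis 2))| ≤ B₁)
    (h₂ : ∀ᵐ p ∂volume.restrict paramBox, ∀ j : Fin 3, j ≠ 2 → |wedge2 (sgrad b (H p))
      (sgrad c (H p)) (fderiv ℝ H p (paramBasis j)) (fderiv ℝ H p (paramBasis 2))| ≤ B₂) :
    |∫ p in paramBox, det3 (fun i => α i (H p)) (sgrad b (H p)) (sgrad c (H p))
        * jacDet (fderiv ℝ H p)| ≤ 216 * Real.pi * (B₁ * B₂) := by
  obtain ⟨h, hh⟩ := hH.exists_isApprox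
  let Z : Fin 3 → Space3 × (Param →L[ℝ] Space3) → ℝ := fun j z =>
    dform α z.1 (z.2 (paramBasis j)) (z.2 (paramBasis 2))
  let Y : Fin 3 → Space3 × (Param →L[ℝ] Space3) → ℝ := fun j z =>
    wedge2 (sgrad b z.1) (sgrad c z.1) (z.2 (paramBasis j)) (z.2 (paramBasis 2))
  have cZ : ∀ j, Continuous (Z j) := fun j => continuous_dform hα j 2
  have cY : ∀ j, Continuous (Y j) := fun j => continuous_wedge2 hb hc j 2
  let J : (Space3 × (Param →L[ℝ] Space3) → ℝ) → (Param → Space3) → ℝ × ℝ → ℝ := fun Φ f q =>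
    ∫ s in Ioc (-1 : ℝ) 2, |Φ (f (q, s), fderiv ℝ f (q, s))|
  let G : (Param → Space3) → ℝ × ℝ → ℝ := fun f q =>
    J (Z 0) f q * J (Y 1) f q + J (Z 1) f q * J (Y 0) f q
  have hJ0 : ∀ Φ f q, 0 ≤ J Φ f q := fun Φ f q => integral_nonneg fun _ => abs_nonneg _
  -- continuity and uniform bounds of the ray integrals of the approximations
  have cJ : ∀ Φ, Continuous Φ → ∀ n, Continuous (J Φ (h n)) := by
    intro Φ hΦ n
    have := intervalIntegral.continuous_parametric_intervalIntegral_of_continuous' (μ := volume)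
      (f := fun (q : ℝ × ℝ) (s : ℝ) => |Φ (h n (q, s), fderiv ℝ (h n) (q, s))|)
      (by exact (hh.continuous_jet hΦ n).abs) (-1) 2
    simpa only [intervalIntegral.integral_of_le (show (-1 : ℝ) ≤ 2 by norm_num)] using this
  have bJ : ∀ Φ, Continuous Φ → ∃ C, 0 ≤ C ∧ ∀ n, ∀ q ∈ angleBox, J Φ (h n) q ≤ C := by
    intro Φ hΦ
    obtain ⟨C, hC⟩ := hh.exists_bound hH hΦ
    refine ⟨3 * max C 0, by positivity, fun n q hq => setIntegral_ray_le ?_⟩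
    filter_upwards [ae_restrict_mem measurableSet_Ioc] with s hs
    exact (hC n (q, s) (paramBox_subset ⟨hq, hs⟩)).trans (le_max_left _ _)
  have tJ : ∀ Φ, Continuous Φ → ∀ᵐ q ∂volume.restrict angleBox,
      Tendsto (fun n => J Φ (h n) q) atTop (𝓝 (J Φ H q)) := fun Φ hΦ =>
    hh.tendsto_integral_ray hH (Φ := fun z => |Φ z|) hΦ.abs
  have tG : Tendsto (fun n => ∫ q in angleBox, G (h n) q) atTop (𝓝 (∫ q in angleBox, G H q)) := by
    obtain ⟨C0, c00, hC0⟩ := bJ _ (cZ 0)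
    obtain ⟨C1, c10, hC1⟩ := bJ _ (cZ 1)
    obtain ⟨D0, d00, hD0⟩ := bJ _ (cY 0)
    obtain ⟨D1, d10, hD1⟩ := bJ _ (cY 1)
    have : Fact (volume angleBox < ⊤) := ⟨volume_angleBox_lt_top⟩
    refine tendsto_integral_of_dominated_convergence (fun _ => C0 * D1 + C1 * D0)
      (fun n => ?_) (integrable_const _) (fun n => ?_) ?_
    · exact (((cJ _ (cZ 0) n).mul (cJ _ (cY 1) n)).add
        ((cJ _ (cZ 1) n).mul (cJ _ (cY 0) n))).aestronglyMeasurable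
    · filter_upwards [ae_restrict_mem measurableSet_angleBox] with q hq
      rw [Real.norm_of_nonneg (add_nonneg (mul_nonneg (hJ0 _ _ _) (hJ0 _ _ _))
        (mul_nonneg (hJ0 _ _ _) (hJ0 _ _ _)))]
      exact add_le_add (mul_le_mul (hC0 n q hq) (hD1 n q hq) (hJ0 _ _ _) c00)
        (mul_le_mul (hC1 n q hq) (hD0 n q hq) (hJ0 _ _ _) c10)
    · filter_upwards [tJ _ (cZ 0), tJ _ (cZ 1), tJ _ (cY 0), tJ _ (cY 1)] with q a1 a2 a3 a4
      exact (a1.mul a4).add (a2.mul a3)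
  -- the bound of the limit
  have ray : ∀ {P : Param → Prop}, (∀ᵐ p ∂volume.restrict paramBox, P p) →
      ∀ᵐ q ∂volume.restrict angleBox, ∀ᵐ s ∂volume.restrict (Ioc (-1 : ℝ) 2), P (q, s) := by
    intro P hP
    unfold paramBox at hP
    rw [Measure.volume_eq_prod, ← Measure.prod_restrict] at hP
    exact Measure.ae_ae_of_ae_prod hP
  -- the rays have length `3`, and the box of angles has area `12 * π`
  have hG : ∫ q in angleBox, G H q ≤ 216 * Real.pi * (B₁ * B₂) := by
    have hle : ∀ᵐ q ∂volume.restrict angleBox, ‖G H q‖ ≤ 18 * (B₁ * B₂) := by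
      filter_upwards [ray h₁, ray h₂] with q a1 a2
      have z0 : J (Z 0) H q ≤ 3 * B₁ := setIntegral_ray_le (a1.mono fun s hs => hs 0 (by decide))
      have z1 : J (Z 1) H q ≤ 3 * B₁ := setIntegral_ray_le (a1.mono fun s hs => hs 1 (by decide))
      have y0 : J (Y 0) H q ≤ 3 * B₂ := setIntegral_ray_le (a2.mono fun s hs => hs 0 (by decide))
      have y1 : J (Y 1) H q ≤ 3 * B₂ := setIntegral_ray_le (a2.mono fun s hs => hs 1 (by decide))
      rw [Real.norm_of_nonneg (add_nonneg (mul_nonneg (hJ0 _ _ _) (hJ0 _ _ _))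
        (mul_nonneg (hJ0 _ _ _) (hJ0 _ _ _)))]
      have m1 := mul_le_mul z0 y1 (hJ0 _ _ _) (by positivity)
      have m2 := mul_le_mul z1 y0 (hJ0 _ _ _) (by positivity)
      linarith
    have := norm_setIntegral_le_of_norm_le_const_ae (μ := volume) volume_angleBox_lt_top hle
    rw [volume_real_angleBox] at this
    linarith [le_abs_self (∫ q in angleBox, G H q), Real.norm_eq_abs (∫ q in angleBox, G H q)]
  -- the inequality for the approximations
  have l1 := hh.tendsto_integral hH (continuous_jacDet (continuous_det3_forms hα hb hc))
  refine le_trans (le_of_tendsto_of_tendsto l1.abs tG ?_) hG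
  have hev : ∀ᶠ n : ℕ in atTop, (K : ℝ) / (n + 2) < δ := by
    have : Tendsto (fun n : ℕ => (K : ℝ) / (n + 2)) atTop (𝓝 0) :=
      tendsto_const_nhds.div_atTop
        (tendsto_atTop_add_const_right _ _ tendsto_natCast_atTop_atTop)
    exact this.eventually_lt_const hδ
  filter_upwards [hev] with n hn
  have hc' := hh.cyl n
  have hs := hc'.smooth
  rw [integral_pullback_eq_radialPrimitive hα hc' hb hc (fun q x y => hface q _ (by
    have := hh.dist_le n (q, 2)
    rw [hH.outer q 2 (by norm_num)] at this
    exact this.trans_lt hn) x y), abs_neg]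
  have cYp : ∀ j, Continuous fun p => Y j (h n p, fderiv ℝ (h n) p) :=
    fun j => hh.continuous_jet (cY j) n
  have cr : ∀ j, Continuous (radialPrimitive α (h n) j) := fun j =>
    intervalIntegral.continuous_parametric_primitive_of_continuous
      (f := fun q s => Z j (h n (q, s), fderiv ℝ (h n) (q, s)))
      (a₀ := -1) (hh.continuous_jet (cZ j) n)
  have rle : ∀ j p, p ∈ paramBox → |radialPrimitive α (h n) j p| ≤ J (Z j) (h n) p.1 := by
    intro j p hp
    exact abs_intervalIntegral_ray_le
      ((hh.continuous_jet (cZ j) n).comp (Continuous.prodMk_right p.1)) hp.2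
  have cW : Continuous fun p : Param =>
      J (Z 0) (h n) p.1 * |Y 1 (h n p, fderiv ℝ (h n) p)|
        + J (Z 1) (h n) p.1 * |Y 0 (h n p, fderiv ℝ (h n) p)| :=
    ((((cJ _ (cZ 0) n).comp continuous_fst)).mul (cYp 1).abs).add
      ((((cJ _ (cZ 1) n).comp continuous_fst)).mul (cYp 0).abs)
  calc _ ≤ ∫ p in paramBox, |radialPrimitive α (h n) 0 p * Y 1 (h n p, fderiv ℝ (h n) p)
            - radialPrimitive α (h n) 1 p * Y 0 (h n p, fderiv ℝ (h n) p)| :=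
        abs_integral_le_integral_abs
    _ ≤ ∫ p in paramBox, (J (Z 0) (h n) p.1 * |Y 1 (h n p, fderiv ℝ (h n) p)|
        + J (Z 1) (h n) p.1 * |Y 0 (h n p, fderiv ℝ (h n) p)|) := by
        refine setIntegral_mono_on ?_ cW.integrableOn_paramBox measurableSet_paramBox
          fun p hp => ?_
        · exact (((cr 0).mul (cYp 1)).sub ((cr 1).mul (cYp 0))).abs.integrableOn_paramBox
        · refine (abs_sub _ _).trans ?_
          rw [abs_mul, abs_mul]
          exact add_le_add (mul_le_mul_of_nonneg_right (rle 0 p hp) (abs_nonneg _))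
            (mul_le_mul_of_nonneg_right (rle 1 p hp) (abs_nonneg _))
    _ = ∫ q in angleBox, G (h n) q := by
        have hi := cW.integrableOn_paramBox
        unfold paramBox at hi ⊢
        rw [Measure.volume_eq_prod] at hi ⊢
        rw [setIntegral_prod _ hi]
        refine setIntegral_congr_fun measurableSet_angleBox fun q _ => ?_
        have ci : ∀ j, IntegrableOn (fun s => |Y j (h n (q, s), fderiv ℝ (h n) (q, s))|)
            (Ioc (-1 : ℝ) 2) := fun j =>
          (((cYp j).abs.comp (Continuous.prodMk_right q)).integrableOn_Icc
            (a := -1) (b := 2)).mono_set Ioc_subset_Icc_self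
        simp only [G]
        rw [integral_add ((ci 1).const_mul _) ((ci 0).const_mul _), integral_const_mul,
          integral_const_mul]

/-! ### Spherical coordinates -/

/-- Spherical coordinates `((θ, φ), r) ↦ r • spherePoint θ φ`. -/
noncomputable def sphParam (p : Param) : Space3 := p.2 • spherePoint p.1.1 p.1.2

/-- The retraction of the parameter space onto the range `θ ∈ [0, π]`, `r ∈ [0, 1]`. -/
noncomputable def clampParam (p : Param) : Param :=
  ((max 0 (min p.1.1 Real.pi), p.1.2), max 0 (min p.2 1))

/-- A map on the closed unit ball, expressed in spherical coordinates and extended to the whole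
parameter space by clamping `θ` and `r`. -/
noncomputable def cylMap (F : Space3 → Space3) (p : Param) : Space3 := F (sphParam (clampParam p))

/-- The open domain on which spherical coordinates are injective. -/
def openParamBox : Set Param := (Ioo 0 Real.pi ×ˢ Ioo 0 (2 * Real.pi)) ×ˢ Ioo 0 1

lemma norm_le_sum_abs (v : Space3) : ‖v‖ ≤ |v 0| + |v 1| + |v 2| := by
  rw [EuclideanSpace.norm_eq, Fin.sum_univ_three]
  apply Real.sqrt_le_iff.2
  refine ⟨by positivity, ?_⟩
  simp only [Real.norm_eq_abs]
  nlinarith [abs_nonneg (v 0), abs_nonneg (v 1), abs_nonneg (v 2),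
    mul_nonneg (abs_nonneg (v 0)) (abs_nonneg (v 1)),
    mul_nonneg (abs_nonneg (v 0)) (abs_nonneg (v 2)),
    mul_nonneg (abs_nonneg (v 1)) (abs_nonneg (v 2))]

lemma norm_spherePoint (θ φ : ℝ) : ‖spherePoint θ φ‖ = 1 := by
  rw [EuclideanSpace.norm_eq, Fin.sum_univ_three, Real.sqrt_eq_one]
  simp only [spherePoint, Real.norm_eq_abs, sq_abs, PiLp.toLp_apply, Matrix.cons_val_zero,
    Matrix.cons_val_one, Matrix.cons_val]
  have h1 := Real.sin_sq_add_cos_sq θ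
  have h2 := Real.sin_sq_add_cos_sq φ
  linear_combination h1 + Real.sin θ ^ 2 * h2

lemma abs_mul_sub_mul_le {a b c d A B : ℝ} (hb : |b| ≤ B) (hc : |c| ≤ A) :
    |a * b - c * d| ≤ |a - c| * B + A * |b - d| := by
  have : a * b - c * d = (a - c) * b + c * (b - d) := by ring
  rw [this]
  refine (abs_add_le _ _).trans ?_
  rw [abs_mul, abs_mul]
  gcongr

lemma abs_sin_sub_le (a b : ℝ) : |Real.sin a - Real.sin b| ≤ |a - b| := by
  simpa [Real.dist_eq] using Real.lipschitzWith_sin.dist_le_mul a b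

lemma abs_cos_sub_le (a b : ℝ) : |Real.cos a - Real.cos b| ≤ |a - b| := by
  simpa [Real.dist_eq] using Real.lipschitzWith_cos.dist_le_mul a b

lemma dist_spherePoint_le (θ φ θ' φ' : ℝ) :
    dist (spherePoint θ φ) (spherePoint θ' φ') ≤ 3 * |θ - θ'| + 2 * |φ - φ'| := by
  rw [dist_eq_norm]
  refine (norm_le_sum_abs _).trans ?_
  simp only [spherePoint, PiLp.sub_apply, Matrix.cons_val_zero,
    Matrix.cons_val_one, Matrix.cons_val]
  have h1 := abs_mul_sub_mul_le (a := Real.sin θ) (c := Real.sin θ') (d := Real.cos φ')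
    (Real.abs_cos_le_one φ) (Real.abs_sin_le_one θ')
  have h2 := abs_mul_sub_mul_le (a := Real.sin θ) (c := Real.sin θ') (d := Real.sin φ')
    (Real.abs_sin_le_one φ) (Real.abs_sin_le_one θ')
  have h3 := abs_sin_sub_le θ θ'
  have h4 := abs_cos_sub_le φ φ'
  have h5 := abs_sin_sub_le φ φ'
  have h6 := abs_cos_sub_le θ θ'
  linarith

lemma abs_clamp_sub_le (a b c : ℝ) : |max 0 (min a c) - max 0 (min b c)| ≤ |a - b| := by
  have h1 := abs_max_sub_max_le_max 0 (min a c) 0 (min b c)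
  have h2 := abs_min_sub_min_le_max a c b c
  simp only [sub_self, abs_zero, abs_nonneg, sup_of_le_left, sup_of_le_right] at h1 h2
  exact h1.trans h2

lemma dist_sphParam_clampParam_le (p p' : Param) :
    dist (sphParam (clampParam p)) (sphParam (clampParam p')) ≤ 6 * dist p p' := by
  have hd := Prod.dist_eq (x := p) (y := p')
  have hd1 := Prod.dist_eq (x := p.1) (y := p'.1)
  have d0 : |p.1.1 - p'.1.1| ≤ dist p p' := by
    rw [hd, hd1, ← Real.dist_eq]; exact (le_max_left _ _).trans (le_max_left _ _)
  have d1 : |p.1.2 - p'.1.2| ≤ dist p p' := by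
    rw [hd, hd1, ← Real.dist_eq]; exact (le_max_right _ _).trans (le_max_left _ _)
  have d2 : |p.2 - p'.2| ≤ dist p p' := by
    rw [hd, ← Real.dist_eq]; exact le_max_right _ _
  have c0 := abs_clamp_sub_le p.1.1 p'.1.1 Real.pi
  have c2 := abs_clamp_sub_le p.2 p'.2 1
  have h1 := dist_spherePoint_le (clampParam p).1.1 (clampParam p).1.2 (clampParam p').1.1
    (clampParam p').1.2
  simp only [sphParam, dist_eq_norm] at h1 ⊢
  set r := (clampParam p).2
  set r' := (clampParam p').2
  set u := spherePoint (clampParam p).1.1 (clampParam p).1.2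
  set u' := spherePoint (clampParam p').1.1 (clampParam p').1.2
  have e : r • u - r' • u' = (r - r') • u + r' • (u - u') := by
    rw [sub_smul, smul_sub]; abel
  have hr' : |r'| ≤ 1 := by
    have : 0 ≤ r' ∧ r' ≤ 1 := ⟨le_max_left _ _, max_le zero_le_one (min_le_right _ _)⟩
    rw [abs_of_nonneg this.1]; exact this.2
  rw [e]
  refine (norm_add_le _ _).trans ?_
  rw [norm_smul, norm_smul, norm_spherePoint, Real.norm_eq_abs, Real.norm_eq_abs]
  have h2 : |r'| * ‖u - u'‖ ≤ 1 * ‖u - u'‖ := mul_le_mul_of_nonneg_right hr' (norm_nonneg _)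
  simp only [clampParam] at h1
  have hc2 : |r - r'| ≤ |p.2 - p'.2| := c2
  rw [← dist_eq_norm p p']
  linarith

lemma sphParam_mem_closedBall {p : Param} (h0 : 0 ≤ p.2) (h1 : p.2 ≤ 1) :
    sphParam p ∈ closedBall (0 : Space3) 1 := by
  rw [mem_closedBall_zero_iff, sphParam, norm_smul, norm_spherePoint, Real.norm_of_nonneg h0]
  linarith

lemma sphParam_clampParam_mem (p : Param) : sphParam (clampParam p) ∈ closedBall (0 : Space3) 1 :=
  sphParam_mem_closedBall (le_max_left _ _) (max_le zero_le_one (min_le_right _ _))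

lemma spherePoint_zero (φ : ℝ) : spherePoint 0 φ = spherePoint 0 0 := by
  simp [spherePoint]

lemma spherePoint_pi (φ : ℝ) : spherePoint Real.pi φ = spherePoint Real.pi 0 := by
  simp [spherePoint]

lemma isLipCylinder_cylMap {K : NNReal} {F : Space3 → Space3}
    (hF : LipschitzOnWith K F (closedBall 0 1)) : IsLipCylinder (K * 6) (cylMap F) where
  lip := LipschitzWith.of_dist_le_mul fun p p' => by
    refine (hF.dist_le_mul _ (sphParam_clampParam_mem p) _ (sphParam_clampParam_mem p')).trans ?_
    push_cast
    rw [mul_assoc]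
    exact mul_le_mul_of_nonneg_left (dist_sphParam_clampParam_le p p') K.2
  periodic p := by
    simp [cylMap, sphParam, clampParam, paramBasis, spherePoint]
  pole q r hr := by
    have : max 0 (min r 1) = 0 := max_eq_left ((min_le_left _ _).trans hr)
    simp [cylMap, sphParam, clampParam, this]
  outer q r hr := by
    simp [cylMap, clampParam, hr]
  north θ φ r hθ := by
    have : max 0 (min θ Real.pi) = 0 := max_eq_left ((min_le_left _ _).trans hθ)
    simp only [cylMap, sphParam, clampParam, this]
    rw [spherePoint_zero]
    simp [Real.pi_pos.le]
  south θ φ r hθ := by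
    simp only [cylMap, sphParam, clampParam, min_eq_right hθ, min_self]
    rw [max_eq_right Real.pi_pos.le, spherePoint_pi]

lemma clampParam_eq {p : Param} (h0 : 0 ≤ p.1.1) (h1 : p.1.1 ≤ Real.pi) (h2 : 0 ≤ p.2)
    (h3 : p.2 ≤ 1) : clampParam p = p := by
  simp [clampParam, h0, h1, h2, h3]

lemma isOpen_openParamBox : IsOpen openParamBox := (isOpen_Ioo.prod isOpen_Ioo).prod isOpen_Ioo

lemma cylMap_eventuallyEq (F : Space3 → Space3) {p : Param} (hp : p ∈ openParamBox) :
    cylMap F =ᶠ[𝓝 p] fun p => F (sphParam p) := by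
  filter_upwards [isOpen_openParamBox.mem_nhds hp] with x hx
  rw [cylMap, clampParam_eq hx.1.1.1.le hx.1.1.2.le hx.2.1.le hx.2.2.le]

lemma contDiff_spherePoint : ContDiff ℝ ∞ fun q : ℝ × ℝ => spherePoint q.1 q.2 := by
  rw [contDiff_euclidean]
  intro i
  fin_cases i <;> simp [spherePoint] <;> fun_prop

lemma contDiff_sphParam : ContDiff ℝ ∞ sphParam :=
  contDiff_snd.smul (contDiff_spherePoint.comp contDiff_fst)

lemma sphParam_mem_ball {p : Param} (hp : p ∈ openParamBox) : sphParam p ∈ ball (0 : Space3) 1 := by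
  rw [mem_ball_zero_iff, sphParam, norm_smul, norm_spherePoint, Real.norm_of_nonneg hp.2.1.le]
  linarith [hp.2.2]

lemma fderiv_sphParam_apply (p : Param) (j i : Fin 3) {c : ℝ}
    (hc : HasDerivAt (fun t : ℝ => sphParam (p + t • paramBasis j) i) c 0) :
    fderiv ℝ sphParam p (paramBasis j) i = c := by
  rw [← pgrad_coord contDiff_sphParam]
  exact (hasLineDerivAt_pgrad (contDiff_coord contDiff_sphParam i) p j).unique hc

lemma fderiv_sphParam (p : Param) :
    fderiv ℝ sphParam p (paramBasis 0) = !₂[p.2 * (Real.cos p.1.1 * Real.cos p.1.2),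
      p.2 * (Real.cos p.1.1 * Real.sin p.1.2), p.2 * (-Real.sin p.1.1)] ∧
    fderiv ℝ sphParam p (paramBasis 1) = !₂[p.2 * (Real.sin p.1.1 * (-Real.sin p.1.2)),
      p.2 * (Real.sin p.1.1 * Real.cos p.1.2), 0] ∧
    fderiv ℝ sphParam p (paramBasis 2) = spherePoint p.1.1 p.1.2 := by
  have hs : ∀ a : ℝ, HasDerivAt (fun t : ℝ => Real.sin (a + t)) (Real.cos a) 0 := fun a => by
    have := (Real.hasDerivAt_sin (a + 0)).comp_const_add a 0
    rwa [add_zero] at this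
  have hc : ∀ a : ℝ, HasDerivAt (fun t : ℝ => Real.cos (a + t)) (-Real.sin a) 0 := fun a => by
    have := (Real.hasDerivAt_cos (a + 0)).comp_const_add a 0
    rwa [add_zero] at this
  have hi : ∀ a : ℝ, HasDerivAt (fun t : ℝ => a + t) 1 0 := fun a => (hasDerivAt_id 0).const_add a
  refine ⟨?_, ?_, ?_⟩ <;> ext i <;> apply fderiv_sphParam_apply <;> fin_cases i <;>
    simp [sphParam, spherePoint, paramBasis]
  · exact ((hs _).mul_const _).const_mul _
  · exact ((hs _).mul_const _).const_mul _
  · simpa using (hc _).const_mul _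
  · simpa using ((hc _).const_mul _).const_mul _
  · exact ((hs _).const_mul _).const_mul _
  · exact hasDerivAt_const _ _
  · simpa using (hi _).mul_const _
  · simpa using (hi _).mul_const _
  · simpa using (hi _).mul_const _

lemma jacDet_fderiv_sphParam (p : Param) :
    jacDet (fderiv ℝ sphParam p) = p.2 ^ 2 * Real.sin p.1.1 := by
  obtain ⟨h0, h1, h2⟩ := fderiv_sphParam p
  rw [jacDet, h0, h1, h2]
  simp only [det3, spherePoint, PiLp.toLp_apply, Matrix.cons_val_zero,
    Matrix.cons_val_one, Matrix.cons_val]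
  have a1 := Real.sin_sq_add_cos_sq p.1.1
  have a2 := Real.sin_sq_add_cos_sq p.1.2
  linear_combination (p.2 ^ 2 * Real.sin p.1.1) * (Real.cos p.1.2 ^ 2 + Real.sin p.1.2 ^ 2) * a1
    + (p.2 ^ 2 * Real.sin p.1.1) * a2

lemma norm_fderiv_sphParam_le {p : Param} (hp : p ∈ openParamBox) {j : Fin 3} (hj : j ≠ 2) :
    ‖fderiv ℝ sphParam p (paramBasis j)‖ ≤ 1 := by
  obtain ⟨h0, h1, -⟩ := fderiv_sphParam p
  have hr : p.2 ^ 2 ≤ 1 := by nlinarith [hp.2.1, hp.2.2]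
  have a1 := Real.sin_sq_add_cos_sq p.1.1
  have a2 := Real.sin_sq_add_cos_sq p.1.2
  rw [EuclideanSpace.norm_eq, Fin.sum_univ_three]
  apply Real.sqrt_le_one.2
  fin_cases j
  · simp only [Fin.zero_eta, h0, Real.norm_eq_abs, sq_abs, PiLp.toLp_apply, Matrix.cons_val_zero,
      Matrix.cons_val_one, Matrix.cons_val]
    have : (p.2 * (Real.cos p.1.1 * Real.cos p.1.2)) ^ 2
        + (p.2 * (Real.cos p.1.1 * Real.sin p.1.2)) ^ 2 + (p.2 * (-Real.sin p.1.1)) ^ 2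
        = p.2 ^ 2 := by
      linear_combination p.2 ^ 2 * a1 + p.2 ^ 2 * Real.cos p.1.1 ^ 2 * a2
    rw [this]; exact hr
  · simp only [Fin.mk_one, h1, Real.norm_eq_abs, sq_abs, PiLp.toLp_apply, Matrix.cons_val_zero,
      Matrix.cons_val_one, Matrix.cons_val]
    have : (p.2 * (Real.sin p.1.1 * (-Real.sin p.1.2))) ^ 2
        + (p.2 * (Real.sin p.1.1 * Real.cos p.1.2)) ^ 2 + (0 : ℝ) ^ 2
        = p.2 ^ 2 * Real.sin p.1.1 ^ 2 := by
      linear_combination p.2 ^ 2 * Real.sin p.1.1 ^ 2 * a2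
    rw [this]
    exact mul_le_one₀ hr (sq_nonneg _) (Real.sin_sq_le_one _)
  · exact absurd rfl hj

/-! ### Change of variables to spherical coordinates -/

/-- The identification of `ℝ³` with the parameter space by Cartesian coordinates. -/
noncomputable def paramEquiv : Space3 ≃L[ℝ] Param :=
  LinearEquiv.toContinuousLinearEquiv
    { toFun := fun w => ((w 0, w 1), w 2)
      invFun := fun p => !₂[p.1.1, p.1.2, p.2]
      map_add' := fun _ _ => rfl
      map_smul' := fun _ _ => rfl
      left_inv := fun w => by ext i; fin_cases i <;> rfl
      right_inv := fun _ => rfl }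

lemma measurePreserving_paramEquiv : MeasurePreserving paramEquiv := by
  have h1 := EuclideanSpace.volume_preserving_symm_measurableEquiv_toLp (Fin 3)
  have h2 := volume_preserving_piFinSuccAbove (fun _ : Fin 3 => ℝ) (Fin.last 2)
  have h3 : MeasurePreserving (Prod.map (id : ℝ → ℝ) (MeasurableEquiv.finTwoArrow (α := ℝ)))
      (volume.prod volume) (volume.prod volume) :=
    (MeasurePreserving.id volume).prod (volume_preserving_finTwoArrow ℝ)
  have h4 : MeasurePreserving (Prod.swap : ℝ × (ℝ × ℝ) → (ℝ × ℝ) × ℝ) (volume.prod volume)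
      (volume.prod volume) := Measure.measurePreserving_swap
  exact h4.comp (h3.comp (h2.comp h1))

lemma measurableEmbedding_paramEquiv : MeasurableEmbedding paramEquiv :=
  paramEquiv.toHomeomorph.measurableEmbedding

lemma paramEquiv_single (i : Fin 3) :
    paramEquiv (EuclideanSpace.single i (1 : ℝ)) = paramBasis i := by
  change (((EuclideanSpace.single i (1 : ℝ) : Space3) 0, (EuclideanSpace.single i (1 : ℝ) : Space3) 1),
    (EuclideanSpace.single i (1 : ℝ) : Space3) 2) = _
  fin_cases i <;> simp [paramBasis]

lemma det_comp_paramEquiv (L : Param →L[ℝ] Space3) :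
    (L ∘L (paramEquiv : Space3 →L[ℝ] Param)).det = jacDet L := by
  rw [ContinuousLinearMap.det, ← LinearMap.det_toMatrix (EuclideanSpace.basisFun (Fin 3) ℝ).toBasis,
    Matrix.det_fin_three]
  simp only [LinearMap.toMatrix_apply]
  simp [paramEquiv_single, jacDet, det3]
  ring

lemma jacDet_comp (A : Space3 →L[ℝ] Space3) (L : Param →L[ℝ] Space3) :
    jacDet (A ∘L L) = A.det * jacDet L := by
  rw [← det_comp_paramEquiv, ← det_comp_paramEquiv, ContinuousLinearMap.comp_assoc]
  exact LinearMap.det_comp _ _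

lemma injOn_sphParam : InjOn sphParam openParamBox := by
  rintro ⟨⟨θ, φ⟩, r⟩ hp ⟨⟨θ', φ'⟩, r'⟩ hp' h
  obtain ⟨⟨⟨t0, t1⟩, f0, f1⟩, r0, r1⟩ := hp
  obtain ⟨⟨⟨t0', t1'⟩, f0', f1'⟩, r0', r1'⟩ := hp'
  simp only at *
  have hr : r = r' := by
    have := congrArg norm h
    simpa [sphParam, norm_smul, norm_spherePoint, abs_of_pos r0, abs_of_pos r0'] using this
  subst hr
  have hs : spherePoint θ φ = spherePoint θ' φ' := smul_right_injective _ r0.ne' h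
  have e2 : Real.cos θ = Real.cos θ' := congrArg (fun v : Space3 => v 2) hs
  have hθ : θ = θ' := Real.injOn_cos ⟨t0.le, t1.le⟩ ⟨t0'.le, t1'.le⟩ e2
  subst hθ
  have hsin : Real.sin θ ≠ 0 := (Real.sin_pos_of_pos_of_lt_pi t0 t1).ne'
  have e0 : Real.cos φ = Real.cos φ' :=
    mul_left_cancel₀ hsin (congrArg (fun v : Space3 => v 0) hs)
  have e1 : Real.sin φ = Real.sin φ' :=
    mul_left_cancel₀ hsin (congrArg (fun v : Space3 => v 1) hs)
  obtain ⟨k, hk⟩ := Real.Angle.angle_eq_iff_two_pi_dvd_sub.1 (Real.Angle.cos_sin_inj e0 e1)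
  have hpi := Real.pi_pos
  have hk0 : k = 0 := by
    have k1 : (k : ℝ) < 1 := by
      by_contra hcon
      push Not at hcon
      nlinarith
    have k2 : (-1 : ℝ) < k := by
      by_contra hcon
      push Not at hcon
      nlinarith
    have k1' : k < 1 := by exact_mod_cast k1
    have k2' : -1 < k := by exact_mod_cast k2
    omega
  rw [hk0] at hk
  have : φ = φ' := by push_cast at hk; linarith
  rw [this]

/-- Spherical coordinates cover the ball up to the plane `y = 0`. -/
lemma ball_diff_subset : ball (0 : Space3) 1 \ sphParam '' openParamBox ⊆ {w | w 1 = 0} := by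
  rintro w ⟨hw, hn⟩
  by_contra h1
  apply hn
  have h1' : w 1 ≠ 0 := h1
  have hr1 : ‖w‖ < 1 := by simpa using hw
  have hsq : ‖w‖ ^ 2 = w 0 ^ 2 + w 1 ^ 2 + w 2 ^ 2 := by
    rw [EuclideanSpace.norm_sq_eq, Fin.sum_univ_three]; simp
  have hy : 0 < w 1 ^ 2 := by positivity
  have hr0 : 0 < ‖w‖ := by
    rw [norm_pos_iff]; rintro rfl; exact h1' rfl
  set z : ℂ := ⟨-w 0, -w 1⟩ with hz
  have hzn : ‖z‖ ^ 2 = w 0 ^ 2 + w 1 ^ 2 := by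
    rw [Complex.sq_norm, Complex.normSq_apply]; simp [hz]; ring
  have hz0 : 0 ≤ ‖z‖ := norm_nonneg z
  have hq1 : w 2 / ‖w‖ < 1 := by
    rw [div_lt_one hr0]; nlinarith [sq_nonneg (w 0)]
  have hq2 : -1 < w 2 / ‖w‖ := by
    rw [lt_div_iff₀ hr0]; nlinarith [sq_nonneg (w 0)]
  have hzim : z.im ≠ 0 := by simpa [hz] using h1'
  have ha1 := Complex.neg_pi_lt_arg z
  have ha2 : Complex.arg z < Real.pi := lt_of_le_of_ne (Complex.arg_le_pi z) fun h =>
    hzim (Complex.arg_eq_pi_iff.1 h).2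
  refine ⟨((Real.arccos (w 2 / ‖w‖), Complex.arg z + Real.pi), ‖w‖), ⟨⟨⟨?_, ?_⟩, ?_, ?_⟩, hr0, hr1⟩, ?_⟩
  · exact Real.arccos_pos.2 hq1
  · refine lt_of_le_of_ne (Real.arccos_le_pi _) fun h => ?_
    rw [Real.arccos_eq_pi] at h
    linarith
  · simp only; linarith
  · simp only; linarith
  · have hs : ‖w‖ * Real.sin (Real.arccos (w 2 / ‖w‖)) = ‖z‖ := by
      rw [Real.sin_arccos]
      have e : 1 - (w 2 / ‖w‖) ^ 2 = (‖z‖ / ‖w‖) ^ 2 := by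
        rw [div_pow, div_pow, hzn, eq_div_iff (by positivity)]
        field_simp
        rw [hsq]; ring
      rw [e, Real.sqrt_sq (by positivity)]
      field_simp
    have hc := Real.cos_arccos hq2.le hq1.le
    have hre := Complex.norm_mul_cos_arg z
    have him := Complex.norm_mul_sin_arg z
    ext i
    fin_cases i <;> simp only [sphParam, spherePoint, PiLp.smul_apply, smul_eq_mul, Real.cos_add_pi,
      Real.sin_add_pi, Fin.zero_eta, Fin.mk_one, Fin.reduceFinMk,
      Matrix.cons_val_zero, Matrix.cons_val_one, Matrix.cons_val]
    · rw [← mul_assoc, hs, mul_neg, hre]; simp [hz]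
    · rw [← mul_assoc, hs, mul_neg, him]; simp [hz]
    · rw [hc]; field_simp

lemma volume_coord_eq_zero : volume {w : Space3 | w 1 = 0} = 0 := by
  have : {w : Space3 | w 1 = 0} = (LinearMap.ker (EuclideanSpace.proj (𝕜 := ℝ) (1 : Fin 3) :
      Space3 →L[ℝ] ℝ).toLinearMap : Set Space3) := by
    ext w; simp
  rw [this]
  apply Measure.addHaar_submodule
  intro h
  have : EuclideanSpace.single (1 : Fin 3) (1 : ℝ) ∈ LinearMap.ker
      (EuclideanSpace.proj (𝕜 := ℝ) (1 : Fin 3) : Space3 →L[ℝ] ℝ).toLinearMap := by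
    rw [h]; trivial
  simp at this

/-- A null set of the ball has a null preimage under spherical coordinates. -/
lemma volume_preimage_sphParam_eq_zero {Z : Set Space3} (hZ : volume Z = 0) :
    volume (openParamBox ∩ sphParam ⁻¹' Z) = 0 := by
  set Z' := toMeasurable volume Z
  have hZ' : volume Z' = 0 := by rw [measure_toMeasurable, hZ]
  have hsub : openParamBox ∩ sphParam ⁻¹' Z ⊆ openParamBox ∩ sphParam ⁻¹' Z' :=
    inter_subset_inter_right _ (preimage_mono (subset_toMeasurable _ _))
  refine measure_mono_null hsub ?_
  have hms : MeasurableSet (openParamBox ∩ sphParam ⁻¹' Z') :=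
    isOpen_openParamBox.measurableSet.inter
      (contDiff_sphParam.continuous.measurable (measurableSet_toMeasurable _ _))
  rw [← measurePreserving_paramEquiv.measure_preimage hms.nullMeasurableSet]
  set s := paramEquiv ⁻¹' (openParamBox ∩ sphParam ⁻¹' Z') with hs
  have hsm : MeasurableSet s := measurePreserving_paramEquiv.measurable hms
  have hd : ∀ w ∈ s, HasFDerivWithinAt (fun w => sphParam (paramEquiv w))
      (fderiv ℝ sphParam (paramEquiv w) ∘L (paramEquiv : Space3 →L[ℝ] Param)) s w := fun w _ =>
    (((contDiff_sphParam.differentiable (by norm_num)).differentiableAt.hasFDerivAt).comp w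
      paramEquiv.hasFDerivAt).hasFDerivWithinAt
  have hinj : InjOn (fun w => sphParam (paramEquiv w)) s := fun a ha b hb hab =>
    paramEquiv.injective (injOn_sphParam ha.1 hb.1 hab)
  have hcv := lintegral_abs_det_fderiv_eq_addHaar_image volume hsm hd hinj
  have hz : volume ((fun w => sphParam (paramEquiv w)) '' s) = 0 :=
    measure_mono_null (by rintro _ ⟨w, hw, rfl⟩; exact hw.2) hZ'
  rw [hz] at hcv
  by_contra hne
  refine ((setLIntegral_pos_iff ?_).2 ?_).ne' hcv
  · simp only [det_comp_paramEquiv, jacDet_fderiv_sphParam]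
    have : Continuous fun w => |(paramEquiv w).2 ^ 2 * Real.sin (paramEquiv w).1.1| := by fun_prop
    exact this.measurable.ennreal_ofReal
  · have hsupp : s ⊆ Function.support (fun w => ENNReal.ofReal
        |(fderiv ℝ sphParam (paramEquiv w) ∘L (paramEquiv : Space3 →L[ℝ] Param)).det|) := by
      intro w hw
      have hp := hw.1
      rw [Function.mem_support, det_comp_paramEquiv, jacDet_fderiv_sphParam]
      have : 0 < (paramEquiv w).2 ^ 2 * Real.sin (paramEquiv w).1.1 :=
        mul_pos (pow_pos hp.2.1 2) (Real.sin_pos_of_pos_of_lt_pi hp.1.1.1 hp.1.1.2)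
      exact (ENNReal.ofReal_pos.2 (abs_pos.2 this.ne')).ne'
    rw [inter_eq_right.2 hsupp]
    exact pos_iff_ne_zero.2 hne

/-- The change of variables formula for an orientation preserving injective map of the ball, in
spherical coordinates. -/
theorem integral_openParamBox_eq {G : Space3 → Space3}
    (hd : ∀ x ∈ ball (0 : Space3) 1, DifferentiableAt ℝ G x)
    (hdet : ∀ x ∈ ball (0 : Space3) 1, 0 < (fderiv ℝ G x).det)
    (hinj : InjOn G (ball 0 1)) (g : Space3 → ℝ) :
    ∫ p in openParamBox, g (G (sphParam p)) * jacDet (fderiv ℝ (fun p => G (sphParam p)) p)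
      = ∫ x in G '' ball 0 1, g x := by
  have hfd : ∀ p ∈ openParamBox, HasFDerivAt (fun p => G (sphParam p))
      (fderiv ℝ G (sphParam p) ∘L fderiv ℝ sphParam p) p := fun p hp =>
    (hd _ (sphParam_mem_ball hp)).hasFDerivAt.comp p
      (contDiff_sphParam.differentiable (by norm_num)).differentiableAt.hasFDerivAt
  set s := paramEquiv ⁻¹' openParamBox with hs
  have hsm : MeasurableSet s := measurePreserving_paramEquiv.measurable
    isOpen_openParamBox.measurableSet
  have hcv := integral_image_eq_integral_abs_det_fderiv_smul volume hsm
    (f := fun w => G (sphParam (paramEquiv w)))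
    (f' := fun w => (fderiv ℝ G (sphParam (paramEquiv w)) ∘L fderiv ℝ sphParam (paramEquiv w))
      ∘L (paramEquiv : Space3 →L[ℝ] Param))
    (fun w hw => ((hfd _ hw).comp w paramEquiv.hasFDerivAt).hasFDerivWithinAt)
    (fun a ha b hb hab => paramEquiv.injective (injOn_sphParam ha hb
      (hinj (sphParam_mem_ball ha) (sphParam_mem_ball hb) hab))) g
  have himg : (fun w => G (sphParam (paramEquiv w))) '' s = G '' (sphParam '' openParamBox) := by
    rw [image_image]
    ext x
    constructor
    · rintro ⟨w, hw, rfl⟩; exact ⟨paramEquiv w, hw, rfl⟩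
    · rintro ⟨p, hp, rfl⟩
      exact ⟨paramEquiv.symm p, by simpa [hs] using hp, by simp⟩
  have hae : (G '' (sphParam '' openParamBox) : Set Space3) =ᵐ[volume] G '' ball 0 1 := by
    have hsub : G '' (sphParam '' openParamBox) ⊆ G '' ball 0 1 := by
      apply image_mono
      rintro _ ⟨p, hp, rfl⟩
      exact sphParam_mem_ball hp
    refine hsub.eventuallyLE.antisymm ?_
    rw [ae_le_set]
    have himd : G '' ball 0 1 \ G '' (sphParam '' openParamBox)
        ⊆ G '' (ball 0 1 \ sphParam '' openParamBox) := by
      rw [sdiff_subset_iff, ← image_union, union_sdiff_self]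
      exact image_mono subset_union_right
    refine measure_mono_null himd ?_
    exact addHaar_image_eq_zero_of_differentiableOn_of_addHaar_eq_zero volume
      (fun x hx => (hd x hx.1).differentiableWithinAt)
      (measure_mono_null ball_diff_subset volume_coord_eq_zero)
  rw [himg, setIntegral_congr_set hae] at hcv
  rw [hcv, ← measurePreserving_paramEquiv.setIntegral_preimage_emb measurableEmbedding_paramEquiv]
  refine setIntegral_congr_fun hsm fun w hw => ?_
  have hpos : 0 < jacDet (fderiv ℝ G (sphParam (paramEquiv w)) ∘L fderiv ℝ sphParam (paramEquiv w)) := by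
    rw [jacDet_comp, jacDet_fderiv_sphParam]
    exact mul_pos (hdet _ (sphParam_mem_ball hw)) (mul_pos (pow_pos hw.2.1 2)
      (Real.sin_pos_of_pos_of_lt_pi hw.1.1.1 hw.1.1.2))
  simp only
  rw [(hfd _ hw).fderiv, det_comp_paramEquiv, abs_of_pos hpos, smul_eq_mul, mul_comm]

/-! ### Degree and the integral over the ball -/

lemma fderiv_eq_zero_of_line {H : Param → Space3} {p v : Param}
    (h : ∀ᶠ t in 𝓝 (0 : ℝ), H (p + t • v) = H p) : fderiv ℝ H p v = 0 := by
  by_cases hd : DifferentiableAt ℝ H p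
  · have h1 : HasDerivAt (fun t : ℝ => H (p + t • v)) (fderiv ℝ H p v) 0 :=
      hd.hasFDerivAt.hasLineDerivAt v
    exact h1.unique ((hasDerivAt_const 0 (H p)).congr_of_eventuallyEq h)
  · rw [fderiv_zero_of_not_differentiableAt hd]; rfl

lemma eventually_add_mul_lt {x c : ℝ} (a : ℝ) (h : x < c) : ∀ᶠ t in 𝓝 (0 : ℝ), x + t * a < c := by
  have hc : Continuous fun t : ℝ => x + t * a := by fun_prop
  exact hc.continuousAt.eventually_lt continuousAt_const (by simpa using h)

lemma eventually_lt_add_mul {x c : ℝ} (a : ℝ) (h : c < x) : ∀ᶠ t in 𝓝 (0 : ℝ), c < x + t * a := by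
  have hc : Continuous fun t : ℝ => x + t * a := by fun_prop
  exact continuousAt_const.eventually_lt hc.continuousAt (by simpa using h)

lemma IsLipCylinder.fderiv_r_eq_zero {K : NNReal} {H : Param → Space3} (hH : IsLipCylinder K H)
    {p : Param} (hp : p.2 < 0 ∨ 1 < p.2) :
    fderiv ℝ H p (paramBasis 2) = 0 := by
  apply fderiv_eq_zero_of_line
  rcases p with ⟨q, r⟩
  rcases hp with hp | hp
  · filter_upwards [eventually_add_mul_lt 1 hp] with t ht
    rw [hH.pole q r hp.le]
    exact hH.pole _ _ (by simpa [paramBasis] using ht.le)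
  · filter_upwards [eventually_lt_add_mul 1 hp] with t ht
    rw [hH.outer q r hp.le]
    have e : q + ((0 : ℝ), (0 : ℝ)) = q := add_zero q
    simpa [paramBasis, e] using hH.outer q (r + t * 1) ht.le

lemma IsLipCylinder.fderiv_angle_eq_zero {K : NNReal} {H : Param → Space3}
    (hH : IsLipCylinder K H) {p : Param} (hp : p.1.1 < 0 ∨ Real.pi < p.1.1) {j : Fin 3}
    (hj : j ≠ 2) : fderiv ℝ H p (paramBasis j) = 0 := by
  apply fderiv_eq_zero_of_line
  rcases p with ⟨⟨θ, φ⟩, r⟩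
  obtain ⟨a, b, hab⟩ : ∃ a b, paramBasis j = ((a, b), 0) := by
    fin_cases j
    · exact ⟨1, 0, rfl⟩
    · exact ⟨0, 1, rfl⟩
    · exact absurd rfl hj
  rcases hp with hp | hp
  · filter_upwards [eventually_add_mul_lt a hp] with t ht
    rw [hH.north θ φ r hp.le]
    simpa [hab] using hH.north (θ + t * a) (φ + t * b) r ht.le
  · filter_upwards [eventually_lt_add_mul a hp] with t ht
    rw [hH.south θ φ r hp.le]
    simpa [hab] using hH.south (θ + t * a) (φ + t * b) r ht.le

lemma ae_angle_ne : ∀ᵐ q : ℝ × ℝ, q.1 ≠ 0 ∧ q.1 ≠ Real.pi ∧ q.2 ≠ 2 * Real.pi := by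
  have h1 : ∀ c : ℝ, ∀ᵐ q : ℝ × ℝ, q.1 ≠ c := fun c =>
    Measure.quasiMeasurePreserving_fst.ae (Measure.ae_ne volume c)
  have h2 : ∀ c : ℝ, ∀ᵐ q : ℝ × ℝ, q.2 ≠ c := fun c =>
    Measure.quasiMeasurePreserving_snd.ae (Measure.ae_ne volume c)
  filter_upwards [h1 0, h1 Real.pi, h2 (2 * Real.pi)] with q a b c
  exact ⟨a, b, c⟩

lemma pi_le_five : Real.pi ≤ 5 := by linarith [Real.pi_lt_d2]

lemma openParamBox_subset : openParamBox ⊆ paramBox := by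
  rintro ⟨⟨θ, φ⟩, r⟩ ⟨⟨⟨a, b⟩, c, d⟩, e, f⟩
  have := pi_le_five
  simp only at *
  exact ⟨⟨⟨by linarith, by simp only; linarith⟩, c, d.le⟩, by simp only; linarith,
    by simp only; linarith⟩

/-- Almost every point of the parameter box lies in the domain of spherical coordinates or in a
region where the map is independent of `r` or of the angles. -/
lemma ae_mem_openParamBox_or : ∀ᵐ p ∂volume.restrict paramBox, p ∈ openParamBox ∨
    (p.2 < 0 ∨ 1 < p.2) ∨ (p.1.1 < 0 ∨ Real.pi < p.1.1) := by
  have h1 : ∀ᵐ p : Param, p.1.1 ≠ 0 ∧ p.1.1 ≠ Real.pi ∧ p.1.2 ≠ 2 * Real.pi :=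
    Measure.quasiMeasurePreserving_fst.ae ae_angle_ne
  have h2 : ∀ c : ℝ, ∀ᵐ p : Param, p.2 ≠ c := fun c =>
    Measure.quasiMeasurePreserving_snd.ae (Measure.ae_ne volume c)
  filter_upwards [ae_restrict_of_ae h1, ae_restrict_of_ae (h2 0), ae_restrict_of_ae (h2 1),
    ae_restrict_mem measurableSet_paramBox] with p ⟨a, b, c⟩ d e hp
  by_contra hcon
  push Not at hcon
  obtain ⟨g1, ⟨g2, g3⟩, g4, g5⟩ := hcon
  exact g1 ⟨⟨⟨lt_of_le_of_ne g4 (Ne.symm a), lt_of_le_of_ne g5 b⟩, hp.1.2.1,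
    lt_of_le_of_ne hp.1.2.2 c⟩, lt_of_le_of_ne g2 (Ne.symm d), lt_of_le_of_ne g3 e⟩

lemma jacDet_eq_zero {L : Param →L[ℝ] Space3} (h : L (paramBasis 0) = 0 ∨ L (paramBasis 2) = 0) :
    jacDet L = 0 := by
  rcases h with h | h <;> simp [jacDet, det3, h]

lemma IsLipCylinder.integral_paramBox_eq {K : NNReal} {H : Param → Space3}
    (hH : IsLipCylinder K H) (f : Space3 → ℝ) :
    ∫ p in paramBox, f (H p) * jacDet (fderiv ℝ H p)
      = ∫ p in openParamBox, f (H p) * jacDet (fderiv ℝ H p) := by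
  refine setIntegral_eq_of_subset_of_ae_sdiff_eq_zero measurableSet_paramBox.nullMeasurableSet
    openParamBox_subset ?_
  have h := ae_mem_openParamBox_or
  rw [ae_restrict_iff' measurableSet_paramBox] at h
  filter_upwards [h] with p hp hp'
  rcases hp hp'.1 with h1 | h1 | h1
  · exact absurd h1 hp'.2
  · rw [jacDet_eq_zero (Or.inr (hH.fderiv_r_eq_zero h1)), mul_zero]
  · rw [jacDet_eq_zero (Or.inl (hH.fderiv_angle_eq_zero h1 (by decide))), mul_zero]

/-- The two-form `dz ∧ dx` on `ℝ³`. -/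
noncomputable def dzdx : Space3 [⋀^Fin 2]→L[ℝ] ℝ where
  toFun m := m 0 2 * m 1 0 - m 1 2 * m 0 0
  map_update_add' m i x y := by
    fin_cases i <;> simp [Function.update] <;> ring
  map_update_smul' m i c x := by
    fin_cases i <;> simp [Function.update] <;> ring
  cont := by fun_prop
  map_eq_zero_of_eq' m i j h hij := by
    fin_cases i <;> fin_cases j <;> simp_all

lemma dzdx_apply (u v : Space3) : dzdx ![u, v] = u 2 * v 0 - v 2 * u 0 := rfl

lemma contDiff_space_coord (i : Fin 3) : ContDiff ℝ ∞ (fun x : Space3 => x i) :=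
  (EuclideanSpace.proj (𝕜 := ℝ) i).contDiff

lemma sgrad_coord (i : Fin 3) (x : Space3) : sgrad (fun x : Space3 => x i) x = Pi.single i 1 := by
  funext j
  have : fderiv ℝ (fun x : Space3 => x i) x = EuclideanSpace.proj (𝕜 := ℝ) i :=
    (EuclideanSpace.proj (𝕜 := ℝ) i).hasFDerivAt.fderiv
  simp only [sgrad, this]
  by_cases h : i = j
  · subst h; simp
  · simp [h, Ne.symm h]

lemma wedge2_coord (x u v : Space3) : wedge2 (sgrad (fun x : Space3 => x 2) x)
    (sgrad (fun x : Space3 => x 0) x) u v = dzdx ![u, v] := by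
  simp [wedge2, pairing, sgrad_coord, dzdx_apply, Pi.single_apply]

/-- Stokes' theorem on the ball for the pullback of `e dz ∧ dx` by a Lipschitz map. -/
theorem integral_openParamBox_eq_spherePullbackIntegral {K : NNReal} {F : Space3 → Space3}
    (hF : LipschitzOnWith K F (closedBall 0 1)) {e : Space3 → ℝ} (he : ContDiff ℝ ∞ e) :
    ∫ p in openParamBox, sgrad e (cylMap F p) 1 * jacDet (fderiv ℝ (cylMap F) p)
      = spherePullbackIntegral F (fun x => e x • dzdx) := by
  have hH := isLipCylinder_cylMap hF
  set H := cylMap F with hHdef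
  rw [← hH.integral_paramBox_eq (fun x => sgrad e x 1)]
  have st := hH.stokes he (contDiff_space_coord 2) (contDiff_space_coord 0)
  have hdet : ∀ x, det3 (sgrad e x) (sgrad (fun x : Space3 => x 2) x)
      (sgrad (fun x : Space3 => x 0) x) = sgrad e x 1 := by
    intro x
    simp [det3, sgrad_coord]
  simp only [hdet, wedge2_coord] at st
  rw [st, spherePullbackIntegral]
  have hsub : Ioo 0 Real.pi ×ˢ Ioo 0 (2 * Real.pi) ⊆ angleBox := by
    rintro ⟨θ, φ⟩ ⟨⟨a, b⟩, c, d⟩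
    have := pi_le_five
    simp only at *
    exact ⟨⟨by linarith, by simp only; linarith⟩, c, d.le⟩
  rw [setIntegral_eq_of_subset_of_ae_sdiff_eq_zero measurableSet_angleBox.nullMeasurableSet hsub]
  · -- inside the domain of the angles both integrands agree almost everywhere
    have hdiff : ∀ᵐ q : ℝ × ℝ, DifferentiableAt ℝ H (q, 2) := by
      have h0 : (volume : Measure (ℝ × ℝ)).IsAddHaarMeasure :=
        inferInstanceAs ((volume : Measure ℝ).prod (volume : Measure ℝ)).IsAddHaarMeasure
      have : (volume : Measure Param).IsAddHaarMeasure :=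
        inferInstanceAs ((volume : Measure (ℝ × ℝ)).prod (volume : Measure ℝ)).IsAddHaarMeasure
      have h1 := hH.lip.ae_differentiableAt (μ := (volume : Measure Param))
      rw [Measure.volume_eq_prod] at h1
      filter_upwards [Measure.ae_ae_of_ae_prod h1] with q hq
      have hfreq : ∃ᵐ r : ℝ, r ∈ ball (2 : ℝ) 1 := by
        rw [frequently_ae_mem_iff]
        exact (measure_ball_pos _ _ (by norm_num)).ne'
      obtain ⟨r, hrI, hr⟩ := (hfreq.and_eventually hq).exists
      have hr2 := abs_lt.1 (show |r - 2| < 1 by rwa [mem_ball, Real.dist_eq] at hrI)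
      have e1 : (q, r) = (q, (2 : ℝ)) + (0, r - 2) := by simp
      rw [e1] at hr
      have h2 := hr.comp (q, (2 : ℝ)) (differentiableAt_id.add_const ((0 : ℝ × ℝ), r - 2))
      refine h2.congr_of_eventuallyEq ?_
      have c1 : Continuous fun p : Param => p.2 := by fun_prop
      have c2 : Continuous fun p : Param => p.2 + (r - 2) := by fun_prop
      filter_upwards [continuousAt_const.eventually_lt (c1.continuousAt (x := (q, (2 : ℝ))))
          (show (1 : ℝ) < 2 by norm_num),
        continuousAt_const.eventually_lt (c2.continuousAt (x := (q, (2 : ℝ))))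
          (show (1 : ℝ) < 2 + (r - 2) by linarith)] with p hp1 hp2
      rcases p with ⟨a, s⟩
      simp only [Function.comp, id]
      rw [Prod.mk_add_mk, add_zero, hH.outer a s hp1.le, hH.outer a _ hp2.le]
    refine setIntegral_congr_ae (measurableSet_Ioo.prod measurableSet_Ioo) ?_
    filter_upwards [hdiff] with q hq hqm
    rcases q with ⟨θ, φ⟩
    obtain ⟨⟨a, b⟩, -⟩ := hqm
    simp only at a b
    have hval : ∀ t s : ℝ, 0 ≤ t → t ≤ Real.pi → H ((t, s), 2) = F (spherePoint t s) := by
      intro t s h1 h2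
      simp [hHdef, cylMap, clampParam, sphParam, h1, h2]
    have d0 : deriv (fun t => F (spherePoint t φ)) θ = fderiv ℝ H ((θ, φ), 2) (paramBasis 0) := by
      have h1 : HasDerivAt (fun t => H ((t, φ), 2)) (fderiv ℝ H ((θ, φ), 2) (paramBasis 0)) θ := by
        have h2 : HasDerivAt (fun t : ℝ => (((t, φ), 2) : Param)) (paramBasis 0) θ :=
          ((hasDerivAt_id θ).prodMk (hasDerivAt_const θ φ)).prodMk (hasDerivAt_const θ (2 : ℝ))
        exact HasFDerivAt.comp_hasDerivAt θ hq.hasFDerivAt h2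
      refine (h1.congr_of_eventuallyEq ?_).deriv
      filter_upwards [Ioo_mem_nhds a b] with t ht
      rw [hval t φ ht.1.le ht.2.le]
    have d1 : deriv (fun t => F (spherePoint θ t)) φ = fderiv ℝ H ((θ, φ), 2) (paramBasis 1) := by
      have h1 : HasDerivAt (fun t => H ((θ, t), 2)) (fderiv ℝ H ((θ, φ), 2) (paramBasis 1)) φ := by
        have h2 : HasDerivAt (fun t : ℝ => (((θ, t), 2) : Param)) (paramBasis 1) φ :=
          ((hasDerivAt_const φ θ).prodMk (hasDerivAt_id φ)).prodMk (hasDerivAt_const φ (2 : ℝ))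
        exact HasFDerivAt.comp_hasDerivAt φ hq.hasFDerivAt h2
      refine (h1.congr_of_eventuallyEq (Eventually.of_forall fun t => ?_)).deriv
      simp only []
      rw [hval θ t a.le b.le]
    simp only
    rw [d0, d1, hval θ φ a.le b.le]
    rfl
  · filter_upwards [ae_angle_ne] with q hq hqm
    rcases q with ⟨θ, φ⟩
    obtain ⟨⟨-, c1, c2⟩, hn⟩ := hqm
    have hθ : θ < 0 ∨ Real.pi < θ := by
      by_contra hcon
      push Not at hcon
      exact hn ⟨⟨lt_of_le_of_ne hcon.1 (Ne.symm hq.1), lt_of_le_of_ne hcon.2 hq.2.1⟩, c1,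
        lt_of_le_of_ne c2 hq.2.2⟩
    rw [hH.fderiv_angle_eq_zero (p := ((θ, φ), 2)) hθ (by decide : (0 : Fin 3) ≠ 2),
      dzdx_apply]
    simp

/-! ### The lower bound for the two-dilation -/

/-- The sum of the absolute values of the components of the exterior derivative of `∑ αⱼ dxⱼ`. -/
noncomputable def curlNorm (α : Fin 3 → Space3 → ℝ) (x : Space3) : ℝ :=
  |sgrad (α 1) x 0 - sgrad (α 0) x 1| + |sgrad (α 2) x 0 - sgrad (α 0) x 2|
    + |sgrad (α 2) x 1 - sgrad (α 1) x 2|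

/-- The sum of the absolute values of the components of the exterior product of two covectors. -/
noncomputable def wedgeNorm (a b : Fin 3 → ℝ) : ℝ :=
  |a 0 * b 1 - a 1 * b 0| + |a 0 * b 2 - a 2 * b 0| + |a 1 * b 2 - a 2 * b 1|

/-- The squared norm of the bivector `u ∧ v`. -/
noncomputable def gram (u v : Space3) : ℝ := ‖u‖ ^ 2 * ‖v‖ ^ 2 - (inner ℝ u v) ^ 2

lemma gram_eq (u v : Space3) : gram u v = (u 0 * v 1 - v 0 * u 1) ^ 2
    + (u 0 * v 2 - v 0 * u 2) ^ 2 + (u 1 * v 2 - v 1 * u 2) ^ 2 := by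
  rw [gram, EuclideanSpace.norm_sq_eq, EuclideanSpace.norm_sq_eq, PiLp.inner_apply]
  simp only [Fin.sum_univ_three, Real.norm_eq_abs, sq_abs, RCLike.inner_apply, conj_trivial]
  ring

lemma abs_comb_le {a b c x y z s D : ℝ} (hD : 0 ≤ D) (h : x ^ 2 + y ^ 2 + z ^ 2 ≤ D ^ 2)
    (hs : |a| + |b| + |c| ≤ s) : |a * x + b * y + c * z| ≤ s * D := by
  have hx : |x| ≤ D := abs_le_of_sq_le_sq (by nlinarith) hD
  have hy : |y| ≤ D := abs_le_of_sq_le_sq (by nlinarith) hD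
  have hz : |z| ≤ D := abs_le_of_sq_le_sq (by nlinarith) hD
  calc |a * x + b * y + c * z| ≤ |a * x| + |b * y| + |c * z| := abs_add_three _ _ _
    _ = |a| * |x| + |b| * |y| + |c| * |z| := by rw [abs_mul, abs_mul, abs_mul]
    _ ≤ |a| * D + |b| * D + |c| * D := by gcongr
    _ = (|a| + |b| + |c|) * D := by ring
    _ ≤ s * D := by gcongr

lemma abs_dform_le {α : Fin 3 → Space3 → ℝ} {x u v : Space3} {s D : ℝ} (hD : 0 ≤ D)
    (h : gram u v ≤ D ^ 2) (hs : curlNorm α x ≤ s) : |dform α x u v| ≤ s * D := by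
  rw [gram_eq] at h
  have := abs_comb_le hD h hs
  convert this using 2
  simp only [dform, pairing, Fin.sum_univ_three]
  ring

lemma abs_wedge2_le {a b : Fin 3 → ℝ} {u v : Space3} {s D : ℝ} (hD : 0 ≤ D)
    (h : gram u v ≤ D ^ 2) (hs : wedgeNorm a b ≤ s) : |wedge2 a b u v| ≤ s * D := by
  rw [gram_eq] at h
  have := abs_comb_le hD h hs
  convert this using 2
  simp only [wedge2, pairing, Fin.sum_univ_three]
  ring

lemma lipschitzOnWith_of_isOrientedBallDiffeo {G : Space3 → Space3} {U : Set Space3}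
    (hG : IsOrientedBallDiffeo G U) : ∃ K : NNReal, LipschitzOnWith K G (closedBall 0 1) := by
  obtain ⟨V, hV, hBV, hs⟩ := hG.smooth
  have hc : ContinuousOn (fderiv ℝ G) (closedBall 0 1) :=
    (hs.continuousOn_fderiv_of_isOpen hV (by norm_num)).mono hBV
  obtain ⟨C, hC⟩ := (isCompact_closedBall (0 : Space3) 1).exists_bound_of_continuousOn hc
  refine ⟨C.toNNReal, (convex_closedBall (0 : Space3) 1).lipschitzOnWith_of_nnnorm_fderiv_le
    (𝕜 := ℝ) (fun x hx => ?_) fun x hx => ?_⟩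
  · exact (hs.differentiableOn (by norm_num)).differentiableAt (hV.mem_nhds (hBV hx))
  · rw [← NNReal.coe_le_coe, coe_nnnorm, Real.coe_toNNReal']
    exact (hC x hx).trans (le_max_left _ _)

/-- The integral of a function over the image of an oriented diffeomorphism of the ball. -/
lemma IsOrientedBallDiffeo.integral_eq {G : Space3 → Space3} {U : Set Space3}
    (hG : IsOrientedBallDiffeo G U) {e : Space3 → ℝ} (he : ContDiff ℝ ∞ e) :
    spherePullbackIntegral G (fun x => e x • dzdx) = ∫ x in U, sgrad e x 1 := by
  obtain ⟨K, hK⟩ := lipschitzOnWith_of_isOrientedBallDiffeo hG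
  obtain ⟨V, hV, hBV, hs⟩ := hG.smooth
  rw [← integral_openParamBox_eq_spherePullbackIntegral hK he, ← hG.image_ball,
    ← integral_openParamBox_eq (fun x hx => (hs.differentiableOn (by norm_num)).differentiableAt
      (hV.mem_nhds (hBV (ball_subset_closedBall hx))))
      (fun x hx => hG.det_pos x (ball_subset_closedBall hx)) (hG.inj.mono ball_subset_closedBall)]
  refine setIntegral_congr_fun isOpen_openParamBox.measurableSet fun p hp => ?_
  have h := cylMap_eventuallyEq G hp
  rw [h.fderiv_eq, h.eq_of_nhds]

/-- If `α ∧ db ∧ dc = ∂_y e dx ∧ dy ∧ dz`, where `dα` and `db ∧ dc` are bounded on `U` and `db ∧ dc`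
has compact support in `U`, then a Lipschitz map of degree one onto `U` has two-dilation at least a
multiple of the square root of `|∫_U ∂_y e|`. -/
theorem abs_integral_le_of_degree_one {U : Set Space3} (hU : IsOpen U)
    {α : Fin 3 → Space3 → ℝ} (hα : ∀ i, ContDiff ℝ ∞ (α i)) {b c e : Space3 → ℝ}
    (hb : ContDiff ℝ ∞ b) (hc : ContDiff ℝ ∞ c) (he : ContDiff ℝ ∞ e)
    (hdet : ∀ x, det3 (fun i => α i x) (sgrad b x) (sgrad c x) = sgrad e x 1)
    {T : Set Space3} (hT : IsCompact T) (hTU : T ⊆ U)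
    (hsupp : ∀ x ∉ T, ∀ u v, wedge2 (sgrad b x) (sgrad c x) u v = 0)
    {C₁ C₂ : ℝ} (hC₁ : ∀ x ∈ closure U, curlNorm α x ≤ C₁)
    (hC₂ : ∀ x, wedgeNorm (sgrad b x) (sgrad c x) ≤ C₂)
    {F : Space3 → Space3} {K : NNReal} (hF : LipschitzOnWith K F (closedBall 0 1))
    (hFU : MapsTo F (closedBall 0 1) (closure U)) (hFS : MapsTo F (sphere 0 1) (frontier U))
    (hdeg : HasBoundaryDegree F U 1) {Ω : Set Space3} (hΩ : IsFullDiffSet F (closedBall 0 1) Ω)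
    {D : ℝ} (hD : ∀ p ∈ Ω, extPowNorm 2 (fderivWithin ℝ F (closedBall 0 1) p) ≤ D) :
    |∫ x in U, sgrad e x 1| ≤ 216 * Real.pi * (C₁ * D * (C₂ * D)) := by
  have hH := isLipCylinder_cylMap hF
  have hnonneg : ∀ A : Space3 →L[ℝ] Space3, 0 ≤ extPowNorm 2 A := fun A =>
    Finset.prod_nonneg fun i _ => LinearMap.singularValues_nonneg _ _
  obtain ⟨δ, hδ, hδU⟩ := hT.exists_cthickening_subset_open hU hTU
  have hFm : ∀ p, cylMap F p ∈ closure U := fun p => hFU (sphParam_clampParam_mem p)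
  have hC₁0 : 0 ≤ C₁ := by
    refine le_trans ?_ (hC₁ _ (hFm 0))
    unfold curlNorm; positivity
  have hC₂0 : 0 ≤ C₂ := by
    refine le_trans ?_ (hC₂ 0)
    unfold wedgeNorm; positivity
  -- the degree identifies the integral over `U` with an integral of a pullback by `F`
  have hint : ∫ x in U, sgrad e x 1 = ∫ p in paramBox, det3 (fun i => α i (cylMap F p))
      (sgrad b (cylMap F p)) (sgrad c (cylMap F p)) * jacDet (fderiv ℝ (cylMap F) p) := by
    obtain ⟨G, hG, hdG⟩ := hdeg
    have := hdG (fun x => e x • dzdx) (he.smul contDiff_const)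
    rw [Int.cast_one, one_mul, hG.integral_eq he,
      ← integral_openParamBox_eq_spherePullbackIntegral hF he] at this
    simp only [hdet]
    rw [← this, ← hH.integral_paramBox_eq (fun x => sgrad e x 1)]
  have hmain : ∀ᵐ p ∂volume.restrict paramBox, ∀ j : Fin 3, j ≠ 2 →
      0 ≤ D ∧ gram (fderiv ℝ (cylMap F) p (paramBasis j)) (fderiv ℝ (cylMap F) p (paramBasis 2))
        ≤ D ^ 2 := by
    have hnull : ∀ᵐ p ∂volume.restrict paramBox, p ∈ openParamBox → sphParam p ∈ Ω := by
      apply ae_restrict_of_ae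
      have := volume_preimage_sphParam_eq_zero hΩ.full
      rw [ae_iff]
      refine measure_mono_null ?_ this
      intro p hp
      simp only [mem_ofPred_eq, Classical.not_imp] at hp
      exact ⟨hp.1, ball_subset_closedBall (sphParam_mem_ball hp.1), hp.2⟩
    have hD0 : 0 ≤ D := by
      obtain ⟨p, hp⟩ : Ω.Nonempty := by
        by_contra hne
        rw [not_nonempty_iff_eq_empty] at hne
        have := hΩ.full
        rw [hne, sdiff_empty] at this
        exact (measure_closedBall_pos volume (0 : Space3) one_pos).ne' this
      exact (hnonneg _).trans (hD p hp)
    filter_upwards [hnull, ae_mem_openParamBox_or] with p hp hp' j hj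
    refine ⟨hD0, ?_⟩
    rcases hp' with h | h | h
    · have hx := hp h
      have hnhds : closedBall (0 : Space3) 1 ∈ 𝓝 (sphParam p) :=
        mem_of_superset (isOpen_ball.mem_nhds (sphParam_mem_ball h)) ball_subset_closedBall
      have hdF : DifferentiableAt ℝ F (sphParam p) := (hΩ.diff _ hx).differentiableAt hnhds
      have hder : fderiv ℝ (cylMap F) p = fderiv ℝ F (sphParam p) ∘L fderiv ℝ sphParam p := by
        rw [(cylMap_eventuallyEq F h).fderiv_eq]
        exact (hdF.hasFDerivAt.comp p
          (contDiff_sphParam.differentiable (by norm_num)).differentiableAt.hasFDerivAt).fderiv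
      have hDp := hD _ hx
      rw [fderivWithin_of_mem_nhds hnhds] at hDp
      rw [hder]
      simp only [ContinuousLinearMap.comp_apply]
      refine (gram_image_le _ _ _).trans ?_
      have n1 := norm_fderiv_sphParam_le h hj
      have n2 : ‖fderiv ℝ sphParam p (paramBasis 2)‖ = 1 := by
        rw [(fderiv_sphParam p).2.2, norm_spherePoint]
      have g1 : ‖fderiv ℝ sphParam p (paramBasis j)‖ ^ 2
          * ‖fderiv ℝ sphParam p (paramBasis 2)‖ ^ 2 - (inner ℝ (fderiv ℝ sphParam p (paramBasis j))
            (fderiv ℝ sphParam p (paramBasis 2))) ^ 2 ≤ 1 := by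
        rw [n2]
        nlinarith [sq_nonneg (inner ℝ (fderiv ℝ sphParam p (paramBasis j))
            (fderiv ℝ sphParam p (paramBasis 2))), norm_nonneg (fderiv ℝ sphParam p (paramBasis j))]
      calc _ ≤ extPowNorm 2 (fderiv ℝ F (sphParam p)) ^ 2 * 1 :=
            mul_le_mul_of_nonneg_left g1 (sq_nonneg _)
        _ ≤ D ^ 2 := by
            rw [mul_one]; exact pow_le_pow_left₀ (hnonneg _) hDp 2
    · rw [hH.fderiv_r_eq_zero h, gram_eq]
      simp only [PiLp.zero_apply, mul_zero, zero_mul, sub_self]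
      nlinarith [sq_nonneg D]
    · rw [hH.fderiv_angle_eq_zero h hj, gram_eq]
      simp only [PiLp.zero_apply, mul_zero, zero_mul, sub_self]
      nlinarith [sq_nonneg D]
  have hD0 : 0 ≤ D := by
    have hne : volume.restrict paramBox ≠ 0 := by
      rw [Ne, Measure.restrict_eq_zero]
      refine (lt_of_lt_of_le ?_ (measure_mono openParamBox_subset)).ne'
      have := Real.pi_pos
      refine isOpen_openParamBox.measure_pos volume ⟨((1, 1), 1 / 2), ⟨⟨?_, ?_⟩, ?_, ?_⟩, ?_, ?_⟩ <;>
        norm_num <;> linarith [Real.pi_gt_three]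
    have := ae_neBot.2 hne
    obtain ⟨p, hp⟩ := hmain.exists
    exact (hp 0 (by decide)).1
  rw [hint]
  refine hH.abs_integral_le hα hb hc hδ (fun q z hz u v => hsupp z (fun hzT => ?_) u v)
    (mul_nonneg hC₁0 hD0) ?_ ?_
  · have hmem : cylMap F (q, 1) ∈ frontier U := by
      apply hFS
      rw [mem_sphere_zero_iff_norm, sphParam, norm_smul, norm_spherePoint]
      simp [clampParam]
    rw [hU.frontier_eq] at hmem
    apply hmem.2
    apply hδU
    rw [dist_comm] at hz
    exact mem_cthickening_of_dist_le _ _ _ _ hzT hz.le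
  · filter_upwards [hmain] with p hp j hj
    exact abs_dform_le hD0 (hp j hj).2 (hC₁ _ (hFm p))
  · filter_upwards [hmain] with p hp j hj
    exact abs_wedge2_le hD0 (hp j hj).2 (hC₂ _)

/-! ### Calculus with coordinates -/

/-- The function `f` is differentiable at `x` with partial derivatives `g`. -/
def HasSGrad (f : Space3 → ℝ) (g : Fin 3 → ℝ) (x : Space3) : Prop :=
  DifferentiableAt ℝ f x ∧ sgrad f x = g

lemma HasSGrad.congr {f : Space3 → ℝ} {g g' : Fin 3 → ℝ} {x : Space3} (h : HasSGrad f g x)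
    (hg : g = g') : HasSGrad f g' x := hg ▸ h

lemma HasSGrad.congr_of_eventuallyEq {f f' : Space3 → ℝ} {g : Fin 3 → ℝ} {x : Space3}
    (h : HasSGrad f g x) (hf : f' =ᶠ[𝓝 x] f) : HasSGrad f' g x := by
  refine ⟨h.1.congr_of_eventuallyEq hf, ?_⟩
  rw [← h.2]
  ext i
  simp only [sgrad, hf.fderiv_eq]

lemma hasSGrad_const (c : ℝ) (x : Space3) : HasSGrad (fun _ => c) 0 x :=
  ⟨differentiableAt_const c, by ext i; simp [sgrad]⟩

lemma hasSGrad_coord (i : Fin 3) (x : Space3) : HasSGrad (fun x => x i) (Pi.single i 1) x :=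
  ⟨((contDiff_space_coord i).differentiable (by norm_num)).differentiableAt, by
    ext j; rw [sgrad_coord]⟩

lemma HasSGrad.add {f f' : Space3 → ℝ} {g g' : Fin 3 → ℝ} {x : Space3} (h : HasSGrad f g x)
    (h' : HasSGrad f' g' x) : HasSGrad (fun x => f x + f' x) (g + g') x := by
  refine ⟨h.1.add h'.1, ?_⟩
  rw [← h.2, ← h'.2]
  ext i
  simp [sgrad, fderiv_fun_add h.1 h'.1]

lemma HasSGrad.sub {f f' : Space3 → ℝ} {g g' : Fin 3 → ℝ} {x : Space3} (h : HasSGrad f g x)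
    (h' : HasSGrad f' g' x) : HasSGrad (fun x => f x - f' x) (g - g') x := by
  refine ⟨h.1.sub h'.1, ?_⟩
  rw [← h.2, ← h'.2]
  ext i
  simp [sgrad, fderiv_fun_sub h.1 h'.1]

lemma HasSGrad.mul {f f' : Space3 → ℝ} {g g' : Fin 3 → ℝ} {x : Space3} (h : HasSGrad f g x)
    (h' : HasSGrad f' g' x) : HasSGrad (fun x => f x * f' x) (f x • g' + f' x • g) x := by
  refine ⟨h.1.mul h'.1, ?_⟩
  rw [← h.2, ← h'.2]
  ext i
  simp [sgrad, fderiv_fun_mul h.1 h'.1]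

lemma HasSGrad.const_mul {f : Space3 → ℝ} {g : Fin 3 → ℝ} {x : Space3} (h : HasSGrad f g x)
    (c : ℝ) : HasSGrad (fun x => c * f x) (c • g) x :=
  ((hasSGrad_const c x).mul h).congr (by simp)

lemma HasSGrad.comp {f : Space3 → ℝ} {g : Fin 3 → ℝ} {x : Space3} (h : HasSGrad f g x)
    {φ : ℝ → ℝ} {c : ℝ} (hφ : HasDerivAt φ c (f x)) :
    HasSGrad (fun x => φ (f x)) (c • g) x := by
  have := hφ.comp_hasFDerivAt x h.1.hasFDerivAt
  refine ⟨this.differentiableAt, ?_⟩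
  rw [← h.2]
  ext i
  simp only [sgrad]
  rw [show (fun x => φ (f x)) = φ ∘ f from rfl, this.fderiv]
  rfl

lemma det_fderiv_eq_det3 {G : Space3 → Space3} {g₀ g₁ g₂ : Fin 3 → ℝ} {x : Space3}
    (h₀ : HasSGrad (fun x => G x 0) g₀ x) (h₁ : HasSGrad (fun x => G x 1) g₁ x)
    (h₂ : HasSGrad (fun x => G x 2) g₂ x) : (fderiv ℝ G x).det = det3 g₀ g₁ g₂ := by
  have h : ∀ i, HasSGrad (fun x => G x i) ((![g₀, g₁, g₂] : Fin 3 → Fin 3 → ℝ) i) x := fun i => by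
    fin_cases i
    exacts [h₀, h₁, h₂]
  have hG : DifferentiableAt ℝ G x := (differentiableAt_euclidean).2 fun i => (h i).1
  have hc : ∀ i j, fderiv ℝ G x (EuclideanSpace.single j 1) i = (![g₀, g₁, g₂] : Fin 3 → Fin 3 → ℝ) i j := by
    intro i j
    rw [← (h i).2, sgrad]
    have := ((EuclideanSpace.proj (𝕜 := ℝ) i : Space3 →L[ℝ] ℝ).hasFDerivAt.comp x
      hG.hasFDerivAt).fderiv
    change _ = fderiv ℝ ((EuclideanSpace.proj (𝕜 := ℝ) i : Space3 →L[ℝ] ℝ) ∘ G) x _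
    rw [this]
    rfl
  rw [ContinuousLinearMap.det, ← LinearMap.det_toMatrix (EuclideanSpace.basisFun (Fin 3) ℝ).toBasis,
    Matrix.det_fin_three]
  simp [LinearMap.toMatrix_apply, hc, det3]
  ring

/-! ### The smooth step -/

/-- The derivative of the smooth step function. -/
noncomputable def stepDeriv : ℝ → ℝ := deriv Real.smoothTransition

lemma hasDerivAt_step (x : ℝ) : HasDerivAt Real.smoothTransition (stepDeriv x) x :=
  (Real.smoothTransition.contDiff (n := 1)).differentiable (by norm_num) |>.differentiableAt.hasDerivAt

lemma contDiff_step : ContDiff ℝ ∞ Real.smoothTransition := Real.smoothTransition.contDiff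

lemma contDiff_stepDeriv : ContDiff ℝ ∞ stepDeriv :=
  (contDiff_infty_iff_deriv.1 contDiff_step).2

lemma hasDerivAt_stepDeriv (x : ℝ) : HasDerivAt stepDeriv (deriv stepDeriv x) x :=
  (contDiff_stepDeriv.differentiable (by norm_num)).differentiableAt.hasDerivAt

lemma stepDeriv_nonneg (x : ℝ) : 0 ≤ stepDeriv x := Real.smoothTransition.monotone.deriv_nonneg

lemma stepDeriv_of_nonpos {x : ℝ} (hx : x ≤ 0) : stepDeriv x = 0 := by
  have h : EqOn stepDeriv (fun _ => 0) (Iio 0) := fun y hy => by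
    have : Real.smoothTransition =ᶠ[𝓝 y] fun _ => 0 := by
      filter_upwards [isOpen_Iio.mem_nhds hy] with z hz
      exact Real.smoothTransition.zero_of_nonpos hz.le
    simp [stepDeriv, this.deriv_eq]
  have := h.closure contDiff_stepDeriv.continuous continuous_const
  rw [closure_Iio] at this
  exact this hx

lemma stepDeriv_of_one_le {x : ℝ} (hx : 1 ≤ x) : stepDeriv x = 0 := by
  have h : EqOn stepDeriv (fun _ => 0) (Ioi 1) := fun y hy => by
    have : Real.smoothTransition =ᶠ[𝓝 y] fun _ => 1 := by
      filter_upwards [isOpen_Ioi.mem_nhds hy] with z hz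
      exact Real.smoothTransition.one_of_one_le (le_of_lt hz)
    simp [stepDeriv, this.deriv_eq]
  have := h.closure contDiff_stepDeriv.continuous continuous_const
  rw [closure_Ioi] at this
  exact this hx

lemma exists_step_bound : ∃ L : ℝ, 1 ≤ L ∧ (∀ x, |stepDeriv x| ≤ L) ∧
    ∀ x, |deriv stepDeriv x| ≤ L := by
  have hcs : HasCompactSupport stepDeriv := by
    refine HasCompactSupport.of_support_subset_isCompact (isCompact_Icc (a := (0 : ℝ)) (b := 1)) ?_
    intro x hx
    by_contra hn
    rw [mem_Icc, not_and_or, not_le, not_le] at hn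
    exact hx (hn.elim (fun h => stepDeriv_of_nonpos h.le) fun h => stepDeriv_of_one_le h.le)
  obtain ⟨A, hA⟩ := contDiff_stepDeriv.continuous.bounded_above_of_compact_support hcs
  obtain ⟨B, hB⟩ := (contDiff_infty_iff_deriv.1
    contDiff_stepDeriv).2.continuous.bounded_above_of_compact_support hcs.deriv
  exact ⟨max 1 (max A B), le_max_left _ _,
    fun x => (hA x).trans ((le_max_left _ _).trans (le_max_right _ _)),
    fun x => (hB x).trans ((le_max_right _ _).trans (le_max_right _ _))⟩

lemma abs_sub_le_of_deriv_le {f f' : ℝ → ℝ} {L : ℝ} (h : ∀ x, HasDerivAt f (f' x) x)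
    (hL : ∀ x, |f' x| ≤ L) (x y : ℝ) : |f x - f y| ≤ L * |x - y| :=
  convex_univ.norm_image_sub_le_of_norm_hasDerivWithin_le
    (fun z _ => (h z).hasDerivWithinAt) (fun z _ => hL z) (mem_univ y) (mem_univ x)

/-! ### The domain -/

lemma norm_sq_coord (v : Space3) : ‖v‖ ^ 2 = v 0 ^ 2 + v 1 ^ 2 + v 2 ^ 2 := by
  rw [EuclideanSpace.norm_sq_eq, Fin.sum_univ_three]
  simp only [Real.norm_eq_abs, sq_abs]

/-- The angle, in units of `M`, by which the circles of squared radius `q` are rotated. -/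
noncomputable def twistProfile (q : ℝ) : ℝ := 5 * Real.smoothTransition (5 / 2 * q - 3 / 4) - 5

/-- Rotation about the third axis by an angle which depends on the distance to that axis. -/
noncomputable def twist (M : ℝ) (p : Space3) : Space3 :=
  let β := M * twistProfile (p 0 ^ 2 + p 1 ^ 2)
  !₂[p 0 * Real.cos β - p 1 * Real.sin β, p 0 * Real.sin β + p 1 * Real.cos β, p 2]

/-- The factor by which the ball is contracted: it is `1 / 2` near the first axis, and `1` at
distance more than `1 / M` from it. -/
noncomputable def pinchFactor (M : ℝ) (p : Space3) : ℝ :=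
  (1 + Real.smoothTransition (2 * M ^ 2 * (p 1 ^ 2 + p 2 ^ 2) - 1)) / 2

/-- The map which pushes two thin fingers along the first axis into the ball. -/
noncomputable def pinch (M : ℝ) (p : Space3) : Space3 := pinchFactor M p • p

/-- The diffeomorphism of the ball onto the domain with two spiralling fingers removed. -/
noncomputable def spiralMap (M : ℝ) (p : Space3) : Space3 := twist M (pinch M p)

/-- The unit ball from which two thin spiralling fingers have been removed. -/
noncomputable def spiralDomain (M : ℝ) : Set Space3 := spiralMap M '' ball 0 1

lemma hasDerivAt_twistProfile (q : ℝ) : HasDerivAt twistProfile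
    (25 / 2 * stepDeriv (5 / 2 * q - 3 / 4)) q := by
  have h1 : HasDerivAt (fun q : ℝ => 5 / 2 * q - 3 / 4) (5 / 2) q := by
    simpa using ((hasDerivAt_id q).const_mul (5 / 2 : ℝ)).sub_const (3 / 4)
  have := (((hasDerivAt_step _).comp q h1).const_mul 5).sub_const 5
  refine this.congr_deriv ?_
  ring

lemma contDiff_twistProfile : ContDiff ℝ ∞ twistProfile := by
  unfold twistProfile
  exact ((contDiff_step.comp (by fun_prop)).const_smul (5 : ℝ)).sub contDiff_const

lemma twistProfile_of_le {q : ℝ} (h : q ≤ 3 / 10) : twistProfile q = -5 := by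
  rw [twistProfile, Real.smoothTransition.zero_of_nonpos (by linarith)]; norm_num

lemma twistProfile_of_ge {q : ℝ} (h : 7 / 10 ≤ q) : twistProfile q = 0 := by
  rw [twistProfile, Real.smoothTransition.one_of_one_le (by linarith)]; norm_num

lemma twist_zero (M : ℝ) (p : Space3) : twist M p 0 =
    p 0 * Real.cos (M * twistProfile (p 0 ^ 2 + p 1 ^ 2))
      - p 1 * Real.sin (M * twistProfile (p 0 ^ 2 + p 1 ^ 2)) := rfl

lemma twist_one (M : ℝ) (p : Space3) : twist M p 1 =
    p 0 * Real.sin (M * twistProfile (p 0 ^ 2 + p 1 ^ 2))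
      + p 1 * Real.cos (M * twistProfile (p 0 ^ 2 + p 1 ^ 2)) := rfl

lemma twist_two (M : ℝ) (p : Space3) : twist M p 2 = p 2 := rfl

lemma twist_sq_add_sq (M : ℝ) (p : Space3) :
    twist M p 0 ^ 2 + twist M p 1 ^ 2 = p 0 ^ 2 + p 1 ^ 2 := by
  rw [twist_zero, twist_one]
  linear_combination (p 0 ^ 2 + p 1 ^ 2)
    * Real.sin_sq_add_cos_sq (M * twistProfile (p 0 ^ 2 + p 1 ^ 2))

lemma norm_twist (M : ℝ) (p : Space3) : ‖twist M p‖ = ‖p‖ := by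
  rw [← sq_eq_sq₀ (norm_nonneg _) (norm_nonneg _), norm_sq_coord, norm_sq_coord, twist_sq_add_sq,
    twist_two]

lemma twist_twist_neg (M : ℝ) (p : Space3) : twist M (twist (-M) p) = p := by
  have hs := Real.sin_sq_add_cos_sq (M * twistProfile (p 0 ^ 2 + p 1 ^ 2))
  ext i
  fin_cases i
  · change twist M (twist (-M) p) 0 = p 0
    rw [twist_zero, twist_sq_add_sq, twist_zero, twist_one, neg_mul, Real.sin_neg, Real.cos_neg]
    linear_combination p 0 * hs
  · change twist M (twist (-M) p) 1 = p 1
    rw [twist_one, twist_sq_add_sq, twist_zero, twist_one, neg_mul, Real.sin_neg, Real.cos_neg]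
    linear_combination p 1 * hs
  · rfl

lemma twist_neg_twist (M : ℝ) (p : Space3) : twist (-M) (twist M p) = p := by
  simpa using twist_twist_neg (-M) p

lemma contDiff_twist (M : ℝ) : ContDiff ℝ ∞ (twist M) := by
  have h0 := contDiff_space_coord 0
  have h1 := contDiff_space_coord 1
  have hβ : ContDiff ℝ ∞ fun p : Space3 => M * twistProfile (p 0 ^ 2 + p 1 ^ 2) :=
    contDiff_const.mul (contDiff_twistProfile.comp ((h0.pow 2).add (h1.pow 2)))
  rw [contDiff_euclidean]
  intro i
  fin_cases i
  · exact (h0.mul hβ.cos).sub (h1.mul hβ.sin)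
  · exact (h0.mul hβ.sin).add (h1.mul hβ.cos)
  · exact contDiff_space_coord 2

lemma contDiff_pinchFactor (M : ℝ) : ContDiff ℝ ∞ (pinchFactor M) := by
  have h1 := contDiff_space_coord 1
  have h2 := contDiff_space_coord 2
  unfold pinchFactor
  refine (contDiff_const.add (contDiff_step.comp ?_)).div_const 2
  exact (contDiff_const.mul ((h1.pow 2).add (h2.pow 2))).sub contDiff_const

lemma contDiff_pinch (M : ℝ) : ContDiff ℝ ∞ (pinch M) :=
  (contDiff_pinchFactor M).smul contDiff_id

lemma contDiff_spiralMap (M : ℝ) : ContDiff ℝ ∞ (spiralMap M) :=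
  (contDiff_twist M).comp (contDiff_pinch M)

lemma hasSGrad_sq_add_sq (i j : Fin 3) (x : Space3) : HasSGrad (fun x => x i ^ 2 + x j ^ 2)
    ((2 * x i) • Pi.single i 1 + (2 * x j) • Pi.single j 1) x := by
  have h : ∀ k : Fin 3, HasSGrad (fun x => x k ^ 2) ((2 * x k) • Pi.single k 1) x := fun k =>
    (((hasSGrad_coord k x).comp (hasDerivAt_pow 2 (x k)))).congr (by simp)
  exact (h i).add (h j)

lemma det_fderiv_twist (M : ℝ) (x : Space3) : (fderiv ℝ (twist M) x).det = 1 := by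
  set q := x 0 ^ 2 + x 1 ^ 2 with hq
  set d := M * (25 / 2 * stepDeriv (5 / 2 * q - 3 / 4))
  have hβ : HasSGrad (fun x : Space3 => M * twistProfile (x 0 ^ 2 + x 1 ^ 2))
      (d • ((2 * x 0) • Pi.single 0 1 + (2 * x 1) • Pi.single 1 1)) x :=
    (((hasSGrad_sq_add_sq 0 1 x).comp (hasDerivAt_twistProfile _)).const_mul M).congr
      (by rw [smul_smul])
  have hs := hβ.comp (Real.hasDerivAt_sin _)
  have hc := hβ.comp (Real.hasDerivAt_cos _)
  have h0 := ((hasSGrad_coord 0 x).mul hc).sub ((hasSGrad_coord 1 x).mul hs)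
  have h1 := ((hasSGrad_coord 0 x).mul hs).add ((hasSGrad_coord 1 x).mul hc)
  have h2 := hasSGrad_coord 2 x
  rw [det_fderiv_eq_det3 (G := twist M) h0 h1 h2]
  have := Real.sin_sq_add_cos_sq (M * twistProfile (x 0 ^ 2 + x 1 ^ 2))
  simp [det3]
  linear_combination this

lemma pinchFactor_ge (M : ℝ) (p : Space3) : 1 / 2 ≤ pinchFactor M p := by
  have := Real.smoothTransition.nonneg (2 * M ^ 2 * (p 1 ^ 2 + p 2 ^ 2) - 1)
  rw [pinchFactor]; linarith

lemma pinchFactor_le (M : ℝ) (p : Space3) : pinchFactor M p ≤ 1 := by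
  have := Real.smoothTransition.le_one (2 * M ^ 2 * (p 1 ^ 2 + p 2 ^ 2) - 1)
  rw [pinchFactor]; linarith

lemma pinchFactor_eq_one {M : ℝ} {p : Space3} (h : 1 ≤ M ^ 2 * (p 1 ^ 2 + p 2 ^ 2)) :
    pinchFactor M p = 1 := by
  rw [pinchFactor, Real.smoothTransition.one_of_one_le (by linarith)]; norm_num

lemma det_fderiv_pinch_pos (M : ℝ) (x : Space3) : 0 < (fderiv ℝ (pinch M) x).det := by
  set l := pinchFactor M x
  set u := stepDeriv (2 * M ^ 2 * (x 1 ^ 2 + x 2 ^ 2) - 1)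
  have hl : HasSGrad (pinchFactor M)
      ((M ^ 2 * u) • ((2 * x 1) • Pi.single 1 1 + (2 * x 2) • Pi.single 2 1)) x := by
    have h1 : HasDerivAt (fun t : ℝ => 2 * M ^ 2 * t - 1) (2 * M ^ 2) (x 1 ^ 2 + x 2 ^ 2) := by
      simpa using ((hasDerivAt_id (x 1 ^ 2 + x 2 ^ 2)).const_mul (2 * M ^ 2)).sub_const 1
    have h2 := (((hasDerivAt_step _).comp _ h1).const_add 1).div_const 2
    refine ((hasSGrad_sq_add_sq 1 2 x).comp h2).congr ?_
    congr 1
    simp only [u]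
    ring
  have h0 := hl.mul (hasSGrad_coord 0 x)
  have h1 := hl.mul (hasSGrad_coord 1 x)
  have h2 := hl.mul (hasSGrad_coord 2 x)
  rw [det_fderiv_eq_det3 (G := pinch M) h0 h1 h2]
  have hlp : 1 / 2 ≤ l := pinchFactor_ge M x
  have hu : 0 ≤ u := stepDeriv_nonneg _
  have key : 0 < l ^ 2 * (l + 2 * M ^ 2 * u * (x 1 ^ 2 + x 2 ^ 2)) := by positivity
  convert key using 1
  simp [det3]
  ring

lemma det_fderiv_spiralMap_pos (M : ℝ) (x : Space3) : 0 < (fderiv ℝ (spiralMap M) x).det := by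
  have h1 := ((contDiff_twist M).differentiable (by norm_num)).differentiableAt (x := pinch M x)
  have h2 := ((contDiff_pinch M).differentiable (by norm_num)).differentiableAt (x := x)
  have h : fderiv ℝ (spiralMap M) x = fderiv ℝ (twist M) (pinch M x) ∘L fderiv ℝ (pinch M) x :=
    fderiv_comp x h1 h2
  have hd : (fderiv ℝ (spiralMap M) x).det
      = (fderiv ℝ (twist M) (pinch M x)).det * (fderiv ℝ (pinch M) x).det := by
    rw [h]; exact LinearMap.det_comp _ _
  rw [hd, det_fderiv_twist, one_mul]
  exact det_fderiv_pinch_pos M x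

lemma pinchFactor_mono (M : ℝ) {p p' : Space3} (h : p 1 ^ 2 + p 2 ^ 2 ≤ p' 1 ^ 2 + p' 2 ^ 2) :
    pinchFactor M p ≤ pinchFactor M p' := by
  have := Real.smoothTransition.monotone (show 2 * M ^ 2 * (p 1 ^ 2 + p 2 ^ 2) - 1
    ≤ 2 * M ^ 2 * (p' 1 ^ 2 + p' 2 ^ 2) - 1 by gcongr)
  rw [pinchFactor, pinchFactor]; linarith

lemma injective_pinch (M : ℝ) : Function.Injective (pinch M) := by
  -- two points with the same image lie on a ray, along which the contraction factor increases
  have key : ∀ p p' : Space3, pinch M p = pinch M p' →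
      p 1 ^ 2 + p 2 ^ 2 ≤ p' 1 ^ 2 + p' 2 ^ 2 → p = p' := by
    intro p p' h hle
    have hm := pinchFactor_mono M hle
    have h1 := pinchFactor_ge M p
    have h2 := pinchFactor_ge M p'
    have hc : ∀ i, pinchFactor M p * p i = pinchFactor M p' * p' i := fun i => by
      have := congrArg (fun v : Space3 => v i) h
      simpa [pinch] using this
    have hsq : pinchFactor M p ^ 2 * (p 1 ^ 2 + p 2 ^ 2)
        = pinchFactor M p' ^ 2 * (p' 1 ^ 2 + p' 2 ^ 2) := by
      have a := hc 1
      have b := hc 2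
      linear_combination (pinchFactor M p * p 1 + pinchFactor M p' * p' 1) * a
        + (pinchFactor M p * p 2 + pinchFactor M p' * p' 2) * b
    have heq : p 1 ^ 2 + p 2 ^ 2 = p' 1 ^ 2 + p' 2 ^ 2 := by
      refine le_antisymm hle ?_
      have hpos : 0 < pinchFactor M p' ^ 2 := by positivity
      have : pinchFactor M p' ^ 2 * (p' 1 ^ 2 + p' 2 ^ 2)
          ≤ pinchFactor M p' ^ 2 * (p 1 ^ 2 + p 2 ^ 2) := by
        rw [← hsq]; gcongr
      exact le_of_mul_le_mul_left this hpos
    have hf : pinchFactor M p = pinchFactor M p' := by rw [pinchFactor, pinchFactor, heq]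
    ext i
    have := hc i
    rw [hf] at this
    exact mul_left_cancel₀ (by linarith) this
  intro p p' h
  rcases le_total (p 1 ^ 2 + p 2 ^ 2) (p' 1 ^ 2 + p' 2 ^ 2) with hle | hle
  · exact key p p' h hle
  · exact (key p' p h.symm hle).symm

lemma injective_spiralMap (M : ℝ) : Function.Injective (spiralMap M) := by
  intro p p' h
  apply injective_pinch M
  rw [← twist_neg_twist M (pinch M p), ← twist_neg_twist M (pinch M p')]
  exact congrArg (twist (-M)) h

lemma isOrientedBallDiffeo_spiralMap (M : ℝ) :
    IsOrientedBallDiffeo (spiralMap M) (spiralDomain M) where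
  smooth := ⟨univ, isOpen_univ, subset_univ _, (contDiff_spiralMap M).contDiffOn⟩
  inj := (injective_spiralMap M).injOn
  det_pos x _ := det_fderiv_spiralMap_pos M x
  image_ball := rfl

lemma isOpen_spiralDomain (M : ℝ) : IsOpen (spiralDomain M) := by
  refine isOpenMap_of_hasStrictFDerivAt_equiv
    (f' := fun x => ContinuousLinearMap.toContinuousLinearEquivOfDetNeZero (fderiv ℝ (spiralMap M) x)
      (det_fderiv_spiralMap_pos M x).ne') (fun x => ?_) _ isOpen_ball
  exact ((contDiff_spiralMap M).contDiffAt.hasStrictFDerivAt (by norm_num))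

lemma closure_spiralDomain_subset (M : ℝ) :
    closure (spiralDomain M) ⊆ spiralMap M '' closedBall 0 1 :=
  closure_minimal (image_mono ball_subset_closedBall)
    ((isCompact_closedBall 0 1).image (contDiff_spiralMap M).continuous).isClosed

lemma frontier_spiralDomain_subset (M : ℝ) :
    frontier (spiralDomain M) ⊆ spiralMap M '' sphere 0 1 := by
  rw [(isOpen_spiralDomain M).frontier_eq]
  rintro x ⟨hx, hx'⟩
  obtain ⟨p, hp, rfl⟩ := closure_spiralDomain_subset M hx
  refine ⟨p, ?_, rfl⟩
  rw [mem_closedBall_zero_iff] at hp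
  rw [mem_sphere_zero_iff_norm]
  by_contra hne
  exact hx' ⟨p, by rw [mem_ball_zero_iff]; exact lt_of_le_of_ne hp hne, rfl⟩

lemma isSmoothBallDomain_spiralDomain (M : ℝ) : IsSmoothBallDomain (spiralDomain M) :=
  ⟨isOpen_spiralDomain M, _, isOrientedBallDiffeo_spiralMap M⟩

lemma mem_spiralDomain_of_untwist {M : ℝ} {x : Space3}
    (h : twist (-M) x ∈ pinch M '' ball 0 1) : x ∈ spiralDomain M := by
  obtain ⟨p, hp, h⟩ := h
  exact ⟨p, hp, by rw [spiralMap, h, twist_twist_neg]⟩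

lemma mem_pinch_image_of_norm_lt {M : ℝ} {w : Space3} (hw : ‖w‖ < 1 / 2) :
    w ∈ pinch M '' ball 0 1 := by
  have hc : Continuous fun s : ℝ => s * pinchFactor M (s • w) := by
    have := (contDiff_pinchFactor M).continuous
    fun_prop
  have h1 : (1 : ℝ) ∈ Icc ((1 : ℝ) * pinchFactor M ((1 : ℝ) • w))
      (2 * pinchFactor M ((2 : ℝ) • w)) := by
    constructor
    · linarith [pinchFactor_le M ((1 : ℝ) • w)]
    · linarith [pinchFactor_ge M ((2 : ℝ) • w)]
  obtain ⟨s, hs, hs1⟩ := intermediate_value_Icc (by norm_num) hc.continuousOn h1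
  refine ⟨s • w, ?_, ?_⟩
  · rw [mem_ball_zero_iff, norm_smul, Real.norm_of_nonneg (by linarith [hs.1])]
    have := hs.2
    nlinarith [norm_nonneg w]
  · simp only at hs1
    rw [pinch, smul_smul, mul_comm, hs1, one_smul]

lemma mem_pinch_image_of_far {M : ℝ} {w : Space3} (hw : ‖w‖ < 1)
    (h : 1 ≤ M ^ 2 * (w 1 ^ 2 + w 2 ^ 2)) : w ∈ pinch M '' ball 0 1 :=
  ⟨w, by simpa using hw, by rw [pinch, pinchFactor_eq_one h, one_smul]⟩

/-! ### The area of the boundary -/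

/-- The image of a rectangle under a Lipschitz parametrization has bounded area. -/
lemma euclideanHausdorffMeasure_image_rect_le {f : ℝ → ℝ → Space3} {a b L : ℝ} (ha : 0 ≤ a)
    (hL : 0 ≤ L) (h : ∀ s ∈ Icc 0 a, ∀ s' ∈ Icc 0 a, ∀ t ∈ Icc 0 b, ∀ t' ∈ Icc 0 b,
      dist (f s t) (f s' t') ≤ L * (|s - s'| + |t - t'|)) :
    (Measure.euclideanHausdorffMeasure 2 : Measure Space3)
      {x | ∃ s ∈ Icc 0 a, ∃ t ∈ Icc 0 b, f s t = x} ≤ ENNReal.ofReal ((2 * L) ^ 2 * (a * b)) := by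
  set R : Set (EuclideanSpace ℝ (Fin 2)) := {v | v 0 ∈ Icc 0 a ∧ v 1 ∈ Icc 0 b} with hR
  have hvol : volume R = ENNReal.ofReal (a * b) := by
    have h1 := EuclideanSpace.volume_preserving_symm_measurableEquiv_toLp (Fin 2)
    have h2 : R = (MeasurableEquiv.toLp 2 (Fin 2 → ℝ)).symm ⁻¹'
        (univ.pi ![Icc (0 : ℝ) a, Icc 0 b]) := by
      ext v
      simp [hR]
    rw [h2, h1.measure_preimage_equiv, volume_pi_pi, Fin.prod_univ_two]
    simp only [Matrix.cons_val_zero, Matrix.cons_val_one, Real.volume_Icc, sub_zero]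
    rw [← ENNReal.ofReal_mul ha]
  have himg : {x | ∃ s ∈ Icc 0 a, ∃ t ∈ Icc 0 b, f s t = x}
      ⊆ (fun v : EuclideanSpace ℝ (Fin 2) => f (v 0) (v 1)) '' R := by
    rintro x ⟨s, hs, t, ht, rfl⟩
    exact ⟨!₂[s, t], ⟨hs, ht⟩, rfl⟩
  have hlip : LipschitzOnWith (2 * L).toNNReal
      (fun v : EuclideanSpace ℝ (Fin 2) => f (v 0) (v 1)) R := by
    refine LipschitzOnWith.of_dist_le_mul fun v hv w hw => ?_
    refine (h _ hv.1 _ hw.1 _ hv.2 _ hw.2).trans ?_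
    have hi : ∀ i, |v i - w i| ≤ dist v w := fun i => by
      rw [dist_eq_norm]
      exact PiLp.norm_apply_le (v - w) i
    rw [Real.coe_toNNReal _ (by positivity)]
    nlinarith [hi 0, hi 1]
  refine (measure_mono himg).trans ?_
  have h3 := hlip.hausdorffMeasure_image_le (d := 2) (by norm_num)
  have h4 := congrArg (fun μ : Measure (EuclideanSpace ℝ (Fin 2)) => μ R)
    (EuclideanSpace.euclideanHausdorffMeasure_eq_volume 2)
  simp only [Measure.euclideanHausdorffMeasure_def, Nat.cast_ofNat, Measure.smul_apply, hvol] at h4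
  rw [Measure.euclideanHausdorffMeasure_def, Measure.smul_apply]
  simp only [Nat.cast_ofNat]
  refine (smul_le_smul_of_nonneg_left h3 zero_le).trans_eq ?_
  rw [← mul_smul_comm, h4, ENNReal.ofReal_mul (sq_nonneg (2 * L)),
    ENNReal.ofReal_pow (show 0 ≤ 2 * L by positivity)]
  congr 1
  norm_cast

lemma exists_polar (x y : ℝ) : ∃ ρ ψ : ℝ, 0 ≤ ρ ∧ ρ ^ 2 = x ^ 2 + y ^ 2 ∧ ψ ∈ Icc 0 (2 * Real.pi) ∧
    x = ρ * Real.cos (ψ - Real.pi) ∧ y = ρ * Real.sin (ψ - Real.pi) := by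
  set z : ℂ := ⟨x, y⟩
  have h1 := Complex.norm_mul_cos_arg z
  have h2 := Complex.norm_mul_sin_arg z
  refine ⟨‖z‖, z.arg + Real.pi, norm_nonneg _, ?_, ⟨?_, ?_⟩, ?_, ?_⟩
  · rw [Complex.sq_norm, Complex.normSq_apply]; ring
  · linarith [Complex.neg_pi_lt_arg z]
  · linarith [Complex.arg_le_pi z]
  · rw [add_sub_cancel_right, h1]
  · rw [add_sub_cancel_right, h2]

lemma exists_spherePoint {x : Space3} (hx : ‖x‖ = 1) : ∃ θ ∈ Icc 0 Real.pi,
    ∃ φ ∈ Icc 0 (2 * Real.pi), spherePoint θ (φ - Real.pi) = x := by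
  have hsq := norm_sq_coord x
  rw [hx, one_pow] at hsq
  obtain ⟨ρ, ψ, hρ, hρ2, hψ, h0, h1⟩ := exists_polar (x 0) (x 1)
  refine ⟨Real.arccos (x 2), ⟨Real.arccos_nonneg _, Real.arccos_le_pi _⟩, ψ, hψ, ?_⟩
  have hs : Real.sin (Real.arccos (x 2)) = ρ := by
    rw [Real.sin_arccos, show 1 - x 2 ^ 2 = ρ ^ 2 by linarith, Real.sqrt_sq hρ]
  have hc : Real.cos (Real.arccos (x 2)) = x 2 :=
    Real.cos_arccos (by nlinarith) (by nlinarith)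
  ext i
  fin_cases i
  · simp [spherePoint, hs, h0]
  · simp [spherePoint, hs, h1]
  · simp [spherePoint, hc]

lemma euclideanHausdorffMeasure_sphere_le :
    (Measure.euclideanHausdorffMeasure 2 : Measure Space3) (sphere 0 1)
      ≤ ENNReal.ofReal ((2 * 3) ^ 2 * (Real.pi * (2 * Real.pi))) := by
  refine le_trans (measure_mono ?_) (euclideanHausdorffMeasure_image_rect_le
    (f := fun θ φ => spherePoint θ (φ - Real.pi)) Real.pi_pos.le (by norm_num) ?_)
  · intro x hx
    exact exists_spherePoint (mem_sphere_zero_iff_norm.1 hx)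
  · intro s _ s' _ t _ t' _
    refine (dist_spherePoint_le _ _ _ _).trans ?_
    rw [sub_sub_sub_cancel_right]
    linarith [abs_nonneg (t - t')]

/-- The contraction factor at a point of the sphere at distance `r / M` from the first axis. -/
noncomputable def fingerFactor (r : ℝ) : ℝ := (1 + Real.smoothTransition (2 * r ^ 2 - 1)) / 2

lemma fingerFactor_nonneg (r : ℝ) : 0 ≤ fingerFactor r := by
  have := Real.smoothTransition.nonneg (2 * r ^ 2 - 1)
  rw [fingerFactor]; positivity

lemma fingerFactor_le_one (r : ℝ) : fingerFactor r ≤ 1 := by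
  have := Real.smoothTransition.le_one (2 * r ^ 2 - 1)
  rw [fingerFactor]; linarith

lemma abs_fingerFactor_sub_le {L : ℝ} (hL' : ∀ x, |stepDeriv x| ≤ L) {r r' : ℝ}
    (hr : r ∈ Icc 0 1) (hr' : r' ∈ Icc 0 1) :
    |fingerFactor r - fingerFactor r'| ≤ 2 * L * |r - r'| := by
  have hL0 : 0 ≤ L := (abs_nonneg _).trans (hL' 0)
  have h1 := abs_sub_le_of_deriv_le hasDerivAt_step hL' (2 * r ^ 2 - 1) (2 * r' ^ 2 - 1)
  have h2 : |2 * r ^ 2 - 1 - (2 * r' ^ 2 - 1)| ≤ 4 * |r - r'| := by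
    rw [show 2 * r ^ 2 - 1 - (2 * r' ^ 2 - 1) = 2 * (r + r') * (r - r') by ring, abs_mul,
      abs_of_nonneg (by linarith [hr.1, hr'.1])]
    have := hr.2
    have := hr'.2
    gcongr
    linarith
  have h3 : fingerFactor r - fingerFactor r' = (Real.smoothTransition (2 * r ^ 2 - 1)
      - Real.smoothTransition (2 * r' ^ 2 - 1)) / 2 := by rw [fingerFactor, fingerFactor]; ring
  rw [h3, abs_div, abs_two]
  have h4 := mul_le_mul_of_nonneg_left h2 hL0
  linarith

/-- The parametrization of the boundary of a spiralling finger: `s / M` is the rescaled distance of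
the corresponding point of the sphere to the first axis, and `M * u` is the angle about this axis.
With this scaling the parametrization is Lipschitz uniformly in `M`. -/
noncomputable def fingerMap (M σ s u : ℝ) : Space3 :=
  twist M (fingerFactor (s / M) •
    !₂[σ * √(1 - (s / M / M) ^ 2), s / M / M * Real.cos (M * u - Real.pi),
      s / M / M * Real.sin (M * u - Real.pi)])

lemma abs_sqrt_sub_le {a b : ℝ} (ha : a ≤ 3 / 4) (hb : b ≤ 3 / 4) :
    |√(1 - a) - √(1 - b)| ≤ |a - b| := by
  have h1 : 1 / 2 ≤ √(1 - a) := Real.le_sqrt_of_sq_le (by linarith)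
  have h2 : 1 / 2 ≤ √(1 - b) := Real.le_sqrt_of_sq_le (by linarith)
  have h3 := Real.sq_sqrt (show 0 ≤ 1 - a by linarith)
  have h4 := Real.sq_sqrt (show 0 ≤ 1 - b by linarith)
  have h5 : b - a = (√(1 - a) - √(1 - b)) * (√(1 - a) + √(1 - b)) := by linarith [h3, h4]
  rw [abs_sub_comm a b, h5, abs_mul, abs_of_pos (show 0 < √(1 - a) + √(1 - b) by linarith)]
  nlinarith [abs_nonneg (√(1 - a) - √(1 - b))]

lemma dist_twist_le {M L K x y z x' y' z' : ℝ} (h' : x' ^ 2 + y' ^ 2 ≤ 1)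
    (hβ : |M * twistProfile (x ^ 2 + y ^ 2) - M * twistProfile (x' ^ 2 + y' ^ 2)| ≤ K)
    (hx : |x - x'| ≤ L) (hy : |y - y'| ≤ L) (hz : |z - z'| ≤ L) :
    dist (twist M !₂[x, y, z]) (twist M !₂[x', y', z']) ≤ 5 * L + 4 * K := by
  have hx' : |x'| ≤ 1 := abs_le_one_iff_mul_self_le_one.2 (by nlinarith)
  have hy' : |y'| ≤ 1 := abs_le_one_iff_mul_self_le_one.2 (by nlinarith)
  rw [dist_eq_norm]
  refine (norm_le_sum_abs _).trans ?_
  change |x * Real.cos (M * twistProfile (x ^ 2 + y ^ 2))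
      - y * Real.sin (M * twistProfile (x ^ 2 + y ^ 2))
      - (x' * Real.cos (M * twistProfile (x' ^ 2 + y' ^ 2))
        - y' * Real.sin (M * twistProfile (x' ^ 2 + y' ^ 2)))|
    + |x * Real.sin (M * twistProfile (x ^ 2 + y ^ 2))
      + y * Real.cos (M * twistProfile (x ^ 2 + y ^ 2))
      - (x' * Real.sin (M * twistProfile (x' ^ 2 + y' ^ 2))
        + y' * Real.cos (M * twistProfile (x' ^ 2 + y' ^ 2)))| + |z - z'| ≤ _
  generalize M * twistProfile (x ^ 2 + y ^ 2) = β at *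
  generalize M * twistProfile (x' ^ 2 + y' ^ 2) = β' at *
  have hcos := (abs_cos_sub_le β β').trans hβ
  have hsin := (abs_sin_sub_le β β').trans hβ
  have e0 := abs_mul_sub_mul_le (a := x) (d := Real.cos β') (Real.abs_cos_le_one β) hx'
  have e1 := abs_mul_sub_mul_le (a := y) (d := Real.sin β') (Real.abs_sin_le_one β) hy'
  have e2 := abs_mul_sub_mul_le (a := x) (d := Real.sin β') (Real.abs_sin_le_one β) hx'
  have e3 := abs_mul_sub_mul_le (a := y) (d := Real.cos β') (Real.abs_cos_le_one β) hy'
  have f0 : |x * Real.cos β - y * Real.sin β - (x' * Real.cos β' - y' * Real.sin β')|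
      ≤ |x * Real.cos β - x' * Real.cos β'| + |y * Real.sin β - y' * Real.sin β'| := by
    rw [sub_sub_sub_comm]; exact abs_sub _ _
  have f1 : |x * Real.sin β + y * Real.cos β - (x' * Real.sin β' + y' * Real.cos β')|
      ≤ |x * Real.sin β - x' * Real.sin β'| + |y * Real.cos β - y' * Real.cos β'| := by
    rw [add_sub_add_comm]; exact abs_add_le _ _
  linarith

lemma abs_axial_sub_le {L D l l' a a' σ : ℝ} (hσ : |σ| = 1) (hL : 1 ≤ L) (hD : 0 ≤ D)
    (hl' : |l'| ≤ 1) (hll : |l - l'| ≤ 2 * L * D) (ha : a ∈ Icc 0 (1 / 2))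
    (ha' : a' ∈ Icc 0 (1 / 2)) (haD : |a - a'| ≤ D) :
    |l * (σ * √(1 - a ^ 2)) - l' * (σ * √(1 - a' ^ 2))| ≤ 4 * L * D := by
  have h1 := abs_mul_sub_mul_le (a := l) (b := √(1 - a ^ 2)) (c := l') (d := √(1 - a' ^ 2))
    (A := 1) (B := 1) (by
      rw [abs_of_nonneg (Real.sqrt_nonneg _)]
      exact Real.sqrt_le_one.2 (by linarith [sq_nonneg a])) hl'
  have h2 := abs_sqrt_sub_le (a := a ^ 2) (b := a' ^ 2) (by nlinarith [ha.1, ha.2])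
    (by nlinarith [ha'.1, ha'.2])
  have h3 : |a ^ 2 - a' ^ 2| ≤ 1 * |a - a'| := by
    rw [sq_sub_sq, abs_mul, abs_of_nonneg (by linarith [ha.1, ha'.1])]
    gcongr
    linarith [ha.2, ha'.2]
  have h5 : l * (σ * √(1 - a ^ 2)) - l' * (σ * √(1 - a' ^ 2))
      = σ * (l * √(1 - a ^ 2) - l' * √(1 - a' ^ 2)) := by ring
  rw [h5, abs_mul, hσ, one_mul]
  have h6 : D ≤ L * D := le_mul_of_one_le_left hD hL
  linarith

lemma abs_transverse_sub_le {L D M b b' u u' : ℝ} (hM : 0 < M) (hbM : |b'| ≤ 1 / M)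
    (hb : |b - b'| ≤ 3 * L * D) (hu : L * |u - u'| ≤ L * D) (hL : 1 ≤ L) {f : ℝ → ℝ}
    (h1 : ∀ x, |f x| ≤ 1) (h2 : ∀ x y, |f x - f y| ≤ |x - y|) :
    |b * f (M * u - Real.pi) - b' * f (M * u' - Real.pi)| ≤ 4 * L * D := by
  have h3 := abs_mul_sub_mul_le (a := b) (d := f (M * u' - Real.pi)) (h1 (M * u - Real.pi)) hbM
  have h4 := h2 (M * u - Real.pi) (M * u' - Real.pi)
  rw [sub_sub_sub_cancel_right, ← mul_sub, abs_mul, abs_of_pos hM] at h4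
  have h5 : 1 / M * |f (M * u - Real.pi) - f (M * u' - Real.pi)| ≤ |u - u'| := by
    rw [one_div_mul_eq_div, div_le_iff₀ hM]; linarith
  have h6 : |u - u'| ≤ L * |u - u'| := le_mul_of_one_le_left (abs_nonneg _) hL
  linarith

/-- The twisting angle depends on the third coordinate `z`, of order `1 / M`, only through its
square, which compensates for the factor `M`. -/
lemma abs_twistProfile_sub_le {L D M l l' z z' : ℝ} (hL : 1 ≤ L) (hL' : ∀ x, |stepDeriv x| ≤ L)
    (hM : 0 < M) (hl : l ∈ Icc 0 1) (hl' : l' ∈ Icc 0 1) (hll : M * |l - l'| ≤ 2 * L * D)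
    (hz : |z| ≤ 1 / M) (hz' : |z'| ≤ 1 / M) (hzz : |z - z'| ≤ 4 * L * D) :
    |M * twistProfile (l ^ 2 - z ^ 2) - M * twistProfile (l' ^ 2 - z' ^ 2)| ≤ 150 * L ^ 2 * D := by
  rw [← mul_sub, abs_mul, abs_of_pos hM]
  have h1 := abs_sub_le_of_deriv_le hasDerivAt_twistProfile (L := 25 / 2 * L)
    (fun x => by rw [abs_mul, abs_of_pos (by norm_num)]; gcongr; exact hL' _)
    (l ^ 2 - z ^ 2) (l' ^ 2 - z' ^ 2)
  have h2 : |l ^ 2 - z ^ 2 - (l' ^ 2 - z' ^ 2)|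
      ≤ |l - l'| * |l + l'| + |z + z'| * |z - z'| := by
    rw [show l ^ 2 - z ^ 2 - (l' ^ 2 - z' ^ 2) = (l - l') * (l + l') - (z + z') * (z - z') by ring,
      ← abs_mul, ← abs_mul]
    exact abs_sub _ _
  have h3 : |l + l'| ≤ 2 := by
    rw [abs_of_nonneg (by linarith [hl.1, hl'.1])]; linarith [hl.2, hl'.2]
  have h4 : |z + z'| ≤ 2 / M := by
    refine (abs_add_le _ _).trans ?_
    calc _ ≤ 1 / M + 1 / M := by linarith
      _ = _ := by ring
  have h6 : M * (|l - l'| * |l + l'|) ≤ 4 * L * D := by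
    calc M * (|l - l'| * |l + l'|) = M * |l - l'| * |l + l'| := by ring
      _ ≤ 2 * L * D * 2 := by
        gcongr
        exact (mul_nonneg hM.le (abs_nonneg _)).trans hll
      _ = _ := by ring
  have h7 : M * (|z + z'| * |z - z'|) ≤ 8 * L * D := by
    have e : |z + z'| * |z - z'| ≤ 2 / M * (4 * L * D) := by gcongr
    calc _ ≤ M * (2 / M * (4 * L * D)) := by gcongr
      _ = _ := by field_simp; ring
  calc M * |twistProfile (l ^ 2 - z ^ 2) - twistProfile (l' ^ 2 - z' ^ 2)|
      ≤ M * (25 / 2 * L * (|l - l'| * |l + l'| + |z + z'| * |z - z'|)) := by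
        gcongr
        exact h1.trans (by gcongr)
    _ = 25 / 2 * L * (M * (|l - l'| * |l + l'|) + M * (|z + z'| * |z - z'|)) := by ring
    _ ≤ 25 / 2 * L * (4 * L * D + 8 * L * D) := by gcongr
    _ = 150 * L ^ 2 * D := by ring

lemma finger_sq_add_sq {σ : ℝ} (hσ : |σ| = 1) (l ψ : ℝ) {a : ℝ} (ha : a ∈ Icc 0 (1 / 2)) :
    (l * (σ * √(1 - a ^ 2))) ^ 2 + (l * (a * Real.cos ψ)) ^ 2
      = l ^ 2 - (l * a * Real.sin ψ) ^ 2 := by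
  have h1 := Real.sq_sqrt (show 0 ≤ 1 - a ^ 2 by nlinarith [ha.1, ha.2])
  have h2 : σ ^ 2 = 1 := by rw [← sq_abs, hσ, one_pow]
  have h3 := Real.sin_sq_add_cos_sq ψ
  linear_combination l ^ 2 * √(1 - a ^ 2) ^ 2 * h2 + l ^ 2 * h1 + l ^ 2 * a ^ 2 * h3

lemma dist_twist_finger_le {L : ℝ} (hL : 1 ≤ L) (hL' : ∀ x, |stepDeriv x| ≤ L) {M σ : ℝ}
    (hM : 2 ≤ M) (hσ : |σ| = 1) {D l l' a a' u u' : ℝ} (hl : l ∈ Icc 0 1) (hl' : l' ∈ Icc 0 1)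
    (ha : a ∈ Icc 0 (1 / M)) (ha' : a' ∈ Icc 0 (1 / M)) (hll : M * |l - l'| ≤ 2 * L * D)
    (haD : |a - a'| ≤ D) (huD : |u - u'| ≤ D) :
    dist (twist M (l • !₂[σ * √(1 - a ^ 2), a * Real.cos (M * u - Real.pi),
        a * Real.sin (M * u - Real.pi)]))
      (twist M (l' • !₂[σ * √(1 - a' ^ 2), a' * Real.cos (M * u' - Real.pi),
        a' * Real.sin (M * u' - Real.pi)])) ≤ 640 * L ^ 2 * D := by
  have hM0 : 0 < M := by linarith
  have hD0 : 0 ≤ D := (abs_nonneg _).trans haD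
  have hM2 : 1 / M ≤ 1 / 2 := one_div_le_one_div_of_le two_pos hM
  have ha1 : a ∈ Icc (0 : ℝ) (1 / 2) := ⟨ha.1, ha.2.trans hM2⟩
  have ha1' : a' ∈ Icc (0 : ℝ) (1 / 2) := ⟨ha'.1, ha'.2.trans hM2⟩
  have hl1' : |l'| ≤ 1 := by rw [abs_of_nonneg hl'.1]; exact hl'.2
  have hllD : |l - l'| ≤ 2 * L * D :=
    (le_mul_of_one_le_left (abs_nonneg _) (by linarith)).trans hll
  have hb1 : |l * a| ≤ 1 / M := by
    rw [abs_of_nonneg (mul_nonneg hl.1 ha.1)]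
    exact (mul_le_of_le_one_left ha.1 hl.2).trans ha.2
  have hb1' : |l' * a'| ≤ 1 / M := by
    rw [abs_of_nonneg (mul_nonneg hl'.1 ha'.1)]
    exact (mul_le_of_le_one_left ha'.1 hl'.2).trans ha'.2
  have hbD : |l * a - l' * a'| ≤ 3 * L * D := by
    have h := abs_mul_sub_mul_le (a := l) (b := a) (c := l') (d := a') (A := 1) (B := 1)
      (by rw [abs_of_nonneg ha1.1]; linarith [ha1.2]) hl1'
    have h6 : D ≤ L * D := le_mul_of_one_le_left hD0 hL
    linarith
  have huD : L * |u - u'| ≤ L * D := mul_le_mul_of_nonneg_left huD (by linarith)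
  have hcos := abs_transverse_sub_le hM0 hb1' hbD huD hL Real.abs_cos_le_one abs_cos_sub_le
  have hsin := abs_transverse_sub_le hM0 hb1' hbD huD hL Real.abs_sin_le_one abs_sin_sub_le
  have hz : ∀ b x : ℝ, |b| ≤ 1 / M → |b * Real.sin x| ≤ 1 / M := fun b x hb => by
    rw [abs_mul]
    exact (mul_le_of_le_one_right (abs_nonneg _) (Real.abs_sin_le_one x)).trans hb
  have hβ := abs_twistProfile_sub_le hL hL' hM0 hl hl' hll (hz _ _ hb1) (hz _ _ hb1') hsin
  rw [← finger_sq_add_sq hσ l _ ha1, ← finger_sq_add_sq hσ l' _ ha1'] at hβ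
  rw [mul_assoc, mul_assoc] at hcos hsin
  have hax := abs_axial_sub_le hσ hL hD0 hl1' hllD ha1 ha1' haD
  have hv : ∀ l x y z : ℝ, l • (!₂[x, y, z] : Space3) = !₂[l * x, l * y, l * z] := fun l x y z => by
    ext i
    fin_cases i <;> rfl
  rw [hv, hv]
  refine (dist_twist_le ?_ hβ hax hcos hsin).trans ?_
  · rw [finger_sq_add_sq hσ l' _ ha1']
    linarith [pow_le_one₀ hl'.1 hl'.2 (n := 2),
      sq_nonneg (l' * a' * Real.sin (M * u' - Real.pi))]
  · have h1 : L ≤ L ^ 2 := le_self_pow₀ hL two_ne_zero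
    have : L * D ≤ L ^ 2 * D := mul_le_mul_of_nonneg_right h1 hD0
    linarith [mul_nonneg (sq_nonneg L) hD0]

lemma dist_fingerMap_le {L : ℝ} (hL : 1 ≤ L) (hL' : ∀ x, |stepDeriv x| ≤ L) {M σ : ℝ} (hM : 2 ≤ M)
    (hσ : |σ| = 1) {s s' : ℝ} (hs : s ∈ Icc 0 M) (hs' : s' ∈ Icc 0 M) (u u' : ℝ) :
    dist (fingerMap M σ s u) (fingerMap M σ s' u') ≤ 640 * L ^ 2 * (|s - s'| + |u - u'|) := by
  have hM0 : 0 < M := by linarith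
  have hdiv : ∀ x y : ℝ, M * |x / M - y / M| = |x - y| := fun x y => by
    rw [← sub_div, abs_div, abs_of_pos hM0]; field_simp
  have hdiv' : ∀ x y : ℝ, |x / M - y / M| ≤ |x - y| := fun x y =>
    (le_mul_of_one_le_left (abs_nonneg _) (by linarith)).trans_eq (hdiv x y)
  have hr : ∀ x ∈ Icc 0 M, x / M ∈ Icc (0 : ℝ) 1 := fun x hx =>
    ⟨div_nonneg hx.1 hM0.le, (div_le_one hM0).2 hx.2⟩
  have ha : ∀ x ∈ Icc (0 : ℝ) 1, x / M ∈ Icc (0 : ℝ) (1 / M) := fun x hx =>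
    ⟨div_nonneg hx.1 hM0.le, div_le_div_of_nonneg_right hx.2 hM0.le⟩
  have hl : ∀ x, fingerFactor x ∈ Icc (0 : ℝ) 1 := fun x =>
    ⟨fingerFactor_nonneg x, fingerFactor_le_one x⟩
  refine dist_twist_finger_le hL hL' hM hσ (hl _) (hl _) (ha _ (hr _ hs)) (ha _ (hr _ hs')) ?_ ?_ ?_
  · have h1 := mul_le_mul_of_nonneg_left (abs_fingerFactor_sub_le hL' (hr _ hs) (hr _ hs')) hM0.le
    refine h1.trans ?_
    rw [mul_left_comm, hdiv]
    exact mul_le_mul_of_nonneg_left (by linarith [abs_nonneg (u - u')]) (by linarith)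
  · exact (hdiv' _ _).trans ((hdiv' _ _).trans (by linarith [abs_nonneg (u - u')]))
  · linarith [abs_nonneg (s - s')]

lemma frontier_spiralDomain_subset_union {M : ℝ} (hM : 2 ≤ M) :
    frontier (spiralDomain M) ⊆ sphere 0 1 ∪
      ({x | ∃ s ∈ Icc 0 M, ∃ u ∈ Icc 0 (2 * Real.pi / M), fingerMap M 1 s u = x} ∪
      {x | ∃ s ∈ Icc 0 M, ∃ u ∈ Icc 0 (2 * Real.pi / M), fingerMap M (-1) s u = x}) := by
  have hM0 : 0 < M := by linarith
  intro x hx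
  obtain ⟨p, hp, rfl⟩ := frontier_spiralDomain_subset M hx
  rw [mem_sphere_zero_iff_norm] at hp
  rcases le_or_gt 1 (M ^ 2 * (p 1 ^ 2 + p 2 ^ 2)) with h | h
  · left
    rw [mem_sphere_zero_iff_norm, spiralMap, norm_twist, pinch, pinchFactor_eq_one h, one_smul, hp]
  · right
    have hsq := norm_sq_coord p
    rw [hp, one_pow] at hsq
    obtain ⟨ρ, ψ, hρ, hρ2, hψ, h1, h2⟩ := exists_polar (p 1) (p 2)
    have hMρ : M * ρ ≤ 1 := by
      rw [← hρ2, ← mul_pow] at h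
      exact (sq_lt_one_iff₀ (by positivity)).1 h |>.le
    have hs : M ^ 2 * ρ ∈ Icc 0 M := ⟨by positivity, by nlinarith⟩
    have hu : ψ / M ∈ Icc 0 (2 * Real.pi / M) :=
      ⟨div_nonneg hψ.1 hM0.le, by gcongr; exact hψ.2⟩
    have e1 : M ^ 2 * ρ / M = M * ρ := by field_simp
    have e2 : M * ρ / M = ρ := by field_simp
    have e3 : M * (ψ / M) = ψ := by field_simp
    have hmain : ∀ σ : ℝ, p 0 = σ * √(1 - ρ ^ 2) →
        fingerMap M σ (M ^ 2 * ρ) (ψ / M) = spiralMap M p := by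
      intro σ hσ
      rw [fingerMap, fingerFactor, spiralMap, pinch, pinchFactor, e1, e2, e3, ← hσ, ← h1, ← h2, ← hρ2]
      congr 2
      · ring_nf
      · ext i
        fin_cases i <;> rfl
    have hsqrt : √(1 - ρ ^ 2) = |p 0| := by
      rw [show 1 - ρ ^ 2 = p 0 ^ 2 by linarith, Real.sqrt_sq_eq_abs]
    rcases le_total 0 (p 0) with h0 | h0
    · left
      exact ⟨_, hs, _, hu, hmain 1 (by rw [hsqrt, abs_of_nonneg h0, one_mul])⟩
    · right
      exact ⟨_, hs, _, hu, hmain (-1) (by rw [hsqrt, abs_of_nonpos h0]; ring)⟩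

/-- The boundary consists of parts of the sphere and of two fingers, whose parametrizations have
domains of area `2 * π` and Lipschitz constants independent of `M`. -/
theorem exists_area_bound : ∃ C : ℝ, 0 < C ∧ ∀ M : ℝ, 2 ≤ M →
    (Measure.euclideanHausdorffMeasure 2 : Measure Space3) (frontier (spiralDomain M))
      ≤ ENNReal.ofReal C := by
  obtain ⟨L, hL, hL', -⟩ := exists_step_bound
  have hπ := Real.pi_pos
  refine ⟨(2 * 3) ^ 2 * (Real.pi * (2 * Real.pi)) + ((2 * (640 * L ^ 2)) ^ 2 * (2 * Real.pi)
    + (2 * (640 * L ^ 2)) ^ 2 * (2 * Real.pi)), by positivity, fun M hM => ?_⟩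
  have hM0 : 0 < M := by linarith
  refine (measure_mono (frontier_spiralDomain_subset_union hM)).trans ?_
  have hf : ∀ σ : ℝ, |σ| = 1 → (Measure.euclideanHausdorffMeasure 2 : Measure Space3)
      {x | ∃ s ∈ Icc 0 M, ∃ u ∈ Icc 0 (2 * Real.pi / M), fingerMap M σ s u = x}
      ≤ ENNReal.ofReal ((2 * (640 * L ^ 2)) ^ 2 * (2 * Real.pi)) := by
    intro σ hσ
    refine (euclideanHausdorffMeasure_image_rect_le hM0.le (by positivity)
      fun s hs s' hs' u _ u' _ => dist_fingerMap_le hL hL' hM hσ hs hs' u u').trans_eq ?_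
    rw [mul_div_cancel₀ _ hM0.ne']
  rw [ENNReal.ofReal_add (by positivity) (by positivity),
    ENNReal.ofReal_add (by positivity) (by positivity)]
  refine (measure_union_le _ _).trans (add_le_add euclideanHausdorffMeasure_sphere_le ?_)
  exact (measure_union_le _ _).trans (add_le_add (hf 1 (by simp)) (hf (-1) (by simp)))

/-! ### A one-form with bounded exterior derivative -/

/-- The angle of the horizontal part of the untwisted point `twist (-M) x`, modulo `π`, taken in
`[-π, 0]`. It jumps only across the vertical plane which contains the untwisted fingers. -/
noncomputable def fingerAngle (M : ℝ) (x : Space3) : ℝ :=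
  -Real.arctan (twist (-M) x 0 * (twist (-M) x 1)⁻¹) - Real.pi / 2

/-- A function which increases from `0` near the third axis to `M` near the unit circle of the plane
`z = 0`. Its second factor is a function of the twist profile, corrected by the angle so that the
twisting cancels in its gradient. The first factor cuts it off near the jump of the angle. -/
noncomputable def spiralHeight (M : ℝ) (x : Space3) : ℝ :=
  Real.smoothTransition (20 * M ^ 2 * twist (-M) x 1 ^ 2 - 1)
    * (M * Real.smoothTransition (twistProfile (x 0 ^ 2 + x 1 ^ 2) + fingerAngle M x / M + 5))

lemma fingerAngle_nonpos (M : ℝ) (x : Space3) : fingerAngle M x ≤ 0 := by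
  rw [fingerAngle]
  linarith [Real.neg_pi_div_two_lt_arctan (twist (-M) x 0 * (twist (-M) x 1)⁻¹)]

lemma neg_pi_le_fingerAngle (M : ℝ) (x : Space3) : -Real.pi ≤ fingerAngle M x := by
  rw [fingerAngle]
  linarith [Real.arctan_lt_pi_div_two (twist (-M) x 0 * (twist (-M) x 1)⁻¹)]

lemma contDiff_twist_coord (M : ℝ) (i : Fin 3) : ContDiff ℝ ∞ fun x => twist M x i :=
  (contDiff_space_coord i).comp (contDiff_twist M)

lemma spiralHeight_eq_zero_of_small {M : ℝ} {x : Space3} (h : 20 * M ^ 2 * twist (-M) x 1 ^ 2 ≤ 1) :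
    spiralHeight M x = 0 := by
  rw [spiralHeight, Real.smoothTransition.zero_of_nonpos (by linarith), zero_mul]

lemma spiralHeight_eq_zero_of_le {M : ℝ} (hM : 0 ≤ M) {x : Space3}
    (h : x 0 ^ 2 + x 1 ^ 2 ≤ 3 / 10) : spiralHeight M x = 0 := by
  have h1 : fingerAngle M x / M ≤ 0 := div_nonpos_of_nonpos_of_nonneg (fingerAngle_nonpos M x) hM
  rw [spiralHeight, twistProfile_of_le h, Real.smoothTransition.zero_of_nonpos (x := _ + _ + _)
    (by linarith), mul_zero, mul_zero]

lemma contDiff_spiralHeight (M : ℝ) : ContDiff ℝ ∞ (spiralHeight M) := by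
  rw [contDiff_iff_contDiffAt]
  intro x
  have h0 := contDiff_twist_coord (-M) 0
  have h1 := contDiff_twist_coord (-M) 1
  have hc : ContDiff ℝ ∞ fun x => 20 * M ^ 2 * twist (-M) x 1 ^ 2 := contDiff_const.mul (h1.pow 2)
  by_cases hx : 20 * M ^ 2 * twist (-M) x 1 ^ 2 < 1
  · refine (contDiffAt_const (c := (0 : ℝ))).congr_of_eventuallyEq ?_
    filter_upwards [hc.continuous.continuousAt.eventually_lt continuousAt_const hx] with y hy
    exact spiralHeight_eq_zero_of_small hy.le
  · have hne : twist (-M) x 1 ≠ 0 := by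
      intro h
      rw [h] at hx
      norm_num at hx
    have hang : ContDiffAt ℝ ∞ (fingerAngle M) x :=
      ((Real.contDiff_arctan.contDiffAt.comp x
        (h0.contDiffAt.mul (h1.contDiffAt.inv hne))).neg).sub contDiffAt_const
    have hq : ContDiff ℝ ∞ fun x : Space3 => twistProfile (x 0 ^ 2 + x 1 ^ 2) :=
      contDiff_twistProfile.comp
        (((contDiff_space_coord 0).pow 2).add ((contDiff_space_coord 1).pow 2))
    exact (contDiff_step.comp (hc.sub contDiff_const)).contDiffAt.mul
      (contDiffAt_const.mul (contDiff_step.contDiffAt.comp x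
        ((hq.contDiffAt.add (hang.div_const M)).add contDiffAt_const)))

lemma hasSGrad_twistProfile (x : Space3) :
    HasSGrad (fun x => twistProfile (x 0 ^ 2 + x 1 ^ 2))
      ((25 / 2 * stepDeriv (5 / 2 * (x 0 ^ 2 + x 1 ^ 2) - 3 / 4)) • ![2 * x 0, 2 * x 1, 0]) x :=
  ((hasSGrad_sq_add_sq 0 1 x).comp (hasDerivAt_twistProfile _)).congr (by
    congr 1
    ext i
    fin_cases i <;> simp)

lemma hasSGrad_twist_coord {M : ℝ} {g : Fin 3 → ℝ} {x : Space3}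
    (hβ : HasSGrad (fun x => M * twistProfile (x 0 ^ 2 + x 1 ^ 2)) g x) :
    HasSGrad (fun x => twist M x 0)
      (![Real.cos (M * twistProfile (x 0 ^ 2 + x 1 ^ 2)),
        -Real.sin (M * twistProfile (x 0 ^ 2 + x 1 ^ 2)), 0] - twist M x 1 • g) x ∧
    HasSGrad (fun x => twist M x 1)
      (![Real.sin (M * twistProfile (x 0 ^ 2 + x 1 ^ 2)),
        Real.cos (M * twistProfile (x 0 ^ 2 + x 1 ^ 2)), 0] + twist M x 0 • g) x := by
  have hs := hβ.comp (Real.hasDerivAt_sin _)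
  have hc := hβ.comp (Real.hasDerivAt_cos _)
  constructor
  · refine (((hasSGrad_coord 0 x).mul hc).sub ((hasSGrad_coord 1 x).mul hs)).congr ?_
    rw [twist_one]
    ext i
    fin_cases i <;> simp <;> ring
  · refine (((hasSGrad_coord 0 x).mul hs).add ((hasSGrad_coord 1 x).mul hc)).congr ?_
    rw [twist_zero]
    ext i
    fin_cases i <;> simp <;> ring

/-- The twisting and the rotation of the angle cancel in the gradient of the length along the
fingers. -/
lemma hasSGrad_fingerLength {M : ℝ} (hM : M ≠ 0) {x : Space3} (hx : twist (-M) x 1 ≠ 0) :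
    HasSGrad (fun x => twistProfile (x 0 ^ 2 + x 1 ^ 2) + fingerAngle M x / M + 5)
      ((1 / (M * (x 0 ^ 2 + x 1 ^ 2))) • ![-x 1, x 0, 0]) x := by
  have hσ := hasSGrad_twistProfile x
  generalize 25 / 2 * stepDeriv (5 / 2 * (x 0 ^ 2 + x 1 ^ 2) - 3 / 4) = d at hσ
  obtain ⟨h0, h1⟩ := hasSGrad_twist_coord (hσ.const_mul (-M))
  have hquot := (h0.mul (h1.comp (hasDerivAt_inv hx))).comp (Real.hasDerivAt_arctan _)
  have hang := ((hquot.const_mul (-1)).sub (hasSGrad_const (Real.pi / 2) x)).const_mul (1 / M)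
  have := (hσ.add hang).add (hasSGrad_const 5 x)
  have hq := twist_sq_add_sq (-M) x
  have hq0 : x 0 ^ 2 + x 1 ^ 2 ≠ 0 := by
    rw [← hq]; positivity
  refine HasSGrad.congr (g := _) (HasSGrad.congr_of_eventuallyEq this
    (Eventually.of_forall fun y => ?_)) ?_
  · simp only [fingerAngle]; ring
  · have e0 := twist_zero (-M) x
    have e1 := twist_one (-M) x
    have hs := Real.sin_sq_add_cos_sq (-M * twistProfile (x 0 ^ 2 + x 1 ^ 2))
    generalize Real.cos (-M * twistProfile (x 0 ^ 2 + x 1 ^ 2)) = C at *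
    generalize Real.sin (-M * twistProfile (x 0 ^ 2 + x 1 ^ 2)) = S at *
    generalize twist (-M) x 0 = w at *
    generalize twist (-M) x 1 = v at *
    have hx0 : x 0 = w * C + v * S := by rw [e0, e1]; linear_combination -x 0 * hs
    have hx1 : x 1 = v * C - w * S := by rw [e0, e1]; linear_combination -x 1 * hs
    have hd : 1 + (w * v⁻¹) ^ 2 = (x 0 ^ 2 + x 1 ^ 2) / v ^ 2 := by
      rw [← hq]; field_simp; ring
    rw [hd]
    generalize x 0 = X at *
    generalize x 1 = Y at *
    generalize hQ : X ^ 2 + Y ^ 2 = Q at *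
    ext i
    fin_cases i
    · simp
      field_simp
      linear_combination (-2 * d * X * M) * hq + hx1
    · simp
      field_simp
      linear_combination (-2 * d * Y * M) * hq - hx0
    · simp

lemma hasSGrad_spiralHeight {M : ℝ} (hM : M ≠ 0) {x : Space3}
    (hx : 2 < 20 * M ^ 2 * twist (-M) x 1 ^ 2) :
    HasSGrad (spiralHeight M)
      ((stepDeriv (twistProfile (x 0 ^ 2 + x 1 ^ 2) + fingerAngle M x / M + 5)
        / (x 0 ^ 2 + x 1 ^ 2)) • ![-x 1, x 0, 0]) x := by
  have hne : twist (-M) x 1 ≠ 0 := by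
    intro h
    rw [h] at hx
    norm_num at hx
  have h := ((hasSGrad_fingerLength hM hne).comp (hasDerivAt_step _)).const_mul M
  have hc : Continuous fun x => 20 * M ^ 2 * twist (-M) x 1 ^ 2 :=
    continuous_const.mul ((contDiff_twist_coord (-M) 1).continuous.pow 2)
  refine (h.congr_of_eventuallyEq ?_).congr ?_
  · filter_upwards [continuousAt_const.eventually_lt hc.continuousAt hx] with y hy
    rw [spiralHeight, Real.smoothTransition.one_of_one_le (by linarith), one_mul]
  · rw [smul_smul, smul_smul]
    congr 1
    field_simp

lemma hasSGrad_spiralHeight_of_lt {M : ℝ} (hM : 0 ≤ M) {x : Space3}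
    (hx : x 0 ^ 2 + x 1 ^ 2 < 3 / 10) : HasSGrad (spiralHeight M) 0 x := by
  have h0 := contDiff_space_coord 0
  have h1 := contDiff_space_coord 1
  have hc : Continuous fun x : Space3 => x 0 ^ 2 + x 1 ^ 2 :=
    (h0.continuous.pow 2).add (h1.continuous.pow 2)
  refine (hasSGrad_const 0 x).congr_of_eventuallyEq ?_
  filter_upwards [hc.continuousAt.eventually_lt continuousAt_const hx] with y hy
  exact spiralHeight_eq_zero_of_le hM hy.le

/-- Near the plane of the fingers, and away from the centre, the spiral domain stays at distance at
least a multiple of `1 / M` from the cut of `fingerAngle`. -/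
lemma two_lt_of_mem_closure {M : ℝ} {x : Space3} (hx : x ∈ closure (spiralDomain M))
    (hq : 3 / 10 ≤ x 0 ^ 2 + x 1 ^ 2) (hz : (8 * M * x 2) ^ 2 ≤ 1) :
    2 < 20 * M ^ 2 * twist (-M) x 1 ^ 2 := by
  obtain ⟨p, hp, rfl⟩ := closure_spiralDomain_subset M hx
  rw [mem_closedBall_zero_iff] at hp
  rw [spiralMap, twist_sq_add_sq] at hq
  rw [spiralMap, twist_two] at hz
  rw [spiralMap, twist_neg_twist]
  have hn := norm_sq_coord p
  have hn1 : ‖p‖ ^ 2 ≤ 1 := pow_le_one₀ (norm_nonneg _) hp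
  have hl := pinchFactor_ge M p
  have hc : ∀ i, pinch M p i = pinchFactor M p * p i := fun i => rfl
  rw [hc, hc] at hq
  rw [hc] at hz ⊢
  have h1 : 3 / 10 ≤ pinchFactor M p ^ 2 := by
    have : pinchFactor M p ^ 2 * (p 0 ^ 2 + p 1 ^ 2) ≤ pinchFactor M p ^ 2 * 1 := by
      gcongr
      nlinarith [sq_nonneg (p 2)]
    nlinarith
  have h2 : 1 < 2 * M ^ 2 * (p 1 ^ 2 + p 2 ^ 2) := by
    by_contra hle
    rw [not_lt] at hle
    have : pinchFactor M p = 1 / 2 := by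
      rw [pinchFactor, Real.smoothTransition.zero_of_nonpos (by linarith)]; norm_num
    rw [this] at h1
    norm_num at h1
  have h3 : 1 / 4 * 1 ≤ pinchFactor M p ^ 2 * (2 * M ^ 2 * (p 1 ^ 2 + p 2 ^ 2)) := by
    gcongr
    nlinarith
  nlinarith

/-- The quotient of `P'(σ(q))` by `q`, where `σ` is the twist profile and `P` a smooth step. -/
noncomputable def angularRate (q : ℝ) : ℝ := stepDeriv (twistProfile q + 5) / q

lemma stepDeriv_twistProfile_of_le {q : ℝ} (h : q ≤ 3 / 10) : stepDeriv (twistProfile q + 5) = 0 :=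
  by rw [twistProfile_of_le h]; exact stepDeriv_of_nonpos (by norm_num)

lemma mul_angularRate (q : ℝ) : q * angularRate q = stepDeriv (twistProfile q + 5) := by
  by_cases hq : q = 0
  · rw [stepDeriv_twistProfile_of_le (by rw [hq]; norm_num), hq, zero_mul]
  · rw [angularRate, mul_div_cancel₀ _ hq]

lemma contDiff_angularRate : ContDiff ℝ ∞ angularRate := by
  rw [contDiff_iff_contDiffAt]
  intro q
  by_cases hq : q < 3 / 10
  · refine (contDiffAt_const (c := (0 : ℝ))).congr_of_eventuallyEq ?_
    filter_upwards [isOpen_Iio.mem_nhds hq] with y hy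
    rw [angularRate, stepDeriv_twistProfile_of_le (le_of_lt hy), zero_div]
  · exact (contDiff_stepDeriv.comp (contDiff_twistProfile.add contDiff_const)).contDiffAt.div
      contDiffAt_id (by rintro rfl; norm_num at hq)

lemma hasDerivAt_angularRate (q : ℝ) : HasDerivAt angularRate (deriv angularRate q) q :=
  (contDiff_angularRate.differentiable (by norm_num)).differentiableAt.hasDerivAt

lemma angularRate_add_mul_deriv (q : ℝ) : angularRate q + q * deriv angularRate q
    = deriv stepDeriv (twistProfile q + 5) * (25 / 2 * stepDeriv (5 / 2 * q - 3 / 4)) := by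
  have h1 := (hasDerivAt_id q).mul (hasDerivAt_angularRate q)
  have h2 := (hasDerivAt_stepDeriv (twistProfile q + 5)).comp q
    ((hasDerivAt_twistProfile q).add_const 5)
  have h3 : (id * angularRate) = stepDeriv ∘ (fun q => twistProfile q + 5) :=
    funext mul_angularRate
  rw [h3] at h1
  simpa using h1.unique h2

/-- A cutoff which is `1` for `1 / (8 * M) ≤ t ≤ 1 / 20`, and `0` for `t ≤ 0` and `1 / 10 ≤ t`. -/
noncomputable def heightCutoff (M t : ℝ) : ℝ :=
  Real.smoothTransition (8 * M * t) - Real.smoothTransition (20 * t - 1)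

/-- The components of a one-form. For `1 / (8 * M) ≤ z ≤ 1 / 20` it is the angular form `dθ` times
a function of `x ^ 2 + y ^ 2`, and it vanishes for `z ≤ 0` and `1 / 10 ≤ z`. The vertical component
compensates, on the spiral domain, for the rapid change of the angular components in the slab
`0 ≤ z ≤ 1 / (8 * M)`. -/
noncomputable def spiralForm (M : ℝ) : Fin 3 → Space3 → ℝ :=
  ![fun x => heightCutoff M (x 2) * angularRate (x 0 ^ 2 + x 1 ^ 2) * (-1 * x 1),
    fun x => heightCutoff M (x 2) * angularRate (x 0 ^ 2 + x 1 ^ 2) * x 0,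
    fun x => 8 * M * stepDeriv (8 * M * x 2) * spiralHeight M x]

lemma contDiff_heightCutoff (M : ℝ) : ContDiff ℝ ∞ (heightCutoff M) :=
  (contDiff_step.comp (contDiff_const.mul contDiff_id)).sub
    (contDiff_step.comp ((contDiff_const.mul contDiff_id).sub contDiff_const))

lemma hasDerivAt_comp_affine {f f' : ℝ → ℝ} (h : ∀ x, HasDerivAt f (f' x) x) (a b t : ℝ) :
    HasDerivAt (fun t => f (a * t + b)) (a * f' (a * t + b)) t := by
  have h1 : HasDerivAt (fun t : ℝ => a * t + b) a t := by
    simpa using ((hasDerivAt_id t).const_mul a).add_const b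
  have := (h (a * t + b)).comp t h1
  rwa [mul_comm] at this

lemma hasDerivAt_heightCutoff (M t : ℝ) : HasDerivAt (heightCutoff M)
    (8 * M * stepDeriv (8 * M * t) - 20 * stepDeriv (20 * t - 1)) t := by
  have h1 := hasDerivAt_comp_affine hasDerivAt_step (8 * M) 0 t
  have h2 := hasDerivAt_comp_affine hasDerivAt_step 20 (-1) t
  simp only [add_zero, ← sub_eq_add_neg] at h1 h2
  exact h1.sub h2

lemma contDiff_spiralForm (M : ℝ) (i : Fin 3) : ContDiff ℝ ∞ (spiralForm M i) := by
  have h0 := contDiff_space_coord 0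
  have h1 := contDiff_space_coord 1
  have h2 := contDiff_space_coord 2
  have ha : ContDiff ℝ ∞ fun x : Space3 => angularRate (x 0 ^ 2 + x 1 ^ 2) :=
    contDiff_angularRate.comp ((h0.pow 2).add (h1.pow 2))
  have hh : ContDiff ℝ ∞ fun x : Space3 => heightCutoff M (x 2) := (contDiff_heightCutoff M).comp h2
  fin_cases i
  · exact (hh.mul ha).mul (contDiff_const.mul h1)
  · exact (hh.mul ha).mul h0
  · exact (contDiff_const.mul (contDiff_stepDeriv.comp (contDiff_const.mul h2))).mul
      (contDiff_spiralHeight M)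

lemma sgrad_spiralForm_sub {M : ℝ} {x : Space3} {g : Fin 3 → ℝ} (hg : HasSGrad (spiralHeight M) g x) :
    sgrad (spiralForm M 1) x 0 - sgrad (spiralForm M 0) x 1 = 2 * heightCutoff M (x 2) *
      (angularRate (x 0 ^ 2 + x 1 ^ 2)
        + (x 0 ^ 2 + x 1 ^ 2) * deriv angularRate (x 0 ^ 2 + x 1 ^ 2)) ∧
    sgrad (spiralForm M 2) x 0 - sgrad (spiralForm M 0) x 2
      = 8 * M * stepDeriv (8 * M * x 2) * g 0 + (8 * M * stepDeriv (8 * M * x 2)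
        - 20 * stepDeriv (20 * x 2 - 1)) * angularRate (x 0 ^ 2 + x 1 ^ 2) * x 1 ∧
    sgrad (spiralForm M 2) x 1 - sgrad (spiralForm M 1) x 2
      = 8 * M * stepDeriv (8 * M * x 2) * g 1 - (8 * M * stepDeriv (8 * M * x 2)
        - 20 * stepDeriv (20 * x 2 - 1)) * angularRate (x 0 ^ 2 + x 1 ^ 2) * x 0 := by
  have hh := (hasSGrad_coord 2 x).comp (hasDerivAt_heightCutoff M (x 2))
  have ha := (hasSGrad_sq_add_sq 0 1 x).comp (hasDerivAt_angularRate _)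
  have h0 := ((hh.mul ha).mul ((hasSGrad_coord 1 x).const_mul (-1))).2
  have h1 := ((hh.mul ha).mul (hasSGrad_coord 0 x)).2
  have hs := hasDerivAt_comp_affine hasDerivAt_stepDeriv (8 * M) 0 (x 2)
  simp only [add_zero] at hs
  have h2 := ((((hasSGrad_coord 2 x).comp hs).const_mul (8 * M)).mul hg).2
  change sgrad (spiralForm M 0) x = _ at h0
  change sgrad (spiralForm M 1) x = _ at h1
  change sgrad (spiralForm M 2) x = _ at h2
  rw [h0, h1, h2]
  refine ⟨?_, ?_, ?_⟩ <;> simp <;> ring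

lemma abs_heightCutoff_le (M t : ℝ) : |heightCutoff M t| ≤ 1 := by
  have h1 := Real.smoothTransition.nonneg (8 * M * t)
  have h2 := Real.smoothTransition.le_one (8 * M * t)
  have h3 := Real.smoothTransition.nonneg (20 * t - 1)
  have h4 := Real.smoothTransition.le_one (20 * t - 1)
  rw [heightCutoff, abs_le]
  constructor <;> linarith

lemma norm_le_one_of_mem_closure {M : ℝ} {x : Space3} (hx : x ∈ closure (spiralDomain M)) :
    ‖x‖ ≤ 1 := by
  obtain ⟨p, hp, rfl⟩ := closure_spiralDomain_subset M hx
  rw [mem_closedBall_zero_iff] at hp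
  rw [spiralMap, norm_twist, pinch, norm_smul,
    Real.norm_of_nonneg (by linarith [pinchFactor_ge M p])]
  exact mul_le_one₀ (pinchFactor_le M p) (norm_nonneg _) hp

/-- On the closure of the spiral domain, where the vertical component of `spiralForm` is supported,
the gradient of the height is a bounded multiple of the differential of the angle. -/
lemma exists_hasSGrad_spiralHeight {M : ℝ} (hM : 0 < M) {x : Space3}
    (hx : x ∈ closure (spiralDomain M)) : ∃ g, HasSGrad (spiralHeight M) g x ∧ ∀ i,
      8 * M * stepDeriv (8 * M * x 2) * g i = 8 * M * stepDeriv (8 * M * x 2)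
        * (stepDeriv (twistProfile (x 0 ^ 2 + x 1 ^ 2) + fingerAngle M x / M + 5)
          / (x 0 ^ 2 + x 1 ^ 2) * ![-x 1, x 0, 0] i) := by
  rcases lt_or_ge (x 0 ^ 2 + x 1 ^ 2) (3 / 10) with hq | hq
  · refine ⟨0, hasSGrad_spiralHeight_of_lt hM.le hq, fun i => ?_⟩
    have h1 : fingerAngle M x / M ≤ 0 :=
      div_nonpos_of_nonpos_of_nonneg (fingerAngle_nonpos M x) hM.le
    rw [twistProfile_of_le hq.le, stepDeriv_of_nonpos (x := _ + _ + _) (by linarith)]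
    simp
  · by_cases hz : stepDeriv (8 * M * x 2) = 0
    · exact ⟨sgrad (spiralHeight M) x, ⟨((contDiff_spiralHeight M).differentiable
        (by norm_num)).differentiableAt, rfl⟩, fun i => by simp [hz]⟩
    · have h0 : 0 ≤ 8 * M * x 2 := by
        by_contra h; exact hz (stepDeriv_of_nonpos (not_le.1 h).le)
      have h1 : 8 * M * x 2 ≤ 1 := by
        by_contra h; exact hz (stepDeriv_of_one_le (not_le.1 h).le)
      exact ⟨_, hasSGrad_spiralHeight hM.ne'
        (two_lt_of_mem_closure hx hq (pow_le_one₀ h0 h1)), fun i => rfl⟩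

/-- On the spiral domain the exterior derivative of the one-form is bounded uniformly in `M`. -/
lemma curlNorm_spiralForm_le {L : ℝ} (hL' : ∀ x, |stepDeriv x| ≤ L)
    (hL'' : ∀ x, |deriv stepDeriv x| ≤ L) {M : ℝ} (hM : 0 < M) {x : Space3}
    (hx : x ∈ closure (spiralDomain M)) :
    curlNorm (spiralForm M) x ≤ 25 * L ^ 2 + 2 * (4 * (32 * L ^ 2 + 20 * L * L)) := by
  have hL0 : 0 ≤ L := (abs_nonneg _).trans (hL' 0)
  obtain ⟨g, hg, hgi⟩ := exists_hasSGrad_spiralHeight hM hx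
  obtain ⟨e1, e2, e3⟩ := sgrad_spiralForm_sub hg
  have g0 := hgi 0
  have g1 := hgi 1
  simp only [Matrix.cons_val_zero, Matrix.cons_val_one] at g0 g1
  rw [curlNorm, e1, e2, e3, g0, g1, angularRate_add_mul_deriv, angularRate]
  have hn := norm_sq_coord x
  have hn1 : ‖x‖ ^ 2 ≤ 1 := pow_le_one₀ (norm_nonneg _) (norm_le_one_of_mem_closure hx)
  have hx0 : |x 0| ≤ 1 := by
    rw [← sq_le_one_iff_abs_le_one]; nlinarith [sq_nonneg (x 1), sq_nonneg (x 2)]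
  have hx1 : |x 1| ≤ 1 := by
    rw [← sq_le_one_iff_abs_le_one]; nlinarith [sq_nonneg (x 0), sq_nonneg (x 2)]
  have hang : |fingerAngle M x| ≤ 4 := by
    rw [abs_le]
    constructor <;> linarith [fingerAngle_nonpos M x, neg_pi_le_fingerAngle M x, Real.pi_le_four]
  have hdiff : |stepDeriv (twistProfile (x 0 ^ 2 + x 1 ^ 2) + 5)
      - stepDeriv (twistProfile (x 0 ^ 2 + x 1 ^ 2) + fingerAngle M x / M + 5)| ≤ L * (4 / M) := by
    refine (abs_sub_le_of_deriv_le hasDerivAt_stepDeriv hL'' _ _).trans ?_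
    gcongr
    rw [add_sub_add_right_eq_sub, sub_add_cancel_left, abs_neg, abs_div, abs_of_pos hM]
    gcongr
  have hcut := abs_heightCutoff_le M (x 2)
  -- both angular rates vanish near the axis
  have hq : x 0 ^ 2 + x 1 ^ 2 ≤ 3 / 10 →
      stepDeriv (twistProfile (x 0 ^ 2 + x 1 ^ 2) + 5) = 0 ∧
      stepDeriv (twistProfile (x 0 ^ 2 + x 1 ^ 2) + fingerAngle M x / M + 5) = 0 := by
    intro h
    refine ⟨stepDeriv_twistProfile_of_le h, stepDeriv_of_nonpos ?_⟩
    have h1 : fingerAngle M x / M ≤ 0 :=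
      div_nonpos_of_nonpos_of_nonneg (fingerAngle_nonpos M x) hM.le
    rw [twistProfile_of_le h]
    linarith
  have hp := hL' (twistProfile (x 0 ^ 2 + x 1 ^ 2) + 5)
  generalize stepDeriv (twistProfile (x 0 ^ 2 + x 1 ^ 2) + 5) = p at *
  generalize stepDeriv (twistProfile (x 0 ^ 2 + x 1 ^ 2) + fingerAngle M x / M + 5) = r at *
  have hc := hL' (8 * M * x 2)
  have hd := hL' (20 * x 2 - 1)
  have ha := hL' (5 / 2 * (x 0 ^ 2 + x 1 ^ 2) - 3 / 4)
  have hb := hL'' (twistProfile (x 0 ^ 2 + x 1 ^ 2) + 5)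
  generalize stepDeriv (8 * M * x 2) = c at *
  generalize stepDeriv (20 * x 2 - 1) = d at *
  generalize stepDeriv (5 / 2 * (x 0 ^ 2 + x 1 ^ 2) - 3 / 4) = a at *
  generalize deriv stepDeriv (twistProfile (x 0 ^ 2 + x 1 ^ 2) + 5) = b at *
  generalize heightCutoff M (x 2) = h at *
  have hbr : |8 * M * c * (p - r) - 20 * d * p| ≤ 32 * L ^ 2 + 20 * L * L := by
    refine (abs_sub _ _).trans ?_
    rw [abs_mul, abs_mul, abs_mul, abs_mul, abs_mul, abs_of_pos (show (0 : ℝ) < 8 by norm_num),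
      abs_of_pos hM, abs_of_pos (show (0 : ℝ) < 20 by norm_num)]
    have : 8 * M * |c| * |p - r| ≤ 8 * M * L * (L * (4 / M)) := by gcongr
    have e : 8 * M * L * (L * (4 / M)) = 32 * L ^ 2 := by field_simp; ring
    have : 20 * |d| * |p| ≤ 20 * L * L := by gcongr
    linarith
  have hterm : ∀ y : ℝ, |y| ≤ 1 →
      |(8 * M * c * (p - r) - 20 * d * p) / (x 0 ^ 2 + x 1 ^ 2) * y|
        ≤ 4 * (32 * L ^ 2 + 20 * L * L) := by
    intro y hy
    rcases le_or_gt (x 0 ^ 2 + x 1 ^ 2) (3 / 10) with h' | h'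
    · obtain ⟨hp0, hr0⟩ := hq h'
      rw [hp0, hr0]
      simp only [sub_self, mul_zero, zero_div, zero_mul, abs_zero]
      positivity
    · rw [abs_mul, abs_div, abs_of_pos (show 0 < x 0 ^ 2 + x 1 ^ 2 by linarith)]
      have h4 : |8 * M * c * (p - r) - 20 * d * p| / (x 0 ^ 2 + x 1 ^ 2)
          ≤ 4 * (32 * L ^ 2 + 20 * L * L) := by
        rw [div_le_iff₀ (by linarith)]
        have : 0 ≤ 32 * L ^ 2 + 20 * L * L := by positivity
        nlinarith
      exact (mul_le_of_le_one_right (by positivity) hy).trans h4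
  have t1 : |2 * h * (b * (25 / 2 * a))| ≤ 25 * L ^ 2 := by
    rw [abs_mul, abs_mul, abs_mul, abs_mul, abs_two, abs_of_pos (show (0 : ℝ) < 25 / 2 by norm_num)]
    calc 2 * |h| * (|b| * (25 / 2 * |a|)) ≤ 2 * 1 * (L * (25 / 2 * L)) := by gcongr
      _ = _ := by ring
  have t2 := hterm (x 1) hx1
  have t3 := hterm (x 0) hx0
  rw [← abs_neg] at t3
  have s2 : 8 * M * c * (r / (x 0 ^ 2 + x 1 ^ 2) * -x 1)
      + (8 * M * c - 20 * d) * (p / (x 0 ^ 2 + x 1 ^ 2)) * x 1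
      = (8 * M * c * (p - r) - 20 * d * p) / (x 0 ^ 2 + x 1 ^ 2) * x 1 := by ring
  have s3 : 8 * M * c * (r / (x 0 ^ 2 + x 1 ^ 2) * x 0)
      - (8 * M * c - 20 * d) * (p / (x 0 ^ 2 + x 1 ^ 2)) * x 0
      = -((8 * M * c * (p - r) - 20 * d * p) / (x 0 ^ 2 + x 1 ^ 2) * x 0) := by ring
  rw [s2, s3]
  linarith

/-! ### The flux tube -/

/-- A step function of the first coordinate, increasing on `[-1 / 20, 1 / 20]`. -/
noncomputable def tubeStep (x : Space3) : ℝ := Real.smoothTransition (10 * x 0 + 1 / 2)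

/-- The profile of the plateau in the second coordinate: `1` on `[2 / 5, 17 / 20]`, supported in
`[1 / 10, 19 / 20]`. -/
noncomputable def plateauY (t : ℝ) : ℝ :=
  Real.smoothTransition (10 / 3 * t - 1 / 3) - Real.smoothTransition (10 * t - 17 / 2)

/-- The profile of the plateau in the third coordinate: `1` on `[-1 / 10, 1 / 10]`, supported in
`[-1 / 4, 1 / 4]`. -/
noncomputable def plateauZ (t : ℝ) : ℝ := Real.smoothTransition (-(400 / 21) * t ^ 2 + 25 / 21)

/-- A plateau function of the second and third coordinates. -/
noncomputable def plateau (x : Space3) : ℝ := plateauY (x 1) * plateauZ (x 2)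

/-- A ring in the plane `x = 0`, slightly thickened, on which the form `d tubeStep ∧ d plateau` is
supported. It surrounds the segment `2 / 5 ≤ y ≤ 17 / 20`, `z = 0`, which crosses all the turns of
the fingers. -/
def tube : Set Space3 := {x | |x 0| ≤ 1 / 20 ∧ x 1 ∈ Icc (1 / 10) (19 / 20) ∧ |x 2| ≤ 1 / 4 ∧
  (x 1 ≤ 2 / 5 ∨ 17 / 20 ≤ x 1 ∨ 1 / 10 ≤ |x 2|)}

lemma isCompact_tube : IsCompact tube := by
  refine (isCompact_closedBall (0 : Space3) 1).of_isClosed_subset ?_ ?_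
  · have h0 := (contDiff_space_coord 0).continuous
    have h1 := (contDiff_space_coord 1).continuous
    have h2 := (contDiff_space_coord 2).continuous
    refine (isClosed_le h0.abs continuous_const).inter ((isClosed_Icc.preimage h1).inter
      ((isClosed_le h2.abs continuous_const).inter ?_))
    exact (isClosed_le h1 continuous_const).union ((isClosed_le continuous_const h1).union
      (isClosed_le continuous_const h2.abs))
  · rintro x ⟨h0, h1, h2, -⟩
    rw [mem_closedBall_zero_iff, ← sq_le_one_iff₀ (norm_nonneg _), norm_sq_coord]
    rw [abs_le] at h0 h2
    nlinarith [h1.1, h1.2, h0.1, h0.2, h2.1, h2.2]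

lemma tube_subset_spiralDomain {M : ℝ} (hM : 20 ≤ M) : tube ⊆ spiralDomain M := by
  rintro x ⟨h0, h1, h2, h3⟩
  apply mem_spiralDomain_of_untwist
  have hM2 : 400 ≤ M ^ 2 := by nlinarith
  have q0 : x 0 ^ 2 ≤ 1 / 400 := by
    rw [← sq_abs]; nlinarith [abs_nonneg (x 0)]
  have q2 : x 2 ^ 2 ≤ 1 / 16 := by
    rw [← sq_abs]; nlinarith [abs_nonneg (x 2)]
  have q1 : x 1 ^ 2 ≤ 361 / 400 := by nlinarith [h1.1, h1.2]
  have hn := norm_sq_coord x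
  have hlt : ‖twist (-M) x‖ < 1 := by
    rw [norm_twist, ← sq_lt_one_iff₀ (norm_nonneg _), hn]
    linarith
  rcases h3 with h | h | h
  · apply mem_pinch_image_of_norm_lt
    have : x 1 ^ 2 ≤ 4 / 25 := by nlinarith [h1.1]
    rw [norm_twist, ← sq_lt_sq₀ (norm_nonneg _) (by norm_num), hn]
    linarith
  · apply mem_pinch_image_of_far hlt
    have hx : 289 / 400 ≤ x 1 ^ 2 := by nlinarith
    rw [twist_one, twistProfile_of_ge (by nlinarith [sq_nonneg (x 0)])]
    simp only [mul_zero, Real.sin_zero, Real.cos_zero, zero_add, mul_one]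
    nlinarith [sq_nonneg (twist (-M) x 2)]
  · apply mem_pinch_image_of_far hlt
    have hx : 1 / 100 ≤ x 2 ^ 2 := by rw [← sq_abs]; nlinarith
    rw [twist_two]
    nlinarith [sq_nonneg (twist (-M) x 1)]

lemma contDiff_tubeStep : ContDiff ℝ ∞ tubeStep :=
  contDiff_step.comp ((contDiff_const.mul (contDiff_space_coord 0)).add contDiff_const)

lemma contDiff_plateau : ContDiff ℝ ∞ plateau := by
  have h1 := contDiff_space_coord 1
  have h2 := contDiff_space_coord 2
  exact ((contDiff_step.comp ((contDiff_const.mul h1).sub contDiff_const)).sub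
    (contDiff_step.comp ((contDiff_const.mul h1).sub contDiff_const))).mul
    (contDiff_step.comp ((contDiff_const.mul (h2.pow 2)).add contDiff_const))

/-- The derivative of `plateauY`. -/
noncomputable def plateauYDeriv (t : ℝ) : ℝ :=
  10 / 3 * stepDeriv (10 / 3 * t - 1 / 3) - 10 * stepDeriv (10 * t - 17 / 2)

/-- The derivative of `plateauZ`. -/
noncomputable def plateauZDeriv (t : ℝ) : ℝ :=
  stepDeriv (-(400 / 21) * t ^ 2 + 25 / 21) * (-(400 / 21) * (2 * t))

lemma hasDerivAt_plateauY (t : ℝ) : HasDerivAt plateauY (plateauYDeriv t) t := by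
  have h1 := hasDerivAt_comp_affine hasDerivAt_step (10 / 3) (-(1 / 3)) t
  have h2 := hasDerivAt_comp_affine hasDerivAt_step 10 (-(17 / 2)) t
  simp only [← sub_eq_add_neg] at h1 h2
  exact h1.sub h2

lemma hasDerivAt_plateauZ (t : ℝ) : HasDerivAt plateauZ (plateauZDeriv t) t := by
  have h1 : HasDerivAt (fun t : ℝ => -(400 / 21) * t ^ 2 + 25 / 21) (-(400 / 21) * (2 * t)) t := by
    simpa using ((hasDerivAt_pow 2 t).const_mul (-(400 / 21))).add_const (25 / 21)
  exact (hasDerivAt_step _).comp t h1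

lemma sgrad_tubeStep (x : Space3) : sgrad tubeStep x = ![10 * stepDeriv (10 * x 0 + 1 / 2), 0, 0] := by
  have h := ((hasSGrad_coord 0 x).comp (hasDerivAt_comp_affine hasDerivAt_step 10 (1 / 2) (x 0))).2
  change sgrad tubeStep x = _ at h
  rw [h]
  ext i
  fin_cases i <;> simp

lemma sgrad_plateau (x : Space3) : sgrad plateau x =
    ![0, plateauYDeriv (x 1) * plateauZ (x 2), plateauY (x 1) * plateauZDeriv (x 2)] := by
  have h := (((hasSGrad_coord 1 x).comp (hasDerivAt_plateauY (x 1))).mul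
    ((hasSGrad_coord 2 x).comp (hasDerivAt_plateauZ (x 2)))).2
  change sgrad plateau x = _ at h
  rw [h]
  ext i
  fin_cases i <;> simp [mul_comm]

lemma plateauYDeriv_eq_zero {t : ℝ} (h : t ≤ 1 / 10 ∨ t ∈ Icc (2 / 5) (17 / 20) ∨ 19 / 20 ≤ t) :
    plateauYDeriv t = 0 := by
  rw [plateauYDeriv]
  rcases h with h | h | h
  · rw [stepDeriv_of_nonpos (by linarith), stepDeriv_of_nonpos (by linarith)]; norm_num
  · rw [stepDeriv_of_one_le (by linarith [h.1]), stepDeriv_of_nonpos (by linarith [h.2])]; norm_num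
  · rw [stepDeriv_of_one_le (by linarith), stepDeriv_of_one_le (by linarith)]; norm_num

lemma plateauY_eq_zero {t : ℝ} (h : t ≤ 1 / 10 ∨ 19 / 20 ≤ t) : plateauY t = 0 := by
  rw [plateauY]
  rcases h with h | h
  · rw [Real.smoothTransition.zero_of_nonpos (by linarith),
      Real.smoothTransition.zero_of_nonpos (by linarith), sub_zero]
  · rw [Real.smoothTransition.one_of_one_le (by linarith),
      Real.smoothTransition.one_of_one_le (by linarith), sub_self]

lemma plateauZDeriv_eq_zero {t : ℝ} (h : |t| ≤ 1 / 10 ∨ 1 / 4 ≤ |t|) : plateauZDeriv t = 0 := by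
  rw [plateauZDeriv, ← sq_abs]
  rcases h with h | h
  · rw [stepDeriv_of_one_le (by nlinarith [abs_nonneg t]), zero_mul]
  · rw [stepDeriv_of_nonpos (by nlinarith), zero_mul]

lemma plateauZ_eq_zero {t : ℝ} (h : 1 / 4 ≤ |t|) : plateauZ t = 0 := by
  rw [plateauZ, ← sq_abs, Real.smoothTransition.zero_of_nonpos (by nlinarith)]

lemma plateauZ_eq_one {t : ℝ} (h : |t| ≤ 1 / 10) : plateauZ t = 1 := by
  rw [plateauZ, ← sq_abs, Real.smoothTransition.one_of_one_le (by nlinarith [abs_nonneg t])]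

lemma sgrad_eq_zero_of_notMem_tube {x : Space3} (hx : x ∉ tube) :
    sgrad tubeStep x = 0 ∨ sgrad plateau x = 0 := by
  by_cases h0 : |x 0| ≤ 1 / 20
  · right
    rw [sgrad_plateau]
    rcases le_or_gt (1 / 4) |x 2| with h2 | h2
    · rw [plateauZ_eq_zero h2, plateauZDeriv_eq_zero (Or.inr h2)]
      ext i; fin_cases i <;> simp
    · by_cases h1 : x 1 ∈ Icc (1 / 10) (19 / 20)
      · have h3 : ¬ (x 1 ≤ 2 / 5 ∨ 17 / 20 ≤ x 1 ∨ 1 / 10 ≤ |x 2|) := fun h => hx ⟨h0, h1, h2.le, h⟩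
        simp only [not_or, not_le] at h3
        rw [plateauYDeriv_eq_zero (Or.inr (Or.inl ⟨h3.1.le, h3.2.1.le⟩)),
          plateauZDeriv_eq_zero (Or.inl h3.2.2.le)]
        ext i; fin_cases i <;> simp
      · rw [mem_Icc, not_and_or, not_le, not_le] at h1
        rw [plateauYDeriv_eq_zero (h1.elim (fun h => Or.inl h.le) fun h => Or.inr (Or.inr h.le)),
          plateauY_eq_zero (h1.imp le_of_lt le_of_lt)]
        ext i; fin_cases i <;> simp
  · left
    have : stepDeriv (10 * x 0 + 1 / 2) = 0 := by
      rw [not_le, lt_abs] at h0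
      rcases h0 with h | h
      · exact stepDeriv_of_one_le (by linarith)
      · exact stepDeriv_of_nonpos (by linarith)
    rw [sgrad_tubeStep, this]
    ext i; fin_cases i <;> simp

lemma wedge2_eq_zero_of_notMem_tube {x : Space3} (hx : x ∉ tube) (u v : Space3) :
    wedge2 (sgrad tubeStep x) (sgrad plateau x) u v = 0 := by
  rcases sgrad_eq_zero_of_notMem_tube hx with h | h <;> simp [wedge2, pairing, h]

lemma exists_wedgeNorm_le : ∃ C₂ : ℝ, 0 ≤ C₂ ∧
    ∀ x, wedgeNorm (sgrad tubeStep x) (sgrad plateau x) ≤ C₂ := by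
  have hb : ∀ i, Continuous fun x => sgrad tubeStep x i := fun i =>
    (contDiff_tubeStep.sgrad i).continuous
  have hc : ∀ i, Continuous fun x => sgrad plateau x i := fun i =>
    (contDiff_plateau.sgrad i).continuous
  have hcont : Continuous fun x => wedgeNorm (sgrad tubeStep x) (sgrad plateau x) := by
    unfold wedgeNorm
    fun_prop
  obtain ⟨C, hC⟩ := isCompact_tube.exists_bound_of_continuousOn hcont.continuousOn
  refine ⟨max C 0, le_max_right _ _, fun x => ?_⟩
  by_cases hx : x ∈ tube
  · exact (le_abs_self _).trans ((hC x hx).trans (le_max_left _ _))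
  · refine le_trans (le_of_eq ?_) (le_max_right _ _)
    rcases sgrad_eq_zero_of_notMem_tube hx with h | h <;> simp [wedgeNorm, h]

/-! ### The linking integral -/

/-- A primitive in the second coordinate of the density of the product of the two forms. -/
noncomputable def linkingPrimitive (M : ℝ) (x : Space3) : ℝ :=
  -M * (10 * stepDeriv (10 * x 0 + 1 / 2)) * (8 * M * stepDeriv (8 * M * x 2))
    * Real.smoothTransition (10 * x 1 - 17 / 2)

lemma contDiff_linkingPrimitive (M : ℝ) : ContDiff ℝ ∞ (linkingPrimitive M) := by
  have h0 := contDiff_space_coord 0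
  have h1 := contDiff_space_coord 1
  have h2 := contDiff_space_coord 2
  exact ((contDiff_const.mul (contDiff_const.mul (contDiff_stepDeriv.comp
    ((contDiff_const.mul h0).add contDiff_const)))).mul (contDiff_const.mul
    (contDiff_stepDeriv.comp (contDiff_const.mul h2)))).mul
    (contDiff_step.comp ((contDiff_const.mul h1).sub contDiff_const))

lemma sgrad_linkingPrimitive (M : ℝ) (x : Space3) : sgrad (linkingPrimitive M) x 1 =
    -M * (10 * stepDeriv (10 * x 0 + 1 / 2)) * (8 * M * stepDeriv (8 * M * x 2))
      * (10 * stepDeriv (10 * x 1 - 17 / 2)) := by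
  have hs0 := hasDerivAt_comp_affine hasDerivAt_stepDeriv 10 (1 / 2) (x 0)
  have hs1 := hasDerivAt_comp_affine hasDerivAt_step 10 (-(17 / 2)) (x 1)
  have hs2 := hasDerivAt_comp_affine hasDerivAt_stepDeriv (8 * M) 0 (x 2)
  simp only [add_zero] at hs2
  simp only [← sub_eq_add_neg] at hs1
  have h := ((((((hasSGrad_coord 0 x).comp hs0).const_mul 10).const_mul (-M)).mul
    (((hasSGrad_coord 2 x).comp hs2).const_mul (8 * M))).mul ((hasSGrad_coord 1 x).comp hs1)).2
  change sgrad (linkingPrimitive M) x = _ at h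
  rw [h]
  simp

lemma spiralHeight_eq {M : ℝ} (hM : 20 ≤ M) {x : Space3} (hx : 17 / 20 ≤ x 1) :
    spiralHeight M x = M := by
  have hx2 : 289 / 400 ≤ x 1 ^ 2 := by nlinarith
  have hM2 : 400 ≤ M ^ 2 := by nlinarith
  have hσ := twistProfile_of_ge (q := x 0 ^ 2 + x 1 ^ 2) (by nlinarith [sq_nonneg (x 0)])
  have hy : twist (-M) x 1 = x 1 := by
    rw [twist_one, hσ]
    simp
  have hang : -1 ≤ fingerAngle M x / M := by
    rw [le_div_iff₀ (by linarith)]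
    linarith [neg_pi_le_fingerAngle M x, Real.pi_le_four]
  rw [spiralHeight, hy, hσ, Real.smoothTransition.one_of_one_le (by nlinarith), one_mul,
    Real.smoothTransition.one_of_one_le (by linarith), mul_one]

/-- The coefficient of `α ∧ db ∧ dc`. Only the part of the ring outside the turns of the fingers, where
the height is `M`, contributes. -/
lemma det3_spiralForm {M : ℝ} (hM : 20 ≤ M) (x : Space3) :
    det3 (fun i => spiralForm M i x) (sgrad tubeStep x) (sgrad plateau x)
      = sgrad (linkingPrimitive M) x 1 := by
  have hM0 : 0 < M := by linarith
  rw [sgrad_linkingPrimitive, sgrad_tubeStep, sgrad_plateau, det3]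
  simp only [Matrix.cons_val_zero, Matrix.cons_val_one, Matrix.cons_val]
  -- the angular component vanishes where the plateau varies in the third coordinate
  have h1 : spiralForm M 1 x * plateauZDeriv (x 2) = 0 := by
    rcases le_or_gt |x 2| (1 / 10) with h | h
    · rw [plateauZDeriv_eq_zero (Or.inl h), mul_zero]
    · have : heightCutoff M (x 2) = 0 := by
        rw [heightCutoff]
        rcases lt_abs.1 h with h | h
        · rw [Real.smoothTransition.one_of_one_le (by nlinarith),
            Real.smoothTransition.one_of_one_le (by linarith), sub_self]
        · rw [Real.smoothTransition.zero_of_nonpos (by nlinarith),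
            Real.smoothTransition.zero_of_nonpos (by linarith), sub_self]
      change heightCutoff M (x 2) * angularRate (x 0 ^ 2 + x 1 ^ 2) * x 0 * plateauZDeriv (x 2) = 0
      rw [this]
      ring
  have h2 : spiralForm M 2 x * (10 * stepDeriv (10 * x 0 + 1 / 2))
      * (plateauYDeriv (x 1) * plateauZ (x 2))
      = -M * (10 * stepDeriv (10 * x 0 + 1 / 2)) * (8 * M * stepDeriv (8 * M * x 2))
      * (10 * stepDeriv (10 * x 1 - 17 / 2)) := by
    change 8 * M * stepDeriv (8 * M * x 2) * spiralHeight M x * (10 * stepDeriv (10 * x 0 + 1 / 2))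
      * (plateauYDeriv (x 1) * plateauZ (x 2)) = _
    by_cases hz : stepDeriv (8 * M * x 2) = 0
    · rw [hz]; ring
    by_cases hx : stepDeriv (10 * x 0 + 1 / 2) = 0
    · rw [hx]; ring
    have hz0 : 0 ≤ 8 * M * x 2 := by
      by_contra h; exact hz (stepDeriv_of_nonpos (not_le.1 h).le)
    have hz1 : 8 * M * x 2 ≤ 1 := by
      by_contra h; exact hz (stepDeriv_of_one_le (not_le.1 h).le)
    have hx0 : -(1 / 20) ≤ x 0 := by
      by_contra h; exact hx (stepDeriv_of_nonpos (by linarith))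
    have hx1 : x 0 ≤ 1 / 20 := by
      by_contra h; exact hx (stepDeriv_of_one_le (by linarith))
    have hz2 : |x 2| ≤ 1 / 10 := by
      rw [abs_le]
      constructor <;> nlinarith
    rw [plateauZ_eq_one hz2, mul_one]
    rcases le_or_gt (x 1) (2 / 5) with hy | hy
    · have e : stepDeriv (10 * x 1 - 17 / 2) = 0 := stepDeriv_of_nonpos (by linarith)
      rcases le_or_gt (x 1) (1 / 10) with hy' | hy'
      · rw [plateauYDeriv_eq_zero (Or.inl hy'), e]; ring
      · rw [spiralHeight_eq_zero_of_le hM0.le (by nlinarith), e]; ring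
    · have e : stepDeriv (10 / 3 * x 1 - 1 / 3) = 0 := stepDeriv_of_one_le (by linarith)
      rw [plateauYDeriv, e]
      rcases le_or_gt (x 1) (17 / 20) with hy' | hy'
      · rw [stepDeriv_of_nonpos (x := 10 * x 1 - 17 / 2) (by linarith)]; ring
      · rw [spiralHeight_eq hM hy'.le]; ring
  linear_combination h2 - 10 * stepDeriv (10 * x 0 + 1 / 2) * plateauY (x 1) * h1

lemma integral_stepDeriv : ∫ t, stepDeriv t = 1 := by
  have hint : Integrable stepDeriv := by
    refine contDiff_stepDeriv.continuous.integrable_of_hasCompactSupport ?_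
    refine HasCompactSupport.of_support_subset_isCompact (isCompact_Icc (a := (0 : ℝ)) (b := 1)) ?_
    intro x hx
    by_contra hn
    rw [mem_Icc, not_and_or, not_le, not_le] at hn
    exact hx (hn.elim (fun h => stepDeriv_of_nonpos h.le) fun h => stepDeriv_of_one_le h.le)
  have h0 : Tendsto Real.smoothTransition atBot (𝓝 0) :=
    tendsto_const_nhds.congr' (by
      filter_upwards [Iic_mem_atBot 0] with x hx
      exact (Real.smoothTransition.zero_of_nonpos hx).symm)
  have h1 : Tendsto Real.smoothTransition atTop (𝓝 1) :=
    tendsto_const_nhds.congr' (by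
      filter_upwards [Ici_mem_atTop 1] with x hx
      exact (Real.smoothTransition.one_of_one_le hx).symm)
  rw [integral_of_hasDerivAt_of_tendsto hasDerivAt_step hint h0 h1, sub_zero]

lemma integral_mul_stepDeriv {a : ℝ} (ha : 0 < a) (b : ℝ) :
    ∫ t, a * stepDeriv (a * t + b) = 1 := by
  rw [integral_const_mul, Measure.integral_comp_mul_left (fun t => stepDeriv (t + b)) a,
    integral_add_right_eq_self stepDeriv b, integral_stepDeriv, abs_of_pos (inv_pos.2 ha)]
  simp [ha.ne']

lemma integral_spiralDomain {M : ℝ} (hM : 20 ≤ M) :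
    ∫ x in spiralDomain M, sgrad (linkingPrimitive M) x 1 = -M := by
  have hM0 : 0 < M := by linarith
  rw [setIntegral_eq_integral_of_forall_compl_eq_zero]
  · obtain ⟨g, hg⟩ : ∃ g : Param → ℝ, g = fun p =>
        (-M * (10 * stepDeriv (10 * p.1.1 + 1 / 2)) * (10 * stepDeriv (10 * p.1.2 + -(17 / 2))))
          * (8 * M * stepDeriv (8 * M * p.2 + 0)) := ⟨_, rfl⟩
    have h : ∀ x : Space3, sgrad (linkingPrimitive M) x 1 = g (paramEquiv x) := by
      intro x
      rw [sgrad_linkingPrimitive, hg]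
      change _ = (-M * (10 * stepDeriv (10 * x 0 + 1 / 2)) *
            (10 * stepDeriv (10 * x 1 + -(17 / 2)))) * (8 * M * stepDeriv (8 * M * x 2 + 0))
      rw [add_zero, ← sub_eq_add_neg]
      ring
    rw [integral_congr_ae (Eventually.of_forall h),
      measurePreserving_paramEquiv.integral_comp measurableEmbedding_paramEquiv g, hg]
    refine (integral_prod_mul (μ := (volume : Measure (ℝ × ℝ))) (ν := (volume : Measure ℝ))
      (fun q : ℝ × ℝ => -M * (10 * stepDeriv (10 * q.1 + 1 / 2))
        * (10 * stepDeriv (10 * q.2 + -(17 / 2))))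
      (fun t => 8 * M * stepDeriv (8 * M * t + 0))).trans ?_
    have h2 := integral_prod_mul (μ := (volume : Measure ℝ)) (ν := (volume : Measure ℝ))
      (fun t => -M * (10 * stepDeriv (10 * t + 1 / 2)))
      (fun t => 10 * stepDeriv (10 * t + -(17 / 2)))
    rw [← Measure.volume_eq_prod] at h2
    rw [h2, integral_const_mul, integral_mul_stepDeriv (by norm_num),
      integral_mul_stepDeriv (by norm_num), integral_mul_stepDeriv (by positivity)]
    ring
  · intro x hx
    rw [← det3_spiralForm hM]
    rcases sgrad_eq_zero_of_notMem_tube (fun h => hx (tube_subset_spiralDomain hM h)) with h | h <;>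
      simp [det3, h]

/-! ### The counterexample -/

theorem mainTheorem3 :
    ∃ C c : ℝ, 0 < C ∧ 0 < c ∧ ∀ N : ℕ, ∃ U : Set Space3,
      IsSmoothBallDomain U ∧
      (Measure.euclideanHausdorffMeasure 2 : Measure Space3) (frontier U) ≤ ENNReal.ofReal C ∧
      ∀ F : Space3 → Space3,
        (∃ K : NNReal, LipschitzOnWith K F (Metric.closedBall 0 1)) →
        MapsTo F (Metric.closedBall 0 1) (closure U) →
        MapsTo F (Metric.sphere 0 1) (frontier U) →
        HasBoundaryDegree F U 1 →
        ∀ Ω : Set Space3, IsFullDiffSet F (Metric.closedBall 0 1) Ω →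
          ENNReal.ofReal (c * Real.sqrt N) ≤ kDilation 2 F (Metric.closedBall 0 1) Ω := by
  obtain ⟨C, hC, hCU⟩ := exists_area_bound
  obtain ⟨L, hL, hL', hL''⟩ := exists_step_bound
  obtain ⟨C₂, hC₂, hC₂'⟩ := exists_wedgeNorm_le
  set C₁ := 25 * L ^ 2 + 2 * (4 * (32 * L ^ 2 + 20 * L * L)) with hC₁
  have hC₁0 : 0 ≤ C₁ := by positivity
  set A := 216 * Real.pi * (C₁ * C₂ + 1) with hA
  have hA0 : 0 < A := by have := Real.pi_pos; positivity
  refine ⟨C, 1 / √A, hC, by positivity, fun N => ?_⟩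
  -- the shift by `20` makes the fingers thin enough for the tube to lie in the domain
  have hM : (20 : ℝ) ≤ N + 20 := by linarith [N.cast_nonneg (α := ℝ)]
  generalize hMN : (N : ℝ) + 20 = M at hM
  refine ⟨spiralDomain M, isSmoothBallDomain_spiralDomain M, hCU M (by linarith), ?_⟩
  rintro F ⟨K, hF⟩ hFU hFS hdeg Ω hΩ
  by_cases htop : kDilation 2 F (closedBall 0 1) Ω = ⊤
  · rw [htop]; exact le_top
  rw [ENNReal.ofReal_le_iff_le_toReal htop]
  set D := (kDilation 2 F (closedBall 0 1) Ω).toReal with hDdef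
  have hD : ∀ p ∈ Ω, extPowNorm 2 (fderivWithin ℝ F (closedBall 0 1) p) ≤ D := by
    intro p hp
    rw [← ENNReal.ofReal_le_iff_le_toReal htop]
    exact le_iSup₂ (f := fun p (_ : p ∈ Ω) =>
      ENNReal.ofReal (extPowNorm 2 (fderivWithin ℝ F (closedBall 0 1) p))) p hp
  have hmain := abs_integral_le_of_degree_one (isOpen_spiralDomain M) (contDiff_spiralForm M)
    contDiff_tubeStep contDiff_plateau (contDiff_linkingPrimitive M) (det3_spiralForm hM)
    isCompact_tube (tube_subset_spiralDomain hM) (fun x hx => wedge2_eq_zero_of_notMem_tube hx)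
    (fun x hx => curlNorm_spiralForm_le hL' hL'' (by linarith) hx) hC₂' hF hFU hFS hdeg hΩ hD
  rw [integral_spiralDomain hM, abs_neg, abs_of_pos (by linarith), ← hC₁] at hmain
  have hD0 : 0 ≤ D := ENNReal.toReal_nonneg
  have hNA : (N : ℝ) ≤ A * D ^ 2 := by
    have : 0 ≤ 216 * Real.pi * D ^ 2 := by have := Real.pi_pos; positivity
    rw [hA]
    nlinarith
  have h1 : √(N : ℝ) ≤ √A * D := by
    have := Real.sqrt_le_sqrt hNA
    rwa [Real.sqrt_mul hA0.le, Real.sqrt_sq hD0] at this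
  rw [one_div_mul_eq_div, div_le_iff₀ (Real.sqrt_pos.2 hA0)]
  linarith
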